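/- **Theorem (Existence for the Galerkin scheme).** *Setting.* Let $d\ge 1$, $n\ge 2$, let $\lambda,\tau,\varepsilon>0$, $M_1,\dots,M_n>0$ and $z_1,\dots,z_n\in\mathbb R$. For $\rho\in[0,\infty)^n\setminus\{0\}$ put $c_{\rm tot}(\rho)=\sum_i\rho_i/M_i$, $c_i=\rho_i/M_i$ and $x_i=\rho_i/(c_{\rm tot}M_i)$. Let $k_{ij}=k_{ji}\ge 0$ be coefficients that may depend continuously on $c_{\rm tot}\in(0,\infty)$ (in particular, they may be constants). Put $A_{ii}(\rho)=\sum_{\ell\ne i}k_{i\ell}\rho_\ell$, $A_{ij}(\rho)=-k_{ij}\rho_i$ for $i\neq j$, and, for $i,j\le n-1$ and $\rho\in(0,1)^n$, $$C_{ij}=\frac{A_{ij}}{\rho_i}-\frac{A_{in}}{\rho_i}-\frac{A_{nj}}{\rho_n}+\frac{A_{nn}}{\rho_n},\qquad B=c_{\rm tot}\,C^{-1}.$$ For $w\in\mathbb R^{n-1}$ and $\varphi\in\mathbb R$, let $\rho(w,\varphi)$ be the unique $\rho\in(0,1)^n$ with $\sum_{i=1}^n\rho_i=1$ and $$w_i=\frac{\log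 x_i}{M_i}-\frac{\log x_n}{M_n}+\Big(\frac{z_i}{M_i}-\frac{z_n}{M_n}\Big)\varphi,\qquad i=1,\dots,n-1;$$ $c_i(w,\varphi)$, $x(w,\varphi)$ and $B(w,\varphi)$ denote the corresponding quantities at $\rho(w,\varphi)$. A prime denotes the first $n-1$ components. *Assumptions.* (A1) $\Omega\subset\mathbb R^d$ is a bounded domain with Lipschitz boundary $\partial\Omega=\Gamma_D\cup\Gamma_N$, $\Gamma_D\cap\Gamma_N=\emptyset$, $\Gamma_N$ is open in $\partial\Omega$, and $\Gamma_D$ has positive surface measure. Let $H^1_D(\Omega)$ be the space of all $u\in H^1(\Omega)$ with zero trace on $\Gamma_D$. (A2) $\rho^0=(\rho^0_1,\dots,\rho^0_n)$ is measurable and nonnegative with $\sum_{i=1}^n\rho_i^0=1$ and $\sum_i\rho_i^0\log\rho_i^0\in L^1(\Omega)$; $f\in L^\infty(\Omega)$; $\Phi_D\in H^1(\Omega)\cap L^\infty(\Omega)$ is a weak solution of $-\lambda\Delta\Phi_D=f$ in $\Omega$, $\nabla\Phi_D\cdot\nu=0$ on $\Gamma_N$. (A3) $\ker A(\rho)^\top=\operatorname{span}\{(1,\dots,1)\}$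 for all $\rho\in[0,\infty)^n\setminus\{0\}$. (A4) $r_i\in C^0([0,1]^n)$, $\sum_{i=1}^n r_i=0$ on $[0,1]^n$, and $\sum_{i=1}^n r_i(x)\log x_i/M_i\le 0$ for all $x\in(0,1]^n$. Let $\Phi^0\in H^1(\Omega)$ be the weak solution of $-\lambda\Delta\Phi^0=\sum_i z_i\rho_i^0/M_i+f$ in $\Omega$, $\Phi^0=\Phi_D$ on $\Gamma_D$, $\nabla\Phi^0\cdot\nu=0$ on $\Gamma_N$. Let $V_N=\operatorname{span}\{v^{(1)},\dots,v^{(N)}\}$ with $v^{(j)}\in H^1(\Omega;\mathbb R^{n-1})\cap L^\infty(\Omega;\mathbb R^{n-1})$ and $P_N=\operatorname{span}\{\theta^{(1)},\dots,\theta^{(N)}\}$ with $\theta^{(j)}\in H^1_D(\Omega)$ (for example, the first $N$ elements of orthonormal bases of $H^1(\Omega;\mathbb R^{n-1})$ and $H^1_D(\Omega)$). Put $w_{D,i}=(z_i/M_i-z_n/M_n)\Phi_D$. *Scheme.* Given $\rho^{k-1}$, a solution of the $k$-th time step is a pair $(w^k,\Phi^k)$ with $u^k:=w^k-w_D\in V_N$,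 $\Phi^k-\Phi_D\in P_N$ and, with $\rho^k=\rho(w^k,\Phi^k)$, $c_i^k=\rho_i^k/M_i$ and $x^k=x(w^k,\Phi^k)$, $$\frac1\tau\int_\Omega\big((\rho^k)'-(\rho^{k-1})'\big)\cdot\phi\,dy+\varepsilon\int_\Omega u^k\cdot\phi\,dy+\int_\Omega\nabla\phi:B(w^k,\Phi^k)\nabla w^k\,dy=\int_\Omega r'(x^k)\cdot\phi\,dy,$$ $$\lambda\int_\Omega\nabla\Phi^k\cdot\nabla\theta\,dy=\int_\Omega\Big(\sum_{i=1}^n z_ic_i^k+f\Big)\theta\,dy$$ for all $\phi\in V_N$ and $\theta\in P_N$. *Claim.* Let $k\ge1$, and let $(\rho^{k-1},\Phi^{k-1})$ be obtained from $(\rho^0,\Phi^0)$ by $k-1$ steps of the scheme. Then the $k$-th time step has a solution $(w^k,\Phi^k)$ such that $0<\rho_i^k<1$ for $i=1,\dots,n$, $\sum_{i=1}^n\rho_i^k=1$ in $\Omega$, and $$H(\rho^k)+\tau\int_\Omega\nabla(w^k-w_D):B(w^k,\Phi^k)\nabla w^k\,dy+\varepsilon\tau\int_\Omega|w^k-w_D|^2\,dy\le\tau\int_\Omega\sum_{i=1}^n\frac{z_i}{M_i}r_i(x^k)(\Phi^k-\Phi_D)\,dy+H(\rho^{k-1}),$$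 where $$H(\rho^j)=\int_\Omega\Big(c_{\rm tot}(\rho^j)\sum_{i=1}^n x^j_i\log x^j_i+\frac\lambda2|\nabla(\Phi^j-\Phi_D)|^2\Big)dy,\qquad x^j_i=\frac{\rho^j_i}{c_{\rm tot}(\rho^j)M_i},\quad 0\log0=0;$$ all the integrals exist. -/

import Mathlib

open MeasureTheory Filter Topology
open scoped ContDiff

noncomputable section

namespace PMS

/-! ### Lipschitz domains and first-order Sobolev spaces -/

/-- `Ω` has Lipschitz boundary: near every boundary point, and after a rotation that turns the unit
vector `e` into the vertical direction, `Ω` is the strict subgraph of a Lipschitz function of the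
component `y - ⟪e, y⟫ e` of `y` orthogonal to `e`. -/
def HasLipschitzBoundary {d : ℕ} (Ω : Set (EuclideanSpace ℝ (Fin d))) : Prop :=
  ∀ p ∈ frontier Ω, ∃ (e : EuclideanSpace ℝ (Fin d)) (K : NNReal)
    (γ : EuclideanSpace ℝ (Fin d) → ℝ) (R : ℝ),
    ‖e‖ = 1 ∧ LipschitzWith K γ ∧ 0 < R ∧
      ∀ y ∈ Metric.ball p R, (y ∈ Ω ↔ inner ℝ e y < γ (y - inner ℝ e y • e))

/-- `G` is a weak gradient of `u` in the open set `Ω`. -/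
def HasWeakGrad {d : ℕ} (Ω : Set (EuclideanSpace ℝ (Fin d)))
    (u : EuclideanSpace ℝ (Fin d) → ℝ)
    (G : EuclideanSpace ℝ (Fin d) → EuclideanSpace ℝ (Fin d)) : Prop :=
  ∀ φ : EuclideanSpace ℝ (Fin d) → ℝ, ContDiff ℝ ∞ φ → HasCompactSupport φ → tsupport φ ⊆ Ω →
    ∀ a : EuclideanSpace ℝ (Fin d),
      ∫ y in Ω, u y * fderiv ℝ φ y a = - ∫ y in Ω, inner ℝ (G y) a * φ y

/-- `u ∈ H¹(Ω)`. -/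
def MemH1 {d : ℕ} (Ω : Set (EuclideanSpace ℝ (Fin d)))
    (u : EuclideanSpace ℝ (Fin d) → ℝ) : Prop :=
  MemLp u 2 (volume.restrict Ω) ∧ ∃ G : EuclideanSpace ℝ (Fin d) → EuclideanSpace ℝ (Fin d),
    MemLp G 2 (volume.restrict Ω) ∧ HasWeakGrad Ω u G

/-- The weak gradient `∇u` of `u ∈ H¹(Ω)` (determined up to a null set of `Ω`). -/
def weakGrad {d : ℕ} (Ω : Set (EuclideanSpace ℝ (Fin d)))
    (u : EuclideanSpace ℝ (Fin d) → ℝ) :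
    EuclideanSpace ℝ (Fin d) → EuclideanSpace ℝ (Fin d) :=
  Classical.epsilon fun G => MemLp G 2 (volume.restrict Ω) ∧ HasWeakGrad Ω u G

/-- `u ∈ H¹_D(Ω)`: `u ∈ H¹(Ω)` has trace zero on `Γ ⊆ ∂Ω`. The trace is the `L²(∂Ω)`-limit
(for the `(d-1)`-dimensional Hausdorff measure) of the boundary values of smooth functions that
approximate `u` in `H¹(Ω)`. -/
def MemH1D {d : ℕ} (Ω Γ : Set (EuclideanSpace ℝ (Fin d)))
    (u : EuclideanSpace ℝ (Fin d) → ℝ) : Prop :=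
  MemH1 Ω u ∧ ∃ φ : ℕ → EuclideanSpace ℝ (Fin d) → ℝ,
    (∀ j, ContDiff ℝ ∞ (φ j)) ∧
    Tendsto (fun j => eLpNorm (fun y => φ j y - u y) 2 (volume.restrict Ω)) atTop (𝓝 0) ∧
    Tendsto (fun j => eLpNorm (fun y => gradient (φ j) y - weakGrad Ω u y) 2
      (volume.restrict Ω)) atTop (𝓝 0) ∧
    Tendsto (fun j => eLpNorm (φ j) 2
      ((Measure.hausdorffMeasure ((d : ℝ) - 1)).restrict Γ)) atTop (𝓝 0)

/-! ### The mixture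

There are `n = m + 1` species; the last one is `Fin.last m`, and the first `n - 1` ones are
`Fin.castSucc i` with `i : Fin m`. -/

/-- Material data: molar masses `M i`, charges `z i`, (reciprocal) Maxwell–Stefan diffusivities
`k i j`, which may depend on the total concentration, and production rates `r i`, functions of the
molar fractions. -/
structure Mixture (m : ℕ) where
  M : Fin (m + 1) → ℝ
  z : Fin (m + 1) → ℝ
  k : Fin (m + 1) → Fin (m + 1) → ℝ → ℝ
  r : Fin (m + 1) → (Fin (m + 1) → ℝ) → ℝ

namespace Mixture

variable {m : ℕ} (S : Mixture m)

/-- Total concentration `∑ ρ_i / M_i`. -/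
def ctot (ρ : Fin (m + 1) → ℝ) : ℝ := ∑ i, ρ i / S.M i

/-- Molar fractions `x_i = ρ_i / (c_tot M_i)`. -/
def molarFrac (ρ : Fin (m + 1) → ℝ) (i : Fin (m + 1)) : ℝ := ρ i / (S.ctot ρ * S.M i)

/-- The Maxwell–Stefan matrix `A(ρ)`. -/
def A (ρ : Fin (m + 1) → ℝ) : Matrix (Fin (m + 1)) (Fin (m + 1)) ℝ :=
  Matrix.of fun i j =>
    if i = j then ∑ l ∈ Finset.univ.erase i, S.k i l (S.ctot ρ) * ρ l
    else - (S.k i j (S.ctot ρ) * ρ i)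

/-- The matrix `C(ρ)` of the flux relation `D_i/ρ_i - D_n/ρ_n = -∑_{j<n} C_ij J_j`. -/
def C (ρ : Fin (m + 1) → ℝ) : Matrix (Fin m) (Fin m) ℝ :=
  Matrix.of fun i j =>
    S.A ρ i.castSucc j.castSucc / ρ i.castSucc
      - S.A ρ i.castSucc (Fin.last m) / ρ i.castSucc
      - S.A ρ (Fin.last m) j.castSucc / ρ (Fin.last m)
      + S.A ρ (Fin.last m) (Fin.last m) / ρ (Fin.last m)

/-- The mobility (Onsager) matrix `B(ρ) = c_tot C(ρ)⁻¹`. -/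
def B (ρ : Fin (m + 1) → ℝ) : Matrix (Fin m) (Fin m) ℝ := S.ctot ρ • (S.C ρ)⁻¹

/-- The number `z_i/M_i - z_n/M_n`. -/
def relCharge (i : Fin m) : ℝ :=
  S.z i.castSucc / S.M i.castSucc - S.z (Fin.last m) / S.M (Fin.last m)

/-- `ρ ∈ (0,1)^n` has total mass one, and its entropy variables at the potential `φ` are `w`. -/
def IsDensity (w : Fin m → ℝ) (φ : ℝ) (ρ : Fin (m + 1) → ℝ) : Prop :=
  (∀ i, 0 < ρ i ∧ ρ i < 1) ∧ ∑ i, ρ i = 1 ∧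
    ∀ i : Fin m, w i =
      Real.log (S.molarFrac ρ i.castSucc) / S.M i.castSucc
        - Real.log (S.molarFrac ρ (Fin.last m)) / S.M (Fin.last m)
        + S.relCharge i * φ

/-- The density vector `ρ(w, φ)`, that is, the inverse of `ρ ↦ w` at the potential `φ`. -/
def density (w : Fin m → ℝ) (φ : ℝ) : Fin (m + 1) → ℝ := Classical.epsilon (S.IsDensity w φ)

/-- Positive molar masses; nonnegative, symmetric diffusivities, continuous in the total
concentration. -/
structure Admissible : Prop where
  M_pos : ∀ i, 0 < S.M i
  k_symm : ∀ i j c, 0 < c → S.k i j c = S.k j i c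
  k_nonneg : ∀ i j c, 0 < c → 0 ≤ S.k i j c
  k_cont : ∀ i j, ContinuousOn (S.k i j) (Set.Ioi 0)

/-- Diffusion matrix: `ker A(ρ)ᵀ = span {(1,…,1)}` for nonnegative `ρ ≠ 0` (note `A(0) = 0`). -/
def DiffusionAssumption : Prop :=
  ∀ ρ : Fin (m + 1) → ℝ, (∀ i, 0 ≤ ρ i) → ρ ≠ 0 →
    LinearMap.ker (S.A ρ).transpose.mulVecLin = Submodule.span ℝ {fun _ => (1 : ℝ)}

/-- Production rates: continuous on `[0,1]^n`, of vanishing sum, and dissipative. -/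
structure ProductionAssumption : Prop where
  cont : ∀ i, ContinuousOn (S.r i) (Set.Icc 0 1)
  sum_zero : ∀ x ∈ Set.Icc (0 : Fin (m + 1) → ℝ) 1, ∑ i, S.r i x = 0
  dissipative : ∀ x : Fin (m + 1) → ℝ, (∀ i, 0 < x i ∧ x i ≤ 1) →
    ∑ i, S.r i x * Real.log (x i) / S.M i ≤ 0

end Mixture

/-! ### The initial-boundary value problem and its Galerkin scheme -/

/-- All data of the problem and of its discretization: the mixture, the domain `Ω` with Dirichlet
part `ΓD` and Neumann part `ΓN` of the boundary, scaled permittivity `lam`, background charge `f`,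
boundary potential `ΦD`, initial densities `ρ0` and initial potential `Φ0`, functions spanning the
Galerkin spaces, time step size `τ` and regularization parameter `ε`. -/
structure Problem (d m N : ℕ) extends Mixture m where
  Ω : Set (EuclideanSpace ℝ (Fin d))
  ΓD : Set (EuclideanSpace ℝ (Fin d))
  ΓN : Set (EuclideanSpace ℝ (Fin d))
  lam : ℝ
  f : EuclideanSpace ℝ (Fin d) → ℝ
  ΦD : EuclideanSpace ℝ (Fin d) → ℝ
  ρ0 : EuclideanSpace ℝ (Fin d) → Fin (m + 1) → ℝ
  Φ0 : EuclideanSpace ℝ (Fin d) → ℝ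
  v : Fin N → EuclideanSpace ℝ (Fin d) → Fin m → ℝ
  θ : Fin N → EuclideanSpace ℝ (Fin d) → ℝ
  τ : ℝ
  ε : ℝ

namespace Problem

variable {d m N : ℕ} (S : Problem d m N)

/-- Bounded Lipschitz domain, with `∂Ω` the disjoint union of `ΓD`, which has positive surface
measure, and `ΓN`, which is relatively open. -/
structure DomainAssumption : Prop where
  isOpen : IsOpen S.Ω
  connected : IsConnected S.Ω
  bounded : Bornology.IsBounded S.Ω
  lipschitz : HasLipschitzBoundary S.Ω
  boundary : S.ΓD ∪ S.ΓN = frontier S.Ω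
  disjoint : Disjoint S.ΓD S.ΓN
  relOpen : ∃ U, IsOpen U ∧ S.ΓN = frontier S.Ω ∩ U
  meas_pos : 0 < Measure.hausdorffMeasure ((d : ℝ) - 1) S.ΓD

/-- Given functions: initial densities and boundary potential; the latter solves
`-lam Δ ΦD = f` in `Ω`, `∇ΦD · ν = 0` on `ΓN`, in the weak sense. -/
structure DataAssumption : Prop where
  ρ0_meas : ∀ i, AEMeasurable (fun y => S.ρ0 y i) (volume.restrict S.Ω)
  ρ0_nonneg : ∀ᵐ y ∂(volume.restrict S.Ω), ∀ i, 0 ≤ S.ρ0 y i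
  ρ0_sum : ∀ᵐ y ∂(volume.restrict S.Ω), ∑ i, S.ρ0 y i = 1
  ρ0_entropy : IntegrableOn (fun y => ∑ i, S.ρ0 y i * Real.log (S.ρ0 y i)) S.Ω
  f_bdd : MemLp S.f ⊤ (volume.restrict S.Ω)
  ΦD_H1 : MemH1 S.Ω S.ΦD
  ΦD_bdd : MemLp S.ΦD ⊤ (volume.restrict S.Ω)
  ΦD_weak : ∀ θ, MemH1D S.Ω S.ΓD θ →
    S.lam * ∫ y in S.Ω, inner ℝ (weakGrad S.Ω S.ΦD y) (weakGrad S.Ω θ y)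
      = ∫ y in S.Ω, S.f y * θ y

/-- `Φ0 ∈ H¹(Ω)` is the weak solution of the Poisson equation with the initial densities and the
mixed boundary conditions. -/
structure IsInitialPotential : Prop where
  mem : MemH1 S.Ω S.Φ0
  boundary : MemH1D S.Ω S.ΓD (fun y => S.Φ0 y - S.ΦD y)
  weak : ∀ θ, MemH1D S.Ω S.ΓD θ →
    S.lam * ∫ y in S.Ω, inner ℝ (weakGrad S.Ω S.Φ0 y) (weakGrad S.Ω θ y)
      = ∫ y in S.Ω, (∑ i, S.z i * (S.ρ0 y i / S.M i) + S.f y) * θ y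

/-- The functions that span the Galerkin spaces lie in `H¹(Ω; ℝ^{n-1}) ∩ L^∞` and `H¹_D(Ω)`. -/
structure GalerkinAssumption : Prop where
  v_H1 : ∀ j i, MemH1 S.Ω (fun y => S.v j y i)
  v_bdd : ∀ j i, MemLp (fun y => S.v j y i) ⊤ (volume.restrict S.Ω)
  θ_H1D : ∀ j, MemH1D S.Ω S.ΓD (S.θ j)

/-- The Galerkin space `V_N`. -/
def V : Submodule ℝ (EuclideanSpace ℝ (Fin d) → Fin m → ℝ) :=
  Submodule.span ℝ (Set.range S.v)

/-- The Galerkin space `P_N`. -/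
def P : Submodule ℝ (EuclideanSpace ℝ (Fin d) → ℝ) :=
  Submodule.span ℝ (Set.range S.θ)

/-- `w_{D,i} = (z_i/M_i - z_n/M_n) ΦD`. -/
def wD (y : EuclideanSpace ℝ (Fin d)) (i : Fin m) : ℝ := S.relCharge i * S.ΦD y

/-- The density field `ρ(w, Φ)`. -/
def rho (w : EuclideanSpace ℝ (Fin d) → Fin m → ℝ) (Φ : EuclideanSpace ℝ (Fin d) → ℝ)
    (y : EuclideanSpace ℝ (Fin d)) : Fin (m + 1) → ℝ := S.density (w y) (Φ y)

/-- The integrand `∇φ : B(ρ) ∇w = ∑_{i,j<n} B_ij(ρ) ∇φ_i · ∇w_j`. -/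
def diffusion (ρ : EuclideanSpace ℝ (Fin d) → Fin (m + 1) → ℝ)
    (φ w : EuclideanSpace ℝ (Fin d) → Fin m → ℝ) (y : EuclideanSpace ℝ (Fin d)) : ℝ :=
  ∑ i, ∑ j, S.B (ρ y) i j *
    inner ℝ (weakGrad S.Ω (fun y' => φ y' i) y) (weakGrad S.Ω (fun y' => w y' j) y)

/-- Entropy density `c_tot ∑ x_i log x_i + (lam/2) |∇(Φ - ΦD)|²`. -/
def entropyDensity (ρ : EuclideanSpace ℝ (Fin d) → Fin (m + 1) → ℝ)
    (Φ : EuclideanSpace ℝ (Fin d) → ℝ) (y : EuclideanSpace ℝ (Fin d)) : ℝ :=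
  S.ctot (ρ y) * ∑ i, S.molarFrac (ρ y) i * Real.log (S.molarFrac (ρ y) i)
    + S.lam / 2 * ‖weakGrad S.Ω (fun y' => Φ y' - S.ΦD y') y‖ ^ 2

/-- The entropy `H`. -/
def entropy (ρ : EuclideanSpace ℝ (Fin d) → Fin (m + 1) → ℝ)
    (Φ : EuclideanSpace ℝ (Fin d) → ℝ) : ℝ :=
  ∫ y in S.Ω, S.entropyDensity ρ Φ y

/-- `(w, Φ)` solves one time step of the regularized implicit Euler Galerkin scheme, where `ρprev`
are the densities of the previous time step. -/
structure IsStep (ρprev : EuclideanSpace ℝ (Fin d) → Fin (m + 1) → ℝ)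
    (w : EuclideanSpace ℝ (Fin d) → Fin m → ℝ) (Φ : EuclideanSpace ℝ (Fin d) → ℝ) : Prop where
  mem_V : w - S.wD ∈ S.V
  mem_P : Φ - S.ΦD ∈ S.P
  integrable : ∀ φ ∈ S.V, IntegrableOn (S.diffusion (S.rho w Φ) φ w) S.Ω
  mass : ∀ φ ∈ S.V,
    1 / S.τ * (∫ y in S.Ω, ∑ i : Fin m,
        (S.rho w Φ y i.castSucc - ρprev y i.castSucc) * φ y i)
      + S.ε * (∫ y in S.Ω, ∑ i : Fin m, (w y i - S.wD y i) * φ y i)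
      + ∫ y in S.Ω, S.diffusion (S.rho w Φ) φ w y
    = ∫ y in S.Ω, ∑ i : Fin m, S.r i.castSucc (S.molarFrac (S.rho w Φ y)) * φ y i
  poisson : ∀ θ ∈ S.P,
    S.lam * (∫ y in S.Ω, inner ℝ (weakGrad S.Ω Φ y) (weakGrad S.Ω θ y))
      = ∫ y in S.Ω, (∑ i, S.z i * (S.rho w Φ y i / S.M i) + S.f y) * θ y

/-- `IsIterate k ρ Φ`: starting from the initial data, `k` steps of the scheme can produce the
densities `ρ` and the potential `Φ`. -/
inductive IsIterate : ℕ → (EuclideanSpace ℝ (Fin d) → Fin (m + 1) → ℝ) →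
    (EuclideanSpace ℝ (Fin d) → ℝ) → Prop
  | zero : IsIterate 0 S.ρ0 S.Φ0
  | succ {k : ℕ} {ρ : EuclideanSpace ℝ (Fin d) → Fin (m + 1) → ℝ}
      {Φ : EuclideanSpace ℝ (Fin d) → ℝ} {w : EuclideanSpace ℝ (Fin d) → Fin m → ℝ}
      {Φ' : EuclideanSpace ℝ (Fin d) → ℝ} :
      IsIterate k ρ Φ → S.IsStep ρ w Φ' → IsIterate (k + 1) (S.rho w Φ') Φ'

end Problem

end PMS

end

noncomputable section

namespace PMS

/-! ### Brouwer's theorem by a volume argument, and zeros of coercive vector fields. -/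

section Brouwer

variable {E : Type*} [NormedAddCommGroup E] [InnerProductSpace ℝ E] [FiniteDimensional ℝ E]

/-! The unknowns of a time step are the 2N coefficients `x : Coeff N` of u = w - w_D and of Φ - Φ_D.
The mass equations times τ plus the Poisson equation give one form `residual ρp x ξ`, continuous in
x and linear in the test coefficients ξ, so that a time step is a zero of a continuous vector field
on ℝ^{2N}. The entropy variables are unconstrained: every (w, φ) belongs to exactly one density in
the open simplex (`isDensity_density`), which gives the bounds on ρ for free.

The heart is the entropy inequality `le_residual_self`, which holds for every x and not only for
solutions. Take ξ = x. By convexity of the mixing entropy (`mixEntropy_sub_le`) the density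
increments, tested with u, dominate the increment of the mixing entropy plus the integral of (charge
increment)·(Φ - Φ_D). The latter cancels against the charge in the Poisson residual, once the
Poisson equation of the previous step is inserted; there remains λ∫∇(Φ - Φ^{k-1})·∇(Φ - Φ_D), which
dominates the increment of the electric energy. Mixing entropy, production rates and mobilities are
bounded, and B is positive semidefinite (`exists_B_bound`), whence residual x x ≥ Q(x) - C with Q =
`coercForm`, that is, (τε/2)‖u‖² + (λ/2)‖∇(Φ - Φ_D)‖².

The spanning functions need not be independent, so Q may vanish at some ξ ≠ 0. Then, almost
everywhere, u = 0 and Φ - Φ_D has zero gradient; as its trace vanishes on a set of positive surface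
measure, it is zero (`MemH1D.ae_eq_zero`), and the residual does not see ξ. This degenerate
coercivity suffices for a zero (`exists_zero_of_coercive`). At the zero, `le_residual_self` and the
dissipativity of the production rates (`power_le`) give the claimed inequality. -/

lemma exists_polynomial_det_one_add_smul (A : E →L[ℝ] E) :
    ∃ p : Polynomial ℝ, p.natDegree ≤ Module.finrank ℝ E ∧
      ∀ t : ℝ, p.eval t = (ContinuousLinearMap.id ℝ E + t • A).det := by
  classical
  let b := Module.finBasis ℝ E
  let MA := LinearMap.toMatrix b b (A : E →ₗ[ℝ] E)
  refine ⟨Matrix.det ((Polynomial.X : Polynomial ℝ) • MA.map Polynomial.C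
    + (1 : Matrix (Fin (Module.finrank ℝ E)) (Fin (Module.finrank ℝ E)) ℝ).map Polynomial.C), ?_, ?_⟩
  · simpa using Polynomial.natDegree_det_X_add_C_le MA 1
  · intro t
    rw [ContinuousLinearMap.det, ← LinearMap.det_toMatrix b, ← Polynomial.coe_evalRingHom,
      RingHom.map_det]
    congr 1
    ext i j
    by_cases hij : i = j <;>
      (simp [MA, hij, LinearMap.toMatrix_apply]; ring)

/-- The closed ball of a Euclidean space has no `C¹` retraction onto its boundary. -/
lemma no_smooth_retraction {ρ : ℝ} (hρ : 0 < ρ) {h : E → E} (hh : ContDiff ℝ 1 h)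
    (hsph : ∀ x, ‖h x‖ = ρ) (hfix : ∀ x, ‖x‖ = ρ → h x = x) : False := by
  borelize E
  set μ : Measure E := Measure.addHaar
  set g : E → E := fun x => h x - x with hg
  have hgC : ContDiff ℝ 1 g := hh.sub contDiff_id
  set A : E → E →L[ℝ] E := fun x => fderiv ℝ g x with hA
  have hAc : Continuous A := hgC.continuous_fderiv one_ne_zero
  obtain ⟨L, hL⟩ : ∃ L : ℝ, ∀ x ∈ Metric.closedBall (0 : E) ρ, ‖A x‖ ≤ L :=
    (isCompact_closedBall (0 : E) ρ).exists_bound_of_continuousOn hAc.continuousOn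
  have hL0 : 0 ≤ L := (norm_nonneg _).trans (hL 0 (by simp [hρ.le]))
  have hlip : ∀ x ∈ Metric.closedBall (0 : E) ρ, ∀ y ∈ Metric.closedBall (0 : E) ρ,
      ‖g x - g y‖ ≤ L * ‖x - y‖ := fun x hx y hy =>
    (convex_closedBall (0 : E) ρ).norm_image_sub_le_of_norm_fderiv_le
      (fun z _ => (hgC.differentiable one_ne_zero) z) (fun z hz => hL z hz) hy hx
  -- The homotopy from the identity to h. For small t it maps the ball bijectively onto itself, so
  -- the integral of its Jacobian is the volume of the ball. The Jacobian is a polynomial in t, so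
  -- the same value results at t = 1, where the Jacobian of h vanishes.
  set f : ℝ → E → E := fun t x => x + t • g x with hf
  have hder : ∀ t x, HasFDerivAt (f t) (ContinuousLinearMap.id ℝ E + t • A x) x := fun t x =>
    (hasFDerivAt_id x).add (((hgC.differentiable one_ne_zero) x).hasFDerivAt.const_smul t)
  -- The second entry makes t • g Lipschitz with constant 1/2 (L + 1, because L may be 0); the first
  -- keeps 1 - t positive.
  set t₀ : ℝ := min (1 / 2) (1 / (2 * (L + 1))) with ht₀
  have ht₀pos : 0 < t₀ := by positivity
  have ht₀L : t₀ * L ≤ 1 / 2 := by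
    have : t₀ ≤ 1 / (2 * (L + 1)) := min_le_right _ _
    calc t₀ * L ≤ 1 / (2 * (L + 1)) * L := by gcongr
      _ ≤ 1 / 2 := by rw [div_mul_eq_mul_div, div_le_div_iff₀ (by positivity) (by norm_num)]; linarith
  have ht₀1 : t₀ ≤ 1 / 2 := min_le_left _ _
  have hvol : ∀ t ∈ Set.Ioc 0 t₀, ∫ x in Metric.ball (0 : E) ρ,
      (ContinuousLinearMap.id ℝ E + t • A x).det ∂μ = μ.real (Metric.ball (0 : E) ρ) := by
    intro t ht
    have htL : t * L ≤ 1 / 2 := (mul_le_mul_of_nonneg_right ht.2 hL0).trans ht₀L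
    have happ : ApproximatesLinearOn (f t)
        ((ContinuousLinearEquiv.refl ℝ E : E ≃L[ℝ] E) : E →L[ℝ] E)
        (Metric.closedBall 0 ρ) (1 / 2) := by
      intro x hx y hy
      have : f t x - f t y - (ContinuousLinearEquiv.refl ℝ E : E →L[ℝ] E) (x - y)
          = t • (g x - g y) := by
        simp only [hf, ContinuousLinearEquiv.coe_refl, ContinuousLinearMap.id_apply, smul_sub]
        abel
      rw [this, norm_smul, Real.norm_of_nonneg ht.1.le]
      calc t * ‖g x - g y‖ ≤ t * (L * ‖x - y‖) := by
            gcongr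
            · exact ht.1.le
            · exact hlip x hx y hy
        _ = (t * L) * ‖x - y‖ := by ring
        _ ≤ (1 / 2 : ℝ) * ‖x - y‖ := by gcongr
        _ = _ := by simp
    have hN : Subsingleton E ∨ (1 / 2 : NNReal) <
        ‖((ContinuousLinearEquiv.refl ℝ E).symm : E →L[ℝ] E)‖₊⁻¹ := by
      rcases subsingleton_or_nontrivial E with h0 | h0
      · exact Or.inl h0
      · right
        have : ‖((ContinuousLinearEquiv.refl ℝ E).symm : E →L[ℝ] E)‖₊ = 1 := by
          exact ContinuousLinearMap.nnnorm_id
        rw [this, inv_one]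
        exact NNReal.half_lt_self one_ne_zero
    have hinj : Set.InjOn (f t) (Metric.ball 0 ρ) :=
      (happ.injOn hN).mono Metric.ball_subset_closedBall
    have hfc : Continuous (f t) := continuous_id.add (hgC.continuous.const_smul t)
    have hconv : ∀ x, f t x = (1 - t) • x + t • h x := fun x => by
      simp only [hf, hg, smul_sub, sub_smul, one_smul]; abel
    have hnorm : ∀ x, ‖f t x‖ ≤ (1 - t) * ‖x‖ + t * ρ := fun x => by
      rw [hconv]
      refine (norm_add_le _ _).trans (le_of_eq ?_)
      rw [norm_smul, norm_smul, hsph, Real.norm_of_nonneg ht.1.le,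
        Real.norm_of_nonneg (by linarith [ht.2])]
    have hsub : f t '' Metric.ball 0 ρ ⊆ Metric.ball 0 ρ := by
      rintro _ ⟨x, hx, rfl⟩
      rw [mem_ball_zero_iff] at hx ⊢
      have h1 : 0 < 1 - t := by linarith [ht.2]
      nlinarith [hnorm x, mul_lt_mul_of_pos_left hx h1]
    -- The image of the open ball is open, as f t is close to the identity. It is also closed
    -- relative to the ball: the image of the closed ball is compact, and the sphere is fixed
    -- pointwise, so it adds no interior points. Connectedness concludes.
    have himg : f t '' Metric.ball 0 ρ = Metric.ball 0 ρ := by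
      refine hsub.antisymm ?_
      have hopen : IsOpen (f t '' Metric.ball 0 ρ) := by
        refine (happ.mono_set Metric.ball_subset_closedBall).open_image
          (ContinuousLinearEquiv.toNonlinearRightInverse _) Metric.isOpen_ball ?_
        exact hN
      have hclosed : IsClosed (f t '' Metric.closedBall 0 ρ) :=
        ((isCompact_closedBall (0 : E) ρ).image hfc).isClosed
      refine (convex_ball (0 : E) ρ).isPreconnected.subset_left_of_subset_union hopen
        hclosed.isOpen_compl ?_ ?_ ?_
      · exact Set.disjoint_compl_right_iff_subset.2 (Set.image_mono Metric.ball_subset_closedBall)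
      · intro y hy
        by_cases hy' : y ∈ f t '' Metric.closedBall 0 ρ
        · left
          obtain ⟨x, hx, rfl⟩ := hy'
          refine ⟨x, ?_, rfl⟩
          by_contra hx'
          have hxρ : ‖x‖ = ρ := le_antisymm (by simpa using hx) (by simpa using hx')
          have : f t x = x := by simp [hf, hg, hfix x hxρ]
          rw [this] at hy
          exact hx' hy
        · exact Or.inr hy'
      · exact ⟨f t 0, hsub ⟨0, by simpa using hρ, rfl⟩, ⟨0, by simpa using hρ, rfl⟩⟩
    -- The determinant is 1 at s = 0 and cannot vanish for s ≤ t because s‖A x‖ ≤ 1/2; its sign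
    -- removes the absolute value in the change of variables.
    have hpos : ∀ x ∈ Metric.ball (0 : E) ρ,
        0 < (ContinuousLinearMap.id ℝ E + t • A x).det := by
      intro x hx
      have hne : ∀ s ∈ Set.Icc 0 t, (ContinuousLinearMap.id ℝ E + s • A x).det ≠ 0 := by
        intro s hs h0
        obtain ⟨v, hv, hv0⟩ := (Submodule.ne_bot_iff _).1
          (LinearMap.bot_lt_ker_of_det_eq_zero h0).ne'
        have hv' : v + s • A x v = 0 := by simpa using hv
        have h1 : ‖v‖ = s * ‖A x v‖ := by
          rw [← Real.norm_of_nonneg hs.1, ← norm_smul, ← norm_neg (s • A x v),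
            ← eq_neg_of_add_eq_zero_left hv']
        have h2 : ‖A x v‖ ≤ L * ‖v‖ := (A x).le_of_opNorm_le (hL x (Metric.ball_subset_closedBall hx)) v
        have h3 : s * ‖A x v‖ ≤ (t * L) * ‖v‖ := by
          calc s * ‖A x v‖ ≤ t * (L * ‖v‖) := mul_le_mul hs.2 h2 (norm_nonneg _) ht.1.le
            _ = _ := by ring
        have h4 : 0 < ‖v‖ := norm_pos_iff.2 hv0
        nlinarith
      obtain ⟨p, -, hp⟩ := exists_polynomial_det_one_add_smul (A x)
      by_contra hneg
      rw [not_lt] at hneg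
      have := intermediate_value_Icc' ht.1.le (p.continuous.continuousOn (s := Set.Icc 0 t))
      obtain ⟨s, hs, hs0⟩ := this (show (0 : ℝ) ∈ Set.Icc (p.eval t) (p.eval 0) by
        rw [hp, hp]; exact ⟨hneg, by simp [ContinuousLinearMap.det]⟩)
      exact hne s hs (by rw [← hp]; exact hs0)
    have := integral_image_eq_integral_abs_det_fderiv_smul μ measurableSet_ball
      (fun x _ => (hder t x).hasFDerivWithinAt) hinj (fun _ => (1 : ℝ))
    rw [himg] at this
    simp only [integral_const, smul_eq_mul, mul_one, measureReal_restrict_apply_univ] at this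
    rw [this]
    exact setIntegral_congr_fun measurableSet_ball fun x hx => (abs_of_pos (hpos x hx)).symm
  set n := Module.finrank ℝ E
  set s : Finset ℕ := Finset.range (n + 1)
  -- Any n + 1 distinct nodes in (0, t₀] determine the Jacobian, a polynomial of degree at most n in
  -- t.
  set v : ℕ → ℝ := fun j => t₀ / (j + 1) with hv
  have hvmem : ∀ j, v j ∈ Set.Ioc 0 t₀ := fun j =>
    ⟨by positivity, div_le_self ht₀pos.le (by linarith [(Nat.cast_nonneg j : (0 : ℝ) ≤ j)])⟩
  have hvinj : Set.InjOn v s := by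
    intro i _ j _ hij
    simp only [hv] at hij
    rw [div_eq_div_iff (by positivity) (by positivity)] at hij
    exact_mod_cast (add_right_cancel (mul_left_cancel₀ ht₀pos.ne' hij)).symm
  have hlag : ∀ x, (ContinuousLinearMap.id ℝ E + (1 : ℝ) • A x).det
      = ∑ j ∈ s, (ContinuousLinearMap.id ℝ E + v j • A x).det
        * (Lagrange.basis s v j).eval 1 := by
    intro x
    obtain ⟨p, hpd, hp⟩ := exists_polynomial_det_one_add_smul (A x)
    have hdeg : p.degree < s.card := by
      refine (Polynomial.degree_le_natDegree).trans_lt ?_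
      rw [Finset.card_range]
      exact_mod_cast Nat.lt_succ_of_le hpd
    have := congrArg (Polynomial.eval 1) (Lagrange.eq_interpolate hvinj hdeg)
    rw [hp, Lagrange.interpolate_apply, Polynomial.eval_finsetSum] at this
    rw [this]
    refine Finset.sum_congr rfl fun j _ => ?_
    rw [Polynomial.eval_mul, Polynomial.eval_C, hp]
  -- ‖h‖ is constant, so the range of Dh(x) is orthogonal to h(x) ≠ 0, and Dh(x) is not onto.
  have hzero : ∀ x ∈ Metric.ball (0 : E) ρ, (ContinuousLinearMap.id ℝ E + (1 : ℝ) • A x).det = 0 := by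
    intro x _
    have hdh : HasFDerivAt h (fderiv ℝ h x) x := ((hh.differentiable one_ne_zero) x).hasFDerivAt
    have hid : ContinuousLinearMap.id ℝ E + (1 : ℝ) • A x = fderiv ℝ h x := by
      have h1 : HasFDerivAt g (fderiv ℝ h x - ContinuousLinearMap.id ℝ E) x :=
        hdh.sub (hasFDerivAt_id x)
      simp [hA, h1.fderiv]
    rw [hid]
    by_contra hne
    have hperp : ∀ u, inner ℝ (h x) (fderiv ℝ h x u) = 0 := by
      intro u
      have h1 := hdh.norm_sq
      have h2 : HasFDerivAt (fun y => ‖h y‖ ^ 2) (0 : E →L[ℝ] ℝ) x := by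
        simp only [hsph]; exact hasFDerivAt_const _ _
      have := congrArg (fun l => l u) (h1.unique h2)
      simpa using this
    have hsurj : Function.Surjective (fderiv ℝ h x) :=
      (LinearMap.equivOfDetNeZero (fderiv ℝ h x : E →ₗ[ℝ] E) hne).surjective
    obtain ⟨u, hu⟩ := hsurj (h x)
    have := hperp u
    rw [hu, real_inner_self_eq_norm_sq, hsph] at this
    exact hρ.ne' (pow_eq_zero_iff two_ne_zero |>.1 this)
  have hint : ∀ t : ℝ, IntegrableOn (fun x => (ContinuousLinearMap.id ℝ E + t • A x).det)
      (Metric.ball 0 ρ) μ := by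
    intro t
    have hc : Continuous fun x => (ContinuousLinearMap.id ℝ E + t • A x).det :=
      ContinuousLinearMap.continuous_det.comp (continuous_const.add (hAc.const_smul t))
    exact (hc.continuousOn.integrableOn_compact (isCompact_closedBall 0 ρ)).mono_set
      Metric.ball_subset_closedBall
  have h0 : ∫ x in Metric.ball (0 : E) ρ, (ContinuousLinearMap.id ℝ E + (1 : ℝ) • A x).det ∂μ = 0 :=
    setIntegral_eq_zero_of_forall_eq_zero hzero
  -- All nodes give the volume of the ball, and the Lagrange basis polynomials add up to 1; so the
  -- volume would be 0.
  rw [integral_congr_ae (Eventually.of_forall hlag),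
    integral_finsetSum _ fun j _ => (hint (v j)).mul_const _] at h0
  simp only [integral_mul_const] at h0
  rw [Finset.sum_congr rfl fun j _ => by rw [hvol (v j) (hvmem j)], ← Finset.mul_sum,
    ← Polynomial.eval_finsetSum, Lagrange.sum_basis hvinj ⟨0, by simp [s]⟩] at h0
  simp only [Polynomial.eval_one, mul_one] at h0
  have : 0 < μ.real (Metric.ball (0 : E) ρ) :=
    ENNReal.toReal_pos (Metric.measure_ball_pos μ _ hρ).ne' measure_ball_lt_top.ne
  exact this.ne' h0

/-- A continuous vector field that points outwards on all large spheres has a zero. -/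
lemma exists_zero_of_inner_pos {F : E → E} (hF : Continuous F) {R : ℝ}
    (hR : ∀ x, R ≤ ‖x‖ → 0 < inner ℝ (F x) x) : ∃ x, F x = 0 := by
  by_contra! hne
  -- A cutoff, 0 for ‖x‖ ≤ R and 1 for ‖x‖ ≥ R + 1. Blending F with the identity creates no zeros,
  -- since both point outwards where they are mixed.
  set s : E → ℝ := fun x => min 1 (max 0 (‖x‖ - R)) with hs
  have hs0 : ∀ x, 0 ≤ s x := fun x => le_min zero_le_one (le_max_left _ _)
  have hs1 : ∀ x, s x ≤ 1 := fun x => min_le_left _ _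
  set F₁ : E → E := fun x => (1 - s x) • F x + s x • x with hF₁
  have hsc : Continuous s := by fun_prop
  have hF₁c : Continuous F₁ := by fun_prop
  have hF₁id : ∀ x, R + 1 ≤ ‖x‖ → F₁ x = x := fun x hx => by
    have : s x = 1 := min_eq_left ((by linarith : (1 : ℝ) ≤ ‖x‖ - R).trans (le_max_right _ _))
    simp [hF₁, this]
  have hF₁ne : ∀ x, F₁ x ≠ 0 := by
    intro x h0
    rcases lt_or_ge ‖x‖ R with hx | hx
    · have : s x = 0 := by
        simp only [hs]
        rw [max_eq_left (by linarith), min_eq_right zero_le_one]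
      exact hne x (by simpa [hF₁, this] using h0)
    · have h1 : inner ℝ (F₁ x) x = (1 - s x) * inner ℝ (F x) x + s x * ‖x‖ ^ 2 := by
        simp only [hF₁, inner_add_left, real_inner_smul_left, real_inner_self_eq_norm_sq]
      rw [h0, inner_zero_left] at h1
      have h2 := hR x hx
      have h3 : x ≠ 0 := by rintro rfl; simp at h2
      have h4 : 0 < ‖x‖ ^ 2 := by positivity
      rcases (hs0 x).eq_or_lt with h5 | h5
      · rw [← h5] at h1; linarith
      · have := mul_nonneg (sub_nonneg.2 (hs1 x)) h2.le
        have := mul_pos h5 h4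
        linarith
  -- Larger than R + 1, so that F₁ is the identity, hence smooth, in a neighbourhood of the set
  -- where the approximation has to be exact.
  set ρ : ℝ := max R 0 + 2 with hρ
  have hRρ : R + 1 < ρ := by have := le_max_left R 0; linarith
  have hρ0 : 0 < ρ := by positivity
  -- An error below ‖F₁ x‖ keeps g free of zeros; g normalized to length ρ is then a smooth
  -- retraction onto the sphere.
  obtain ⟨g, hgC, hgd, hgS, -⟩ := hF₁c.exists_contDiff_approx_and_eqOn 1 hF₁c.norm
    (fun x => norm_pos_iff.2 (hF₁ne x)) (S := {x | ρ ≤ ‖x‖}) (U := {x | R + 1 < ‖x‖})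
    (isClosed_le continuous_const continuous_norm)
    ((isOpen_lt continuous_const continuous_norm).mem_nhdsSet.2 fun x hx => hRρ.trans_le hx)
    (contDiffOn_id.congr fun x hx => hF₁id x (le_of_lt hx))
  have hgne : ∀ x, g x ≠ 0 := by
    intro x h0
    have := hgd x
    rw [h0, dist_zero_left] at this
    exact lt_irrefl _ this
  refine no_smooth_retraction hρ0 (h := fun x => (ρ / ‖g x‖) • g x) ?_ ?_ ?_
  · exact (contDiff_const.div (hgC.norm ℝ hgne) fun x => norm_ne_zero_iff.2 (hgne x)).smul hgC
  · intro x
    have := norm_pos_iff.2 (hgne x)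
    rw [norm_smul, Real.norm_of_nonneg (by positivity)]
    field_simp
  · intro x hx
    have : g x = x := (hgS (show ρ ≤ ‖x‖ from hx.ge)).trans (hF₁id x (by linarith))
    simp only [this, hx, div_self hρ0.ne', one_smul]

/-- A coercive continuous vector field has a zero; coercivity may degenerate in the directions
orthogonal to the range of the field. -/
lemma exists_zero_of_coercive {F : E → E} (hF : Continuous F) {Q : E → ℝ} (hQ : Continuous Q)
    (hQ0 : ∀ x, 0 ≤ Q x) (hQs : ∀ (t : ℝ) x, Q (t • x) = t ^ 2 * Q x)
    (hker : ∀ y, Q y = 0 → ∀ x, inner ℝ (F x) y = 0) {C : ℝ}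
    (hcoer : ∀ x, Q x - C ≤ inner ℝ (F x) x) : ∃ x, F x = 0 := by
  -- Zeros of Q are orthogonal to W, so Q is positive on W \ {0}. By compactness of the unit sphere
  -- and homogeneity, Q ≥ c‖·‖² on W, and F maps W into itself.
  set W : Submodule ℝ E := Submodule.span ℝ (Set.range F) with hW
  have hFW : ∀ x, F x ∈ W := fun x => Submodule.subset_span ⟨x, rfl⟩
  have hpos : ∀ y : W, y ≠ 0 → 0 < Q y := by
    intro y hy
    refine (hQ0 _).lt_of_ne' fun h0 => hy ?_
    have h1 : ∀ z ∈ W, inner ℝ z (y : E) = 0 := by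
      intro z hz
      induction hz using Submodule.span_induction with
      | mem z hz => obtain ⟨x, rfl⟩ := hz; exact hker _ h0 x
      | zero => simp
      | add a b _ _ ha hb => rw [inner_add_left, ha, hb, add_zero]
      | smul c a _ ha => rw [real_inner_smul_left, ha, mul_zero]
    exact Subtype.ext (inner_self_eq_zero.1 (h1 y y.2))
  obtain ⟨c, hc, hcQ⟩ : ∃ c : ℝ, 0 < c ∧ ∀ y : W, c * ‖y‖ ^ 2 ≤ Q y := by
    rcases subsingleton_or_nontrivial W with h0 | h0
    · refine ⟨1, one_pos, fun y => ?_⟩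
      rw [Subsingleton.elim y 0]
      simpa using hQ0 _
    · obtain ⟨y₀, hy₀, hmin⟩ := (isCompact_sphere (0 : W) 1).exists_isMinOn
        (NormedSpace.sphere_nonempty.2 zero_le_one)
        (hQ.comp continuous_subtype_val).continuousOn
      refine ⟨Q y₀, hpos y₀ (fun h => by simp [h] at hy₀), fun y => ?_⟩
      rcases eq_or_ne y 0 with rfl | hy
      · simpa using hQ0 _
      have hn : ‖y‖ ≠ 0 := norm_ne_zero_iff.2 hy
      have h1 : Q y₀ ≤ Q (‖y‖⁻¹ • y : W) := hmin (by
        rw [mem_sphere_zero_iff_norm, norm_smul, norm_inv, norm_norm, inv_mul_cancel₀ hn])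
      rw [Submodule.coe_smul, hQs] at h1
      have h2 : 0 < ‖y‖ ^ 2 := by positivity
      calc Q y₀ * ‖y‖ ^ 2 ≤ (‖y‖⁻¹ ^ 2 * Q y) * ‖y‖ ^ 2 := by gcongr
        _ = Q y := by field_simp
  -- With this radius ‖w‖ ≥ 1, so ‖w‖² ≥ ‖w‖ > |C|/c and Q w > C.
  obtain ⟨w, hw⟩ := exists_zero_of_inner_pos (E := W) (F := fun w => ⟨F w, hFW w⟩)
    (R := |C| / c + 1) ((hF.comp continuous_subtype_val).subtype_mk _) (by
      intro w hw
      have h1 : 1 ≤ ‖w‖ := le_trans (by have : 0 ≤ |C| / c := by positivity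
                                        linarith) hw
      have h2 : |C| / c < ‖w‖ ^ 2 := by nlinarith
      rw [div_lt_iff₀ hc] at h2
      have h3 := hcoer w
      have h4 := hcQ w
      have h5 := le_abs_self C
      rw [Submodule.coe_inner]
      change 0 < inner ℝ (F w) (w : E)
      linarith)
  exact ⟨w, congrArg Subtype.val hw⟩

end Brouwer

namespace Mixture

variable {m : ℕ} {S : Mixture m}

/-! ### Diffusion matrices -/

/-- If k_ij vanished at c, take only species j present, with total concentration c. Row i of A is
then zero, so the i-th unit vector lies in ker Aᵀ, although it is not a multiple of (1,…,1). -/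
lemma k_pos (hS : S.Admissible) (hdiff : S.DiffusionAssumption) {i j : Fin (m + 1)} (hij : i ≠ j)
    {c : ℝ} (hc : 0 < c) : 0 < S.k i j c := by
  refine (hS.k_nonneg i j c hc).lt_of_ne' fun h0 => ?_
  set ρ : Fin (m + 1) → ℝ := Pi.single j (c * S.M j) with hρ
  have hcM : 0 < c * S.M j := mul_pos hc (hS.M_pos j)
  have hρ0 : ∀ l, 0 ≤ ρ l := fun l => by
    by_cases h : l = j
    · subst h; simpa [hρ] using hcM.le
    · simp [hρ, h]
  have hρne : ρ ≠ 0 := fun h => hcM.ne' (by simpa [hρ] using congrFun h j)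
  have hρi : ρ i = 0 := by simp [hρ, hij]
  have hct : S.ctot ρ = c := by
    unfold ctot
    rw [Finset.sum_eq_single j (fun l _ hl => by simp [hρ, hl]) (by simp)]
    simp [hρ, (hS.M_pos j).ne']
  have hker := hdiff ρ hρ0 hρne
  have hmem : (Pi.single i 1 : Fin (m + 1) → ℝ) ∈
      LinearMap.ker (S.A ρ).transpose.mulVecLin := by
    rw [LinearMap.mem_ker, Matrix.mulVecLin_apply]
    ext l
    rw [Matrix.mulVec_single_one]
    simp only [Matrix.col_apply, Matrix.transpose_apply, A, Matrix.of_apply, Pi.zero_apply]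
    split_ifs with h
    · refine Finset.sum_eq_zero fun l' _ => ?_
      by_cases hl : l' = j
      · subst hl; rw [hct, h0, zero_mul]
      · simp [hρ, hl]
    · simp [hρi]
  rw [hker, Submodule.mem_span_singleton] at hmem
  obtain ⟨a, ha⟩ := hmem
  have h1 := congrFun ha i
  have h2 := congrFun ha j
  simp [hij.symm] at h1 h2
  linarith

/-- The quadratic form of `C(ρ)` in terms of the symmetric matrix `A_ij / ρ_i`. -/
lemma dotProduct_C_mulVec (ρ : Fin (m + 1) → ℝ) (J : Fin m → ℝ) :
    J ⬝ᵥ (S.C ρ).mulVec J = ∑ i, ∑ j, S.A ρ i j / ρ i *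
      (Fin.snoc J (-∑ l, J l) : Fin (m + 1) → ℝ) i * (Fin.snoc J (-∑ l, J l) : Fin (m + 1) → ℝ) j := by
  simp only [dotProduct, Matrix.mulVec, C, Matrix.of_apply, Fin.sum_univ_castSucc,
    Fin.snoc_castSucc, Fin.snoc_last, Finset.sum_add_distrib]
  have e1 : ∀ i : Fin m, J i * ∑ j : Fin m, (S.A ρ i.castSucc j.castSucc / ρ i.castSucc
      - S.A ρ i.castSucc (Fin.last m) / ρ i.castSucc
      - S.A ρ (Fin.last m) j.castSucc / ρ (Fin.last m)
      + S.A ρ (Fin.last m) (Fin.last m) / ρ (Fin.last m)) * J j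
      = ∑ j : Fin m, S.A ρ i.castSucc j.castSucc / ρ i.castSucc * J i * J j
        + S.A ρ i.castSucc (Fin.last m) / ρ i.castSucc * J i * (-∑ l, J l)
        + J i * ∑ j : Fin m, S.A ρ (Fin.last m) j.castSucc / ρ (Fin.last m) * (-1) * J j
        + J i * (S.A ρ (Fin.last m) (Fin.last m) / ρ (Fin.last m) * ∑ l, J l) := by
    intro i
    simp only [← Finset.sum_neg_distrib, Finset.mul_sum, ← Finset.sum_add_distrib]
    exact Finset.sum_congr rfl fun j _ => by ring
  rw [Finset.sum_congr rfl fun i _ => e1 i]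
  simp only [Finset.sum_add_distrib, ← Finset.sum_mul]
  have e2 : ∑ j : Fin m, S.A ρ (Fin.last m) j.castSucc / ρ (Fin.last m) * (-∑ l, J l) * J j
      = (∑ l, J l) * ∑ j : Fin m, S.A ρ (Fin.last m) j.castSucc / ρ (Fin.last m) * (-1) * J j := by
    rw [Finset.mul_sum]
    exact Finset.sum_congr rfl fun j _ => by ring
  rw [e2]
  ring

/-- Off the diagonal A_ij/ρ_i = -k_ij, which is symmetric. -/
lemma C_transpose (hS : S.Admissible) {ρ : Fin (m + 1) → ℝ} (hρ : ∀ i, 0 < ρ i)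
    (hc : 0 < S.ctot ρ) : (S.C ρ).transpose = S.C ρ := by
  have hA : ∀ i j, i ≠ j → S.A ρ i j / ρ i = - S.k i j (S.ctot ρ) := fun i j hij => by
    have := (hρ i).ne'
    simp only [A, Matrix.of_apply, if_neg hij]
    field_simp
  have hAs : ∀ i j, S.A ρ i j / ρ i = S.A ρ j i / ρ j := fun i j => by
    by_cases hij : i = j
    · rw [hij]
    · rw [hA i j hij, hA j i (Ne.symm hij), hS.k_symm i j _ hc]
  ext i j
  simp only [Matrix.transpose_apply, C, Matrix.of_apply]
  rw [hAs j.castSucc i.castSucc, hAs j.castSucc, hAs (Fin.last m) i.castSucc]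
  ring

/-- `C(ρ)` is bounded below by a lower bound of the off-diagonal diffusivities. -/
lemma le_dotProduct_C_mulVec (hS : S.Admissible) {ρ : Fin (m + 1) → ℝ}
    (hρ : ∀ i, 0 < ρ i ∧ ρ i < 1) (hsum : ∑ i, ρ i = 1) (hc : 0 < S.ctot ρ) {κ : ℝ}
    (hκ0 : 0 ≤ κ) (hκ : ∀ i j, i ≠ j → κ ≤ S.k i j (S.ctot ρ)) (J : Fin m → ℝ) :
    κ * ∑ i, J i ^ 2 ≤ J ⬝ᵥ (S.C ρ).mulVec J := by
  rw [dotProduct_C_mulVec]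
  set I : Fin (m + 1) → ℝ := Fin.snoc J (-∑ l, J l) with hI
  -- The diagonal entries multiply (V_i - V_i)² = 0; the value κ makes K ≥ κ hold for all pairs.
  set K : Fin (m + 1) → Fin (m + 1) → ℝ := fun i j => if i = j then κ else S.k i j (S.ctot ρ) with hK
  have hKκ : ∀ i j, κ ≤ K i j := fun i j => by
    simp only [hK]; split_ifs with h
    · exact le_rfl
    · exact hκ i j h
  have hKs : ∀ i j, K i j = K j i := fun i j => by
    by_cases h : i = j
    · rw [h]
    · simp only [hK, if_neg h, if_neg (Ne.symm h)]; exact hS.k_symm i j _ hc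
  -- In terms of the velocities V the form is ½ ∑ k_ij ρ_i ρ_j (V_i - V_j)². With κ in place of k_ij
  -- it is a variance and equals κ ∑ ρ_i V_i², because ∑ ρ_i = 1 and the fluxes I_i = ρ_i V_i add up
  -- to zero.
  set V : Fin (m + 1) → ℝ := fun i => I i / ρ i with hV
  have hIV : ∀ i, I i = ρ i * V i := fun i => by
    have := (hρ i).1.ne'
    simp only [hV]; field_simp
  have e1 : ∀ i, ∑ j, S.A ρ i j / ρ i * I i * I j
      = ∑ j, K i j * ρ i * ρ j * (V i ^ 2 - V i * V j) := by
    intro i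
    have hi := (hρ i).1.ne'
    rw [← Finset.add_sum_erase _ _ (Finset.mem_univ i),
      ← Finset.add_sum_erase (Finset.univ) (fun j => K i j * _ * _ * _) (Finset.mem_univ i)]
    have hAii : S.A ρ i i = ∑ l ∈ Finset.univ.erase i, S.k i l (S.ctot ρ) * ρ l := by
      simp [A]
    rw [hAii, Finset.sum_div, Finset.sum_mul, Finset.sum_mul, ← Finset.sum_add_distrib]
    have : K i i * ρ i * ρ i * (V i ^ 2 - V i * V i) = 0 := by ring
    rw [this, zero_add]
    refine Finset.sum_congr rfl fun j hj => ?_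
    have hji : i ≠ j := (Finset.ne_of_mem_erase hj).symm
    simp only [A, Matrix.of_apply, if_neg hji, hK, hIV]
    field_simp
    ring
  rw [Finset.sum_congr rfl fun i _ => e1 i]
  have e2 : ∑ i, ∑ j, K i j * ρ i * ρ j * (V i ^ 2 - V i * V j)
      = ∑ i, ∑ j, K i j * ρ i * ρ j * ((V i - V j) ^ 2 / 2) := by
    have h1 : ∑ i, ∑ j, K i j * ρ i * ρ j * (V i ^ 2 - V i * V j)
        = ∑ i, ∑ j, K i j * ρ i * ρ j * (V j ^ 2 - V i * V j) := by
      rw [Finset.sum_comm]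
      refine Finset.sum_congr rfl fun i _ => Finset.sum_congr rfl fun j _ => ?_
      rw [hKs j i]; ring
    have h2 : ∑ i, ∑ j, K i j * ρ i * ρ j * ((V i - V j) ^ 2 / 2)
        = (∑ i, ∑ j, K i j * ρ i * ρ j * (V i ^ 2 - V i * V j)
          + ∑ i, ∑ j, K i j * ρ i * ρ j * (V j ^ 2 - V i * V j)) / 2 := by
      simp only [← Finset.sum_add_distrib, Finset.sum_div]
      exact Finset.sum_congr rfl fun i _ => Finset.sum_congr rfl fun j _ => by ring
    rw [h2, ← h1]; ring
  rw [e2]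
  have e3 : κ * ∑ i, ρ i * V i ^ 2 = ∑ i, ∑ j, κ * ρ i * ρ j * ((V i - V j) ^ 2 / 2) := by
    have hI0 : ∑ i, ρ i * V i = 0 := by
      simp only [← hIV]
      rw [Fin.sum_univ_castSucc]
      simp [hI]
    have : ∀ i, ∑ j, κ * ρ i * ρ j * ((V i - V j) ^ 2 / 2)
        = κ / 2 * (ρ i * V i ^ 2) * ∑ j, ρ j + κ / 2 * ρ i * ∑ j, ρ j * V j ^ 2
          - κ * (ρ i * V i) * ∑ j, ρ j * V j := by
      intro i
      simp only [Finset.mul_sum, ← Finset.sum_add_distrib, ← Finset.sum_sub_distrib]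
      exact Finset.sum_congr rfl fun j _ => by ring
    simp only [this, hI0, hsum, mul_zero, sub_zero, mul_one, Finset.sum_add_distrib,
      ← Finset.sum_mul, ← Finset.mul_sum]
    ring
  calc κ * ∑ i, J i ^ 2 ≤ κ * ∑ i, ρ i * V i ^ 2 := by
        gcongr
        calc ∑ i, J i ^ 2 ≤ ∑ i, I i ^ 2 := by
              rw [Fin.sum_univ_castSucc]
              simp only [hI, Fin.snoc_castSucc, Fin.snoc_last]
              linarith [sq_nonneg (-∑ l, J l)]
          -- I_i² = ρ_i² V_i², and ρ_i < 1.
          _ ≤ ∑ i, ρ i * V i ^ 2 := by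
              refine Finset.sum_le_sum fun i _ => ?_
              rw [hIV]
              nlinarith [(hρ i).1, (hρ i).2, mul_nonneg (mul_nonneg (hρ i).1.le
                (sub_nonneg.2 (hρ i).2.le)) (sq_nonneg (V i))]
    _ = _ := e3
    _ ≤ _ := by
        refine Finset.sum_le_sum fun i _ => Finset.sum_le_sum fun j _ => ?_
        have := (hρ i).1.le
        have := (hρ j).1.le
        gcongr
        exact hKκ i j

/-- The total concentration of nonnegative densities of total mass one. -/
lemma exists_ctot_bounds (hS : S.Admissible) : ∃ c₁ c₂ : ℝ, 0 < c₁ ∧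
    ∀ ρ : Fin (m + 1) → ℝ, (∀ i, 0 ≤ ρ i) → ∑ i, ρ i = 1 →
      c₁ ≤ S.ctot ρ ∧ S.ctot ρ ≤ c₂ := by
  have hM := hS.M_pos
  obtain ⟨i₁, hi₁⟩ := Finite.exists_min fun i => (S.M i)⁻¹
  obtain ⟨i₂, hi₂⟩ := Finite.exists_max fun i => (S.M i)⁻¹
  refine ⟨(S.M i₁)⁻¹, (S.M i₂)⁻¹, inv_pos.2 (hM _), fun ρ hρ hsum => ⟨?_, ?_⟩⟩
  · calc (S.M i₁)⁻¹ = ∑ i, ρ i * (S.M i₁)⁻¹ := by rw [← Finset.sum_mul, hsum, one_mul]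
      _ ≤ _ := Finset.sum_le_sum fun i _ => mul_le_mul_of_nonneg_left (hi₁ i) (hρ i)
  · calc S.ctot ρ ≤ ∑ i, ρ i * (S.M i₂)⁻¹ :=
          Finset.sum_le_sum fun i _ => mul_le_mul_of_nonneg_left (hi₂ i) (hρ i)
      _ = _ := by rw [← Finset.sum_mul, hsum, one_mul]

lemma ctot_pos (hS : S.Admissible) {ρ : Fin (m + 1) → ℝ} (hρ : ∀ i, 0 ≤ ρ i)
    (hsum : ∑ i, ρ i = 1) : 0 < S.ctot ρ := by
  obtain ⟨c₁, _, h, h'⟩ := exists_ctot_bounds hS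
  exact h.trans_le (h' ρ hρ hsum).1

/-- The total concentration ranges in a compact subset of (0, ∞), on which the coefficients are
continuous and positive; so pointwise positivity becomes uniform. -/
lemma exists_le_k (hS : S.Admissible) (hdiff : S.DiffusionAssumption) : ∃ κ : ℝ, 0 < κ ∧
    ∀ ρ : Fin (m + 1) → ℝ, (∀ i, 0 ≤ ρ i) → ∑ i, ρ i = 1 →
      ∀ i j, i ≠ j → κ ≤ S.k i j (S.ctot ρ) := by
  obtain ⟨c₁, c₂, hc₁, hc⟩ := exists_ctot_bounds hS
  have h1 : ∀ p : Fin (m + 1) × Fin (m + 1), ∃ κ : ℝ, 0 < κ ∧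
      (p.1 ≠ p.2 → ∀ c ∈ Set.Icc c₁ c₂, κ ≤ S.k p.1 p.2 c) := by
    rintro ⟨i, j⟩
    by_cases hij : i = j
    · exact ⟨1, one_pos, fun h => absurd hij h⟩
    rcases (Set.Icc c₁ c₂).eq_empty_or_nonempty with h0 | h0
    · exact ⟨1, one_pos, fun _ c hc => by simp [h0] at hc⟩
    obtain ⟨c, hcm, hmin⟩ := isCompact_Icc.exists_isMinOn h0
      ((hS.k_cont i j).mono fun c hc => hc₁.trans_le hc.1)
    exact ⟨_, k_pos hS hdiff hij (hc₁.trans_le hcm.1), fun _ c' hc' => hmin hc'⟩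
  choose κ hκ0 hκ using h1
  obtain ⟨p, hp⟩ := Finite.exists_min κ
  exact ⟨κ p, hκ0 p, fun ρ hρ hsum i j hij => (hp (i, j)).trans
    (hκ (i, j) hij _ (hc ρ hρ hsum))⟩

lemma det_C_ne_zero (hS : S.Admissible) (hdiff : S.DiffusionAssumption) {ρ : Fin (m + 1) → ℝ}
    (hρ : ∀ i, 0 < ρ i ∧ ρ i < 1) (hsum : ∑ i, ρ i = 1) : (S.C ρ).det ≠ 0 := by
  have hρ0 : ∀ i, 0 ≤ ρ i := fun i => (hρ i).1.le
  obtain ⟨κ, hκ0, hκ⟩ := exists_le_k hS hdiff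
  intro h0
  obtain ⟨J, hJ, hJ0⟩ := Matrix.exists_mulVec_eq_zero_iff.2 h0
  have := le_dotProduct_C_mulVec hS hρ hsum (ctot_pos hS hρ0 hsum) hκ0.le (hκ ρ hρ0 hsum) J
  rw [hJ0, dotProduct_zero] at this
  have h1 : ∑ i, J i ^ 2 ≤ 0 := by by_contra h; push Not at h; nlinarith
  refine hJ (funext fun i => ?_)
  have h2 := (Finset.sum_eq_zero_iff_of_nonneg fun i _ => sq_nonneg (J i)).1
    (le_antisymm h1 (Finset.sum_nonneg fun i _ => sq_nonneg _)) i (Finset.mem_univ i)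
  simpa using h2

lemma B_symm (hS : S.Admissible) {ρ : Fin (m + 1) → ℝ}
    (hρ : ∀ i, 0 < ρ i ∧ ρ i < 1) (hsum : ∑ i, ρ i = 1) (i j : Fin m) :
    S.B ρ i j = S.B ρ j i := by
  have h := C_transpose hS (fun i => (hρ i).1) (ctot_pos hS (fun i => (hρ i).1.le) hsum)
  have : (S.C ρ)⁻¹.transpose = (S.C ρ)⁻¹ := by rw [Matrix.transpose_nonsing_inv, h]
  simp only [B, Matrix.smul_apply]
  rw [← congrFun (congrFun this i) j, Matrix.transpose_apply]

/-- The mobility matrices are positive semidefinite and uniformly bounded. -/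
lemma exists_B_bound (hS : S.Admissible) (hdiff : S.DiffusionAssumption) : ∃ b : ℝ, 0 ≤ b ∧
    ∀ ρ : Fin (m + 1) → ℝ, (∀ i, 0 < ρ i ∧ ρ i < 1) → ∑ i, ρ i = 1 →
      (∀ p : Fin m → ℝ, 0 ≤ ∑ i, ∑ j, S.B ρ i j * (p i * p j)) ∧ ∀ i j, |S.B ρ i j| ≤ b := by
  obtain ⟨κ, hκ0, hκ⟩ := exists_le_k hS hdiff
  obtain ⟨c₁, c₂, hc₁, hc⟩ := exists_ctot_bounds hS
  refine ⟨|c₂| * κ⁻¹, by positivity, fun ρ hρ hsum => ?_⟩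
  have hρ0 : ∀ i, 0 ≤ ρ i := fun i => (hρ i).1.le
  have hcp := ctot_pos hS hρ0 hsum
  have hdet := det_C_ne_zero hS hdiff hρ hsum
  have hCC : S.C ρ * (S.C ρ)⁻¹ = 1 := Matrix.mul_nonsing_inv _ (isUnit_iff_ne_zero.2 hdet)
  have hlow := le_dotProduct_C_mulVec hS hρ hsum hcp hκ0.le (hκ ρ hρ0 hsum)
  have hCinv : ∀ p, (S.C ρ).mulVec ((S.C ρ)⁻¹.mulVec p) = p := fun p => by
    rw [Matrix.mulVec_mulVec, hCC, Matrix.one_mulVec]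
  refine ⟨fun p => ?_, fun i j => ?_⟩
  · have h1 := hlow ((S.C ρ)⁻¹.mulVec p)
    rw [hCinv] at h1
    have h2 : 0 ≤ (S.C ρ)⁻¹.mulVec p ⬝ᵥ p :=
      (mul_nonneg hκ0.le (Finset.sum_nonneg fun i _ => sq_nonneg _)).trans h1
    have h3 : ∑ i, ∑ j, S.B ρ i j * (p i * p j) = S.ctot ρ * ((S.C ρ)⁻¹.mulVec p ⬝ᵥ p) := by
      simp only [B, Matrix.smul_apply, dotProduct, Matrix.mulVec, smul_eq_mul, Finset.mul_sum,
        Finset.sum_mul]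
      exact Finset.sum_congr rfl fun i _ => Finset.sum_congr rfl fun j _ => by ring
    rw [h3]
    positivity
  -- J is column j of C⁻¹, and the lower bound reads κ|J|² ≤ J_j. The j-th square alone gives |J_j|
  -- ≤ 1/κ, and then every entry satisfies J_i² ≤ κ⁻².
  · set J := (S.C ρ)⁻¹.mulVec (Pi.single j 1) with hJ
    have h1 := hlow J
    rw [hJ, hCinv, ← hJ] at h1
    have h2 : J ⬝ᵥ Pi.single j 1 = J j := by simp
    rw [h2] at h1
    have hle : ∀ l, J l ^ 2 ≤ ∑ i, J i ^ 2 := fun l =>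
      Finset.single_le_sum (f := fun i => J i ^ 2) (fun i _ => sq_nonneg _) (Finset.mem_univ l)
    have h3 : |J j| ≤ κ⁻¹ := by
      rw [← mul_one κ⁻¹, ← div_eq_inv_mul, le_div_iff₀ hκ0]
      have h4 : κ * J j ^ 2 ≤ |J j| :=
        (mul_le_mul_of_nonneg_left (hle j) hκ0.le).trans (h1.trans (le_abs_self _))
      rw [← sq_abs] at h4
      rcases (abs_nonneg (J j)).eq_or_lt with h5 | h5
      · rw [← h5]; norm_num
      · by_contra h; push Not at h; nlinarith
    have h4 : J i ^ 2 ≤ κ⁻¹ ^ 2 := by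
      have h5 : κ * J i ^ 2 ≤ κ⁻¹ :=
        (mul_le_mul_of_nonneg_left (hle i) hκ0.le).trans (h1.trans ((le_abs_self _).trans h3))
      calc J i ^ 2 = κ⁻¹ * (κ * J i ^ 2) := by field_simp
        _ ≤ κ⁻¹ * κ⁻¹ := by gcongr
        _ = _ := by ring
    have h5 : |J i| ≤ κ⁻¹ := abs_le_of_sq_le_sq h4 (by positivity)
    have h6 : J i = (S.C ρ)⁻¹ i j := by simp [hJ]
    simp only [B, Matrix.smul_apply, smul_eq_mul, abs_mul]
    rw [← h6]
    rw [abs_of_pos hcp]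
    gcongr
    exact (hc ρ hρ0 hsum).2.trans (le_abs_self _)

end Mixture

namespace Mixture

variable {m : ℕ} {S : Mixture m}

/-! ### Inversion of the entropy variables -/

lemma exists_sum_exp_eq_one (hS : S.Admissible) (μ : Fin (m + 1) → ℝ) :
    ∃ s : ℝ, ∑ i, Real.exp (S.M i * (μ i + s)) = 1 := by
  have hcont : Continuous fun s : ℝ => ∑ i, Real.exp (S.M i * (μ i + s)) := by fun_prop
  have hlim : Tendsto (fun s : ℝ => ∑ i, Real.exp (S.M i * (μ i + s))) atBot (𝓝 0) := by
    have : Tendsto (fun s : ℝ => ∑ i, Real.exp (S.M i * (μ i + s))) atBot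
        (𝓝 (∑ _i : Fin (m + 1), 0)) := by
      refine tendsto_finsetSum _ fun i _ => Real.tendsto_exp_atBot.comp ?_
      exact (tendsto_atBot_add_const_left _ _ tendsto_id).const_mul_atBot (hS.M_pos i)
    simpa using this
  -- The sum is below 1 far to the left and at least 1 at s = -μ 0, where the term of species 0
  -- equals 1.
  obtain ⟨s₀, hs₀1, hs₀2⟩ := ((hlim.eventually (gt_mem_nhds one_pos)).and
    (eventually_le_atBot (-μ 0))).exists
  have h1 : (1 : ℝ) ≤ ∑ i, Real.exp (S.M i * (μ i + -μ 0)) :=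
    calc (1 : ℝ) = Real.exp (S.M 0 * (μ 0 + -μ 0)) := by simp
      _ ≤ _ := Finset.single_le_sum (f := fun i => Real.exp (S.M i * (μ i + -μ 0)))
        (fun i _ => (Real.exp_pos _).le) (Finset.mem_univ 0)
  obtain ⟨s, -, hs⟩ := intermediate_value_Icc hs₀2 hcont.continuousOn ⟨hs₀1.le, h1⟩
  exact ⟨s, hs⟩

lemma strictMono_sum_exp (hS : S.Admissible) (μ : Fin (m + 1) → ℝ) :
    StrictMono fun s : ℝ => ∑ i, Real.exp (S.M i * (μ i + s)) := fun s t hst =>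
  Finset.sum_lt_sum_of_nonempty Finset.univ_nonempty fun i _ =>
    Real.exp_lt_exp.2 (mul_lt_mul_of_pos_left (by linarith) (hS.M_pos i))

/-- The number `s` such that the molar fractions `exp (M_i (μ_i + s))` add up to one. -/
def shift (S : Mixture m) (μ : Fin (m + 1) → ℝ) : ℝ :=
  Classical.epsilon fun s => ∑ i, Real.exp (S.M i * (μ i + s)) = 1

lemma shift_spec (hS : S.Admissible) (μ : Fin (m + 1) → ℝ) :
    ∑ i, Real.exp (S.M i * (μ i + S.shift μ)) = 1 :=
  Classical.epsilon_spec (exists_sum_exp_eq_one hS μ)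

/-- By strict monotonicity, s lies below the shift of μ exactly if the exponential sum at s is below
1, and this is an open condition on μ for fixed s; likewise from above. -/
lemma continuous_shift (hS : S.Admissible) : Continuous S.shift := by
  have hmono := strictMono_sum_exp hS
  refine continuous_iff_continuousAt.2 fun μ₀ => tendsto_order.2 ⟨fun s hs => ?_, fun s hs => ?_⟩
  · have hc : Continuous fun μ : Fin (m + 1) → ℝ => ∑ i, Real.exp (S.M i * (μ i + s)) := by
      fun_prop
    have h1 := hmono μ₀ hs
    simp only [shift_spec hS] at h1
    filter_upwards [hc.continuousAt.eventually (gt_mem_nhds h1)] with μ hμ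
    rw [← shift_spec hS μ] at hμ
    exact (hmono μ).lt_iff_lt.1 hμ
  · have hc : Continuous fun μ : Fin (m + 1) → ℝ => ∑ i, Real.exp (S.M i * (μ i + s)) := by
      fun_prop
    have h1 := hmono μ₀ hs
    simp only [shift_spec hS] at h1
    filter_upwards [hc.continuousAt.eventually (lt_mem_nhds h1)] with μ hμ
    rw [← shift_spec hS μ] at hμ
    exact (hmono μ).lt_iff_lt.1 hμ

/-- The differences of the chemical potentials that belong to the entropy variables. -/
def chemPot (S : Mixture m) (w : Fin m → ℝ) (φ : ℝ) : Fin (m + 1) → ℝ :=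
  Fin.snoc (fun i => w i - S.relCharge i * φ) 0

/-- The molar fractions as functions of the entropy variables and the potential. -/
def fracs (S : Mixture m) (w : Fin m → ℝ) (φ : ℝ) (i : Fin (m + 1)) : ℝ :=
  Real.exp (S.M i * (S.chemPot w φ i + S.shift (S.chemPot w φ)))

lemma fracs_pos (w : Fin m → ℝ) (φ : ℝ) (i : Fin (m + 1)) : 0 < S.fracs w φ i := Real.exp_pos _

lemma sum_fracs (hS : S.Admissible) (w : Fin m → ℝ) (φ : ℝ) : ∑ i, S.fracs w φ i = 1 :=
  shift_spec hS _

lemma continuous_fracs (hS : S.Admissible) (i : Fin (m + 1)) :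
    Continuous fun p : (Fin m → ℝ) × ℝ => S.fracs p.1 p.2 i := by
  have h1 : Continuous fun p : (Fin m → ℝ) × ℝ => S.chemPot p.1 p.2 := by
    refine continuous_pi fun j => ?_
    refine Fin.lastCases ?_ (fun j => ?_) j
    · simp only [chemPot, Fin.snoc_last]; fun_prop
    · simp only [chemPot, Fin.snoc_castSucc]; fun_prop
  have h2 := (continuous_shift hS).comp h1
  have h3 := (continuous_apply i).comp h1
  exact Real.continuous_exp.comp (continuous_const.mul (h3.add h2))

lemma sum_M_mul_pos (hS : S.Admissible) {x : Fin (m + 1) → ℝ} (hx : ∀ i, 0 < x i) :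
    0 < ∑ i, S.M i * x i :=
  Finset.sum_pos (fun i _ => mul_pos (hS.M_pos i) (hx i)) Finset.univ_nonempty

/-- The density that belongs to given molar fractions. -/
def ofFracs (S : Mixture m) (x : Fin (m + 1) → ℝ) (i : Fin (m + 1)) : ℝ :=
  S.M i * x i / ∑ j, S.M j * x j

lemma ctot_ofFracs (hS : S.Admissible) {x : Fin (m + 1) → ℝ}
    (hsum : ∑ i, x i = 1) : S.ctot (S.ofFracs x) = 1 / ∑ j, S.M j * x j := by
  unfold ctot ofFracs
  rw [← hsum, Finset.sum_div]
  exact Finset.sum_congr rfl fun i _ => by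
    have := (hS.M_pos i).ne'
    field_simp

lemma molarFrac_ofFracs (hS : S.Admissible) {x : Fin (m + 1) → ℝ} (hx : ∀ i, 0 < x i)
    (hsum : ∑ i, x i = 1) : S.molarFrac (S.ofFracs x) = x := by
  ext i
  have := (hS.M_pos i).ne'
  have := (sum_M_mul_pos hS hx).ne'
  rw [molarFrac, ctot_ofFracs hS hsum, ofFracs]
  field_simp

lemma isDensity_ofFracs_fracs (hm : 1 ≤ m) (hS : S.Admissible) (w : Fin m → ℝ) (φ : ℝ) :
    S.IsDensity w φ (S.ofFracs (S.fracs w φ)) := by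
  have hp := sum_M_mul_pos hS (S.fracs_pos w φ)
  have hpos : ∀ i, 0 < S.ofFracs (S.fracs w φ) i := fun i =>
    div_pos (mul_pos (hS.M_pos i) (S.fracs_pos w φ i)) hp
  have hsum : ∑ i, S.ofFracs (S.fracs w φ) i = 1 := by
    simp only [ofFracs]
    rw [← Finset.sum_div, div_self hp.ne']
  refine ⟨fun i => ⟨hpos i, ?_⟩, hsum, fun i => ?_⟩
  -- A second species is needed here: its positive density keeps the others below 1.
  · have : Nontrivial (Fin (m + 1)) := Fin.nontrivial_iff_two_le.2 (by omega)
    obtain ⟨j, hj⟩ := exists_ne i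
    have : S.ofFracs (S.fracs w φ) i + S.ofFracs (S.fracs w φ) j ≤ 1 := by
      rw [← hsum, ← Finset.sum_pair hj.symm]
      exact Finset.sum_le_sum_of_subset_of_nonneg (Finset.subset_univ _) fun l _ _ => (hpos l).le
    linarith [hpos j]
  · rw [molarFrac_ofFracs hS (S.fracs_pos w φ) (sum_fracs hS w φ)]
    have h1 := (hS.M_pos i.castSucc).ne'
    have h2 := (hS.M_pos (Fin.last m)).ne'
    simp only [fracs, Real.log_exp]
    rw [mul_div_cancel_left₀ _ h1, mul_div_cancel_left₀ _ h2]
    simp [chemPot]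

/-- Uniqueness: the entropy variables fix every log x_i / M_i up to one common additive constant,
which ∑ x_i = 1 determines; the molar fractions determine ρ, as its total mass is one. -/
lemma IsDensity.eq_ofFracs_fracs (hS : S.Admissible) {w : Fin m → ℝ} {φ : ℝ}
    {ρ : Fin (m + 1) → ℝ} (h : S.IsDensity w φ ρ) : ρ = S.ofFracs (S.fracs w φ) := by
  obtain ⟨hρ, hsum, hw⟩ := h
  have hc := ctot_pos hS (fun i => (hρ i).1.le) hsum
  set x := S.molarFrac ρ with hx
  have hx0 : ∀ i, 0 < x i := fun i => div_pos (hρ i).1 (mul_pos hc (hS.M_pos i))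
  set s := Real.log (x (Fin.last m)) / S.M (Fin.last m) with hs
  have hxe : ∀ i, x i = Real.exp (S.M i * (S.chemPot w φ i + s)) := by
    intro i
    rw [← Real.exp_log (hx0 i)]
    congr 1
    have h1 := (hS.M_pos i).ne'
    refine Fin.lastCases ?_ (fun i => ?_) i
    · have := (hS.M_pos (Fin.last m)).ne'
      simp only [chemPot, Fin.snoc_last, hs]; field_simp; ring
    · have := (hS.M_pos i.castSucc).ne'
      simp only [chemPot, Fin.snoc_castSucc, hw i, hs]
      field_simp
      ring
  have hxsum : ∑ i, x i = 1 := by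
    simp only [hx, molarFrac]
    rw [← mul_right_inj' hc.ne', Finset.mul_sum, mul_one]
    conv_rhs => rw [ctot]
    refine Finset.sum_congr rfl fun i _ => ?_
    have := (hS.M_pos i).ne'
    field_simp
  have hsx : s = S.shift (S.chemPot w φ) := by
    refine (strictMono_sum_exp hS (S.chemPot w φ)).injective ?_
    simp only [shift_spec hS, ← hxe, hxsum]
  have hxf : x = S.fracs w φ := funext fun i => by rw [hxe, hsx, fracs]
  rw [← hxf]
  have hM : ∀ i, S.M i * x i = ρ i / S.ctot ρ := fun i => by
    have := (hS.M_pos i).ne'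
    simp only [hx, molarFrac]
    field_simp
  ext i
  simp only [ofFracs, hM]
  rw [← Finset.sum_div, hsum]
  field_simp

lemma density_eq (hm : 1 ≤ m) (hS : S.Admissible) (w : Fin m → ℝ) (φ : ℝ) :
    S.density w φ = S.ofFracs (S.fracs w φ) :=
  IsDensity.eq_ofFracs_fracs hS (Classical.epsilon_spec ⟨_, isDensity_ofFracs_fracs hm hS w φ⟩)

lemma isDensity_density (hm : 1 ≤ m) (hS : S.Admissible) (w : Fin m → ℝ) (φ : ℝ) :
    S.IsDensity w φ (S.density w φ) := by
  rw [density_eq hm hS]; exact isDensity_ofFracs_fracs hm hS w φ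

lemma molarFrac_density (hm : 1 ≤ m) (hS : S.Admissible) (w : Fin m → ℝ) (φ : ℝ) :
    S.molarFrac (S.density w φ) = S.fracs w φ := by
  rw [density_eq hm hS, molarFrac_ofFracs hS (S.fracs_pos w φ) (sum_fracs hS w φ)]

lemma continuous_density (hm : 1 ≤ m) (hS : S.Admissible) (i : Fin (m + 1)) :
    Continuous fun p : (Fin m → ℝ) × ℝ => S.density p.1 p.2 i := by
  simp only [density_eq hm hS, ofFracs]
  refine (continuous_const.mul (continuous_fracs hS i)).div
    (continuous_finsetSum _ fun j _ => continuous_const.mul (continuous_fracs hS j)) fun p => ?_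
  exact (sum_M_mul_pos hS (S.fracs_pos _ _)).ne'

lemma continuous_ctot_density (hm : 1 ≤ m) (hS : S.Admissible) :
    Continuous fun p : (Fin m → ℝ) × ℝ => S.ctot (S.density p.1 p.2) :=
  continuous_finsetSum _ fun i _ => (continuous_density hm hS i).div_const _

lemma continuous_B_density (hm : 1 ≤ m) (hS : S.Admissible) (hdiff : S.DiffusionAssumption)
    (i j : Fin m) : Continuous fun p : (Fin m → ℝ) × ℝ => S.B (S.density p.1 p.2) i j := by
  have hd := isDensity_density (S := S) hm hS
  have hk : ∀ i j, Continuous fun p : (Fin m → ℝ) × ℝ => S.k i j (S.ctot (S.density p.1 p.2)) :=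
    fun i j => (hS.k_cont i j).comp_continuous (continuous_ctot_density hm hS) fun p =>
      ctot_pos hS (fun i => ((hd p.1 p.2).1 i).1.le) (hd p.1 p.2).2.1
  have hA : ∀ i j, Continuous fun p : (Fin m → ℝ) × ℝ => S.A (S.density p.1 p.2) i j := by
    intro i j
    simp only [A, Matrix.of_apply]
    split_ifs
    · exact continuous_finsetSum _ fun l _ => (hk i l).mul (continuous_density hm hS l)
    · exact ((hk i j).mul (continuous_density hm hS i)).neg
  have hAd : ∀ i j l, Continuous fun p : (Fin m → ℝ) × ℝ =>
      S.A (S.density p.1 p.2) i j / S.density p.1 p.2 l := fun i j l =>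
    (hA i j).div (continuous_density hm hS l) fun p => ((hd p.1 p.2).1 l).1.ne'
  have hC : Continuous fun p : (Fin m → ℝ) × ℝ => S.C (S.density p.1 p.2) := by
    refine continuous_pi fun i => continuous_pi fun j => ?_
    simp only [C, Matrix.of_apply]
    exact (((hAd _ _ _).sub (hAd _ _ _)).sub (hAd _ _ _)).add (hAd _ _ _)
  have hdet : ∀ p : (Fin m → ℝ) × ℝ, (S.C (S.density p.1 p.2)).det ≠ 0 := fun p =>
    det_C_ne_zero hS hdiff (hd p.1 p.2).1 (hd p.1 p.2).2.1
  -- Cramer's formula: adjugate divided by determinant, both continuous in the entries.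
  simp only [B, Matrix.smul_apply, Matrix.inv_def, Ring.inverse_eq_inv', smul_eq_mul]
  exact (continuous_ctot_density hm hS).mul ((hC.matrix_det.inv₀ hdet).mul
    (hC.matrix_adjugate.matrix_elem i j))

/-! ### The mixing entropy -/

/-- The mixing entropy `c_tot ∑ x_i log x_i`. -/
def mixEntropy (S : Mixture m) (ρ : Fin (m + 1) → ℝ) : ℝ :=
  S.ctot ρ * ∑ i, S.molarFrac ρ i * Real.log (S.molarFrac ρ i)

lemma molarFrac_nonneg (hS : S.Admissible) {ρ : Fin (m + 1) → ℝ} (hρ : ∀ i, 0 ≤ ρ i)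
    (hsum : ∑ i, ρ i = 1) (i : Fin (m + 1)) : 0 ≤ S.molarFrac ρ i :=
  div_nonneg (hρ i) (mul_pos (ctot_pos hS hρ hsum) (hS.M_pos i)).le

lemma ctot_mul_molarFrac (hS : S.Admissible) {ρ : Fin (m + 1) → ℝ} (hρ : ∀ i, 0 ≤ ρ i)
    (hsum : ∑ i, ρ i = 1) (i : Fin (m + 1)) : S.ctot ρ * S.molarFrac ρ i = ρ i / S.M i := by
  have := (hS.M_pos i).ne'
  have := (ctot_pos hS hρ hsum).ne'
  rw [molarFrac]; field_simp

lemma sum_molarFrac (hS : S.Admissible) {ρ : Fin (m + 1) → ℝ} (hρ : ∀ i, 0 ≤ ρ i)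
    (hsum : ∑ i, ρ i = 1) : ∑ i, S.molarFrac ρ i = 1 := by
  have hc := (ctot_pos hS hρ hsum).ne'
  rw [← mul_right_inj' hc, Finset.mul_sum, mul_one,
    Finset.sum_congr rfl fun i _ => ctot_mul_molarFrac hS hρ hsum i, ctot]

lemma molarFrac_le_one (hS : S.Admissible) {ρ : Fin (m + 1) → ℝ} (hρ : ∀ i, 0 ≤ ρ i)
    (hsum : ∑ i, ρ i = 1) (i : Fin (m + 1)) : S.molarFrac ρ i ≤ 1 := by
  rw [← sum_molarFrac hS hρ hsum]
  exact Finset.single_le_sum (fun j _ => molarFrac_nonneg hS hρ hsum j) (Finset.mem_univ i)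

/-- The function x log x is bounded on [0,1]. This bound gives integrability of the mixing entropy
and a lower bound that is uniform in the unknowns. -/
lemma exists_mixEntropy_bound (hS : S.Admissible) : ∃ c : ℝ, ∀ ρ : Fin (m + 1) → ℝ,
    (∀ i, 0 ≤ ρ i) → ∑ i, ρ i = 1 → |S.mixEntropy ρ| ≤ c := by
  obtain ⟨c₁, c₂, hc₁, hc⟩ := exists_ctot_bounds hS
  refine ⟨c₂ * (m + 1), fun ρ hρ hsum => ?_⟩
  have h0 := ctot_pos hS hρ hsum
  rw [mixEntropy, abs_mul, abs_of_pos h0]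
  have h1 : |∑ i, S.molarFrac ρ i * Real.log (S.molarFrac ρ i)| ≤ m + 1 := by
    refine (Finset.abs_sum_le_sum_abs _ _).trans ?_
    calc _ ≤ ∑ _i : Fin (m + 1), (1 : ℝ) := Finset.sum_le_sum fun i _ => by
          rcases (molarFrac_nonneg hS hρ hsum i).eq_or_lt with h | h
          · rw [← h]; simp
          · rw [mul_comm]
            exact (Real.abs_log_mul_self_lt _ h (molarFrac_le_one hS hρ hsum i)).le
      _ = m + 1 := by simp
  exact mul_le_mul (hc ρ hρ hsum).2 h1 (abs_nonneg _) (h0.le.trans (hc ρ hρ hsum).2)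

/-- Gibbs' inequality, that is, convexity of the mixing entropy. -/
lemma mixEntropy_sub_le (hS : S.Admissible) {ρ ρ' : Fin (m + 1) → ℝ} (hρ : ∀ i, 0 < ρ i)
    (hsum : ∑ i, ρ i = 1) (hρ' : ∀ i, 0 ≤ ρ' i) (hsum' : ∑ i, ρ' i = 1) :
    S.mixEntropy ρ - S.mixEntropy ρ'
      ≤ ∑ i, (ρ i - ρ' i) * (Real.log (S.molarFrac ρ i) / S.M i) := by
  have hρ0 := fun i => (hρ i).le
  have h1 : ∀ i, (ρ i - ρ' i) * (Real.log (S.molarFrac ρ i) / S.M i)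
      = S.ctot ρ * (S.molarFrac ρ i * Real.log (S.molarFrac ρ i))
        - S.ctot ρ' * (S.molarFrac ρ' i * Real.log (S.molarFrac ρ i)) := fun i => by
    rw [← mul_assoc, ← mul_assoc, ctot_mul_molarFrac hS hρ0 hsum,
      ctot_mul_molarFrac hS hρ' hsum']
    ring
  have hpos : ∀ i, 0 < S.molarFrac ρ i := fun i =>
    div_pos (hρ i) (mul_pos (ctot_pos hS hρ0 hsum) (hS.M_pos i))
  have h2 : ∑ i, S.molarFrac ρ' i * Real.log (S.molarFrac ρ i)
      ≤ ∑ i, S.molarFrac ρ' i * Real.log (S.molarFrac ρ' i) := by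
    -- The inequality log t ≤ t - 1 at t = x_i/x'_i. Where x'_i = 0 the logarithmic terms vanish,
    -- and only x_i ≥ 0 remains.
    have h3 : ∀ i, S.molarFrac ρ' i * Real.log (S.molarFrac ρ i)
        ≤ S.molarFrac ρ' i * Real.log (S.molarFrac ρ' i)
          + (S.molarFrac ρ i - S.molarFrac ρ' i) := fun i => by
      rcases (molarFrac_nonneg hS hρ' hsum' i).eq_or_lt with h | h
      · rw [← h]; simpa using (hpos i).le
      · have h4 := Real.log_le_sub_one_of_pos (div_pos (hpos i) h)
        rw [Real.log_div (hpos i).ne' h.ne'] at h4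
        have h5 := mul_le_mul_of_nonneg_left h4 h.le
        have h6 : S.molarFrac ρ' i * (S.molarFrac ρ i / S.molarFrac ρ' i - 1)
            = S.molarFrac ρ i - S.molarFrac ρ' i := by field_simp
        linarith
    refine (Finset.sum_le_sum fun i _ => h3 i).trans (le_of_eq ?_)
    rw [Finset.sum_add_distrib, Finset.sum_sub_distrib, sum_molarFrac hS hρ0 hsum,
      sum_molarFrac hS hρ' hsum', sub_self, add_zero]
  rw [Finset.sum_congr rfl fun i _ => h1 i, Finset.sum_sub_distrib, ← Finset.mul_sum,
    ← Finset.mul_sum, mixEntropy, mixEntropy]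
  have := mul_le_mul_of_nonneg_left h2 (ctot_pos hS hρ' hsum').le
  linarith

/-- Testing an increment of the total charge type with the entropy variables. -/
lemma sum_mul_entropyVar {w : Fin m → ℝ} {φ : ℝ} {ρ : Fin (m + 1) → ℝ} (h : S.IsDensity w φ ρ)
    {q : Fin (m + 1) → ℝ} (hq : ∑ i, q i = 0) (φ₀ : ℝ) :
    ∑ i : Fin m, q i.castSucc * (w i - S.relCharge i * φ₀)
      = ∑ i, q i * (Real.log (S.molarFrac ρ i) / S.M i)
        + (∑ i, S.z i / S.M i * q i) * (φ - φ₀) := by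
  -- Eliminating the last component turns the sum over n species into one over the n - 1 differences
  -- that occur in w and in the relative charges.
  have hq' : q (Fin.last m) = -∑ i : Fin m, q i.castSucc := by
    rw [Fin.sum_univ_castSucc] at hq; linarith
  rw [Fin.sum_univ_castSucc (fun i => q i * _), Fin.sum_univ_castSucc (fun i => _ * q i), hq']
  simp only [neg_mul, mul_neg, Finset.sum_mul, Finset.mul_sum, add_mul, ← Finset.sum_neg_distrib,
    ← Finset.sum_add_distrib]
  refine Finset.sum_congr rfl fun i _ => ?_
  rw [h.2.2 i, relCharge]
  ring

end Mixture

variable {d : ℕ} {Ω Γ : Set (EuclideanSpace ℝ (Fin d))}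
  {u u' : EuclideanSpace ℝ (Fin d) → ℝ}
  {G G' : EuclideanSpace ℝ (Fin d) → EuclideanSpace ℝ (Fin d)}

/-! ### Calculus of weak gradients -/

/-- `u ∈ H¹(Ω)` with weak gradient `G`. -/
structure IsH1Pair (Ω : Set (EuclideanSpace ℝ (Fin d))) (u : EuclideanSpace ℝ (Fin d) → ℝ)
    (G : EuclideanSpace ℝ (Fin d) → EuclideanSpace ℝ (Fin d)) : Prop where
  memLp : MemLp u 2 (volume.restrict Ω)
  memLp_grad : MemLp G 2 (volume.restrict Ω)
  hasWeakGrad : HasWeakGrad Ω u G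

lemma MemH1.isH1Pair (h : MemH1 Ω u) : IsH1Pair Ω u (weakGrad Ω u) :=
  have h2 := Classical.epsilon_spec h.2
  ⟨h.1, h2.1, h2.2⟩

lemma IsH1Pair.memH1 (h : IsH1Pair Ω u G) : MemH1 Ω u := ⟨h.1, G, h.2, h.3⟩

lemma integrableOn_mul_test {v φ : EuclideanSpace ℝ (Fin d) → ℝ}
    (hv : MemLp v 2 (volume.restrict Ω)) (hφ : Continuous φ) (hφc : HasCompactSupport φ) :
    IntegrableOn (fun y => v y * φ y) Ω :=
  hv.integrable_mul (q := 2) ((hφ.memLp_of_hasCompactSupport hφc).restrict Ω)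

lemma memLp_inner_const (hG : MemLp G 2 (volume.restrict Ω)) (a : EuclideanSpace ℝ (Fin d)) :
    MemLp (fun y => inner ℝ (G y) a) 2 (volume.restrict Ω) :=
  hG.inner_const a

lemma continuous_fderiv_apply_const {φ : EuclideanSpace ℝ (Fin d) → ℝ} (hφ : ContDiff ℝ ∞ φ)
    (a : EuclideanSpace ℝ (Fin d)) : Continuous fun y => fderiv ℝ φ y a :=
  (hφ.continuous_fderiv (by simp)).clm_apply continuous_const

lemma IsH1Pair.add (h : IsH1Pair Ω u G) (h' : IsH1Pair Ω u' G') :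
    IsH1Pair Ω (fun y => u y + u' y) (fun y => G y + G' y) := by
  refine ⟨h.1.add h'.1, h.2.add h'.2, fun φ hφ hc hs a => ?_⟩
  have hc' : HasCompactSupport fun y => fderiv ℝ φ y a := hc.fderiv_apply ℝ a
  have hd' := continuous_fderiv_apply_const hφ a
  simp only [add_mul, inner_add_left]
  rw [integral_add (integrableOn_mul_test h.1 hd' hc') (integrableOn_mul_test h'.1 hd' hc'),
    integral_add (integrableOn_mul_test (memLp_inner_const h.2 a) hφ.continuous hc)
      (integrableOn_mul_test (memLp_inner_const h'.2 a) hφ.continuous hc), h.3 φ hφ hc hs a,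
    h'.3 φ hφ hc hs a]
  ring

lemma IsH1Pair.const_mul (h : IsH1Pair Ω u G) (c : ℝ) :
    IsH1Pair Ω (fun y => c * u y) (fun y => c • G y) := by
  refine ⟨h.1.const_mul c, h.2.const_smul c, fun φ hφ hc hs a => ?_⟩
  simp only [real_inner_smul_left, mul_assoc, integral_const_mul, h.3 φ hφ hc hs a, mul_neg]

lemma IsH1Pair.sub (h : IsH1Pair Ω u G) (h' : IsH1Pair Ω u' G') :
    IsH1Pair Ω (fun y => u y - u' y) (fun y => G y - G' y) := by
  simpa [sub_eq_add_neg] using h.add (h'.const_mul (-1))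

lemma isH1Pair_zero : IsH1Pair Ω (fun _ => 0) (fun _ => 0) :=
  ⟨MemLp.zero', MemLp.zero', fun φ _ _ _ a => by simp⟩

lemma IsH1Pair.sum {ι : Type*} (s : Finset ι) {v : ι → EuclideanSpace ℝ (Fin d) → ℝ}
    {g : ι → EuclideanSpace ℝ (Fin d) → EuclideanSpace ℝ (Fin d)}
    (h : ∀ j, IsH1Pair Ω (v j) (g j)) (a : ι → ℝ) :
    IsH1Pair Ω (fun y => ∑ j ∈ s, a j * v j y) (fun y => ∑ j ∈ s, a j • g j y) := by
  classical
  induction s using Finset.induction_on with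
  | empty => simpa using isH1Pair_zero
  | insert j s hj ih => simpa only [Finset.sum_insert hj] using ((h j).const_mul (a j)).add ih

lemma IsH1Pair.congr (h : IsH1Pair Ω u G) (hu : u =ᵐ[volume.restrict Ω] u')
    (hG : G =ᵐ[volume.restrict Ω] G') : IsH1Pair Ω u' G' := by
  refine ⟨h.1.ae_eq hu, h.2.ae_eq hG, fun φ hφ hc hs a => ?_⟩
  have e1 : ∫ y in Ω, u' y * fderiv ℝ φ y a = ∫ y in Ω, u y * fderiv ℝ φ y a :=
    integral_congr_ae (hu.mono fun y hy => by simp only [hy])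
  have e2 : ∫ y in Ω, inner ℝ (G' y) a * φ y = ∫ y in Ω, inner ℝ (G y) a * φ y :=
    integral_congr_ae (hG.mono fun y hy => by simp only [hy])
  rw [e1, e2, h.3 φ hφ hc hs a]

/-- Weak gradients are unique. -/
lemma IsH1Pair.unique (hΩ : IsOpen Ω) (h : IsH1Pair Ω u G) (h' : IsH1Pair Ω u G') :
    G =ᵐ[volume.restrict Ω] G' := by
  have key : ∀ a, ∀ᵐ y ∂(volume : Measure (EuclideanSpace ℝ (Fin d))), y ∈ Ω →
      inner ℝ (G y) a - inner ℝ (G' y) a = 0 := by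
    intro a
    have hm := (memLp_inner_const h.2 a).sub (memLp_inner_const h'.2 a)
    have hloc : LocallyIntegrableOn (fun y => inner ℝ (G y) a - inner ℝ (G' y) a) Ω volume :=
      locallyIntegrableOn_of_locallyIntegrable_restrict
        (hm.locallyIntegrable (by norm_num))
    refine hΩ.ae_eq_zero_of_integral_contDiff_smul_eq_zero hloc fun φ hφ hc hs => ?_
    have e1 : ∫ y, φ y • (inner ℝ (G y) a - inner ℝ (G' y) a)
        = ∫ y in Ω, φ y • (inner ℝ (G y) a - inner ℝ (G' y) a) := by
      refine (setIntegral_eq_integral_of_forall_compl_eq_zero fun y hy => ?_).symm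
      rw [image_eq_zero_of_notMem_tsupport fun hy' => hy (hs hy'), zero_smul]
    have e2 : ∀ y, φ y • (inner ℝ (G y) a - inner ℝ (G' y) a)
        = inner ℝ (G y) a * φ y - inner ℝ (G' y) a * φ y := fun y => by rw [smul_eq_mul]; ring
    rw [e1]
    simp only [e2]
    rw [integral_sub (integrableOn_mul_test (memLp_inner_const h.2 a) hφ.continuous hc)
      (integrableOn_mul_test (memLp_inner_const h'.2 a) hφ.continuous hc)]
    have := (h.3 φ hφ hc hs a).symm.trans (h'.3 φ hφ hc hs a)
    linarith
  have key' : ∀ᵐ y ∂(volume : Measure (EuclideanSpace ℝ (Fin d))), ∀ i : Fin d, y ∈ Ω →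
      inner ℝ (G y) (EuclideanSpace.single i (1 : ℝ))
        - inner ℝ (G' y) (EuclideanSpace.single i (1 : ℝ)) = 0 :=
    ae_all_iff.2 fun i => key _
  refine (ae_restrict_iff' hΩ.measurableSet).2 (key'.mono fun y hy hyΩ => ?_)
  ext i
  have := hy i hyΩ
  simp only [EuclideanSpace.inner_single_right, one_mul, conj_trivial] at this
  exact sub_eq_zero.1 this

lemma IsH1Pair.weakGrad_ae_eq (hΩ : IsOpen Ω) (h : IsH1Pair Ω u G) :
    weakGrad Ω u =ᵐ[volume.restrict Ω] G :=
  h.memH1.isH1Pair.unique hΩ h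

lemma weakGrad_ae_eq_zero (hΩ : IsOpen Ω) (hu : u =ᵐ[volume.restrict Ω] 0) :
    weakGrad Ω u =ᵐ[volume.restrict Ω] 0 :=
  (isH1Pair_zero.congr hu.symm EventuallyEq.rfl).weakGrad_ae_eq hΩ

/-! ### Functions of vanishing trace -/

lemma memH1D_zero (hΩ : IsOpen Ω) : MemH1D Ω Γ (fun _ => 0) := by
  refine ⟨isH1Pair_zero.memH1, fun _ _ => 0, fun _ => contDiff_const, ?_, ?_, ?_⟩
  · simp
  · have h : ∀ j : ℕ, eLpNorm (fun y => gradient (fun _ : EuclideanSpace ℝ (Fin d) => (0 : ℝ)) y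
        - weakGrad Ω (fun _ => 0) y) 2 (volume.restrict Ω) = 0 := fun j => by
      rw [eLpNorm_congr_ae (g := 0) ?_, eLpNorm_zero]
      filter_upwards [weakGrad_ae_eq_zero hΩ (u := fun _ => 0) EventuallyEq.rfl] with y hy
      simp [hy]
    exact tendsto_const_nhds.congr fun j => (h j).symm
  · simp

lemma gradient_add_apply {φ φ' : EuclideanSpace ℝ (Fin d) → ℝ} (h : ContDiff ℝ ∞ φ)
    (h' : ContDiff ℝ ∞ φ') (y : EuclideanSpace ℝ (Fin d)) :
    gradient (fun y => φ y + φ' y) y = gradient φ y + gradient φ' y := by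
  have := fderiv_fun_add ((h.differentiable (by simp)) y) ((h'.differentiable (by simp)) y)
  simp [gradient, this]

lemma gradient_const_mul_apply {φ : EuclideanSpace ℝ (Fin d) → ℝ} (h : ContDiff ℝ ∞ φ) (c : ℝ)
    (y : EuclideanSpace ℝ (Fin d)) : gradient (fun y => c * φ y) y = c • gradient φ y := by
  have := fderiv_const_mul ((h.differentiable (by simp)) y) c
  simp [gradient, this]

lemma continuous_gradient {φ : EuclideanSpace ℝ (Fin d) → ℝ} (h : ContDiff ℝ ∞ φ) :
    Continuous (gradient φ) :=
  (InnerProductSpace.toDual ℝ _).symm.continuous.comp (h.continuous_fderiv (by simp))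

lemma tendsto_eLpNorm_add {α F : Type*} [MeasurableSpace α] [NormedAddCommGroup F]
    {μ : Measure α} {f f' g : ℕ → α → F} (hf : ∀ j, AEStronglyMeasurable (f j) μ)
    (hf' : ∀ j, AEStronglyMeasurable (f' j) μ)
    (h : Tendsto (fun j => eLpNorm (f j) 2 μ) atTop (𝓝 0))
    (h' : Tendsto (fun j => eLpNorm (f' j) 2 μ) atTop (𝓝 0))
    (hg : ∀ j, g j =ᵐ[μ] f j + f' j) : Tendsto (fun j => eLpNorm (g j) 2 μ) atTop (𝓝 0) := by
  refine tendsto_of_tendsto_of_tendsto_of_le_of_le tendsto_const_nhds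
    (by simpa using h.add h') (fun _ => zero_le) fun j => ?_
  simp only
  rw [eLpNorm_congr_ae (hg j)]
  exact eLpNorm_add_le (hf j) (hf' j) (by norm_num)

lemma MemH1D.add (hΩ : IsOpen Ω) (h : MemH1D Ω Γ u) (h' : MemH1D Ω Γ u') :
    MemH1D Ω Γ (fun y => u y + u' y) := by
  obtain ⟨hu, φ, hφ, h1, h2, h3⟩ := h
  obtain ⟨hu', φ', hφ', h1', h2', h3'⟩ := h'
  have hadd := hu.isH1Pair.add hu'.isH1Pair
  refine ⟨hadd.memH1, fun j y => φ j y + φ' j y, fun j => (hφ j).add (hφ' j), ?_, ?_, ?_⟩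
  · refine tendsto_eLpNorm_add (fun j => ?_) (fun j => ?_) h1 h1' fun j => ?_
    · exact (hφ j).continuous.aestronglyMeasurable.sub hu.1.1
    · exact (hφ' j).continuous.aestronglyMeasurable.sub hu'.1.1
    · exact Eventually.of_forall fun y => by simp only [Pi.add_apply]; ring
  · refine tendsto_eLpNorm_add (fun j => ?_) (fun j => ?_) h2 h2' fun j => ?_
    · exact (continuous_gradient (hφ j)).aestronglyMeasurable.sub hu.isH1Pair.2.1
    · exact (continuous_gradient (hφ' j)).aestronglyMeasurable.sub hu'.isH1Pair.2.1
    · filter_upwards [hadd.weakGrad_ae_eq hΩ] with y hy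
      rw [hy, gradient_add_apply (hφ j) (hφ' j), Pi.add_apply]
      abel
  · exact tendsto_eLpNorm_add (fun j => (hφ j).continuous.aestronglyMeasurable)
      (fun j => (hφ' j).continuous.aestronglyMeasurable) h3 h3' fun j => EventuallyEq.rfl

lemma tendsto_eLpNorm_const_smul {α F : Type*} [MeasurableSpace α] [NormedAddCommGroup F]
    [NormedSpace ℝ F] {μ : Measure α} {f g : ℕ → α → F} (c : ℝ)
    (h : Tendsto (fun j => eLpNorm (f j) 2 μ) atTop (𝓝 0))
    (hg : ∀ j, g j =ᵐ[μ] c • f j) : Tendsto (fun j => eLpNorm (g j) 2 μ) atTop (𝓝 0) := by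
  have : (fun j => eLpNorm (g j) 2 μ) = fun j => ‖c‖ₑ * eLpNorm (f j) 2 μ := by
    ext j; rw [eLpNorm_congr_ae (hg j), eLpNorm_const_smul]
  rw [this]
  simpa using ENNReal.Tendsto.const_mul h (Or.inr (by simp))

lemma MemH1D.const_mul (hΩ : IsOpen Ω) (h : MemH1D Ω Γ u) (c : ℝ) :
    MemH1D Ω Γ (fun y => c * u y) := by
  obtain ⟨hu, φ, hφ, h1, h2, h3⟩ := h
  have hmul := hu.isH1Pair.const_mul c
  refine ⟨hmul.memH1, fun j y => c * φ j y, fun j => contDiff_const.mul (hφ j), ?_, ?_, ?_⟩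
  · exact tendsto_eLpNorm_const_smul c h1 fun j => Eventually.of_forall fun y => by
      simp only [Pi.smul_apply, smul_eq_mul]; ring
  · refine tendsto_eLpNorm_const_smul c h2 fun j => ?_
    filter_upwards [hmul.weakGrad_ae_eq hΩ] with y hy
    rw [hy, gradient_const_mul_apply (hφ j), Pi.smul_apply, smul_sub]
  · exact tendsto_eLpNorm_const_smul c h3 fun j => EventuallyEq.rfl

lemma MemH1D.sum (hΩ : IsOpen Ω) {ι : Type*} (s : Finset ι)
    {v : ι → EuclideanSpace ℝ (Fin d) → ℝ} (h : ∀ j, MemH1D Ω Γ (v j)) (a : ι → ℝ) :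
    MemH1D Ω Γ (fun y => ∑ j ∈ s, a j * v j y) := by
  classical
  induction s using Finset.induction_on with
  | empty => simpa using memH1D_zero hΩ
  | insert j s hj ih =>
    simpa only [Finset.sum_insert hj] using ((h j).const_mul hΩ (a j)).add hΩ ih

variable {d : ℕ} {Ω Γ : Set (EuclideanSpace ℝ (Fin d))}

/-! ### Functions of vanishing gradient and trace -/

lemma norm_gradient (φ : EuclideanSpace ℝ (Fin d) → ℝ) (y : EuclideanSpace ℝ (Fin d)) :
    ‖gradient φ y‖ = ‖fderiv ℝ φ y‖ := by
  simp [gradient]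

/-- The fundamental theorem of calculus along the segment. The bound is the same for all t ∈ (0, δ],
so it can be averaged over t in the trace estimate. -/
lemma enorm_sub_le_lintegral_gradient {φ : EuclideanSpace ℝ (Fin d) → ℝ} (hφ : ContDiff ℝ ∞ φ)
    (x e : EuclideanSpace ℝ (Fin d)) {t δ : ℝ} (ht : t ∈ Set.Ioc 0 δ) :
    ‖φ (x + t • e) - φ x‖ₑ ≤ ‖e‖ₑ * ∫⁻ s in Set.Ioc 0 δ, ‖gradient φ (x + s • e)‖ₑ := by
  have hder : ∀ s : ℝ, HasDerivAt (fun s : ℝ => φ (x + s • e)) (fderiv ℝ φ (x + s • e) e) s := by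
    intro s
    have h1 : HasDerivAt (fun s : ℝ => x + s • e) e s := by
      simpa using ((hasDerivAt_id s).smul_const e).const_add x
    exact ((hφ.differentiable (by simp)) _).hasFDerivAt.comp_hasDerivAt s h1
  have hcont : Continuous fun s : ℝ => fderiv ℝ φ (x + s • e) e :=
    (continuous_fderiv_apply_const hφ e).comp (by fun_prop)
  have h1 := intervalIntegral.integral_eq_sub_of_hasDerivAt (fun s _ => hder s)
    (hcont.intervalIntegrable 0 t)
  rw [zero_smul, add_zero] at h1
  rw [← h1, intervalIntegral.integral_of_le ht.1.le]
  refine (enorm_integral_le_lintegral_enorm _).trans ?_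
  rw [← lintegral_const_mul' _ _ (by simp)]
  refine (lintegral_mono_set (Set.Ioc_subset_Ioc_right ht.2)).trans (lintegral_mono fun s => ?_)
  have h2 := (fderiv ℝ φ (x + s • e)).le_opENorm e
  have h3 : ‖fderiv ℝ φ (x + s • e)‖ₑ = ‖gradient φ (x + s • e)‖ₑ := by
    simp only [← ofReal_norm, norm_gradient]
  rw [← h3, mul_comm]
  exact h2

lemma setLIntegral_ball_translate_le (hΩ : IsOpen Ω) {p a : EuclideanSpace ℝ (Fin d)} {r : ℝ}
    (hball : Metric.ball p (2 * r) ⊆ Ω) (ha : ‖a‖ ≤ r)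
    (F : EuclideanSpace ℝ (Fin d) → ENNReal) :
    ∫⁻ x in Metric.ball p r, F (x + a) ≤ ∫⁻ x in Ω, F x := by
  rw [← lintegral_indicator measurableSet_ball, ← lintegral_indicator hΩ.measurableSet,
    ← lintegral_add_right_eq_self (Ω.indicator F) a]
  refine lintegral_mono fun x => ?_
  by_cases hx : x ∈ Metric.ball p r
  · have : x + a ∈ Ω := hball (by
      rw [Metric.mem_ball, dist_eq_norm] at hx ⊢
      calc ‖x + a - p‖ = ‖(x - p) + a‖ := by congr 1; abel
        _ ≤ ‖x - p‖ + ‖a‖ := norm_add_le _ _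
        _ < 2 * r := by linarith)
    rw [Set.indicator_of_mem hx, Set.indicator_of_mem this]
  · rw [Set.indicator_of_notMem hx]; exact zero_le

/-- For the smooth φ j the difference φ j (x + h) - φ j x is the integral of the gradient along a
segment inside Ω, so by Tonelli its L¹ norm on the ball tends to zero. It also converges to ψ(x + h)
- ψ(x). -/
lemma ae_translate_eq (hΩ : IsOpen Ω) {ψ : EuclideanSpace ℝ (Fin d) → ℝ} (hψ : Measurable ψ)
    {φ : ℕ → EuclideanSpace ℝ (Fin d) → ℝ} (hφ : ∀ j, ContDiff ℝ ∞ (φ j))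
    (h1 : Tendsto (fun j => ∫⁻ y in Ω, ‖φ j y - ψ y‖ₑ) atTop (𝓝 0))
    (h2 : Tendsto (fun j => ∫⁻ y in Ω, ‖gradient (φ j) y‖ₑ) atTop (𝓝 0))
    {p h : EuclideanSpace ℝ (Fin d)} {r : ℝ} (hball : Metric.ball p (2 * r) ⊆ Ω)
    (hh : ‖h‖ ≤ r) : ∀ᵐ x, x ∈ Metric.ball p r → ψ (x + h) = ψ x := by
  have hr : 0 ≤ r := (norm_nonneg _).trans hh
  have hgm : ∀ j, Measurable fun y => ‖gradient (φ j) y‖ₑ := fun j =>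
    (continuous_gradient (hφ j)).enorm.measurable
  have hdm : ∀ j, Measurable fun y => ‖φ j y - ψ y‖ₑ := fun j =>
    ((hφ j).continuous.measurable.sub hψ).enorm
  have hgrad : ∀ j, ∫⁻ x in Metric.ball p r, ‖φ j (x + h) - φ j x‖ₑ
      ≤ ‖h‖ₑ * ∫⁻ y in Ω, ‖gradient (φ j) y‖ₑ := by
    intro j
    calc ∫⁻ x in Metric.ball p r, ‖φ j (x + h) - φ j x‖ₑ
        ≤ ∫⁻ x in Metric.ball p r, ‖h‖ₑ * ∫⁻ s in Set.Ioc (0 : ℝ) 1,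
            ‖gradient (φ j) (x + s • h)‖ₑ := lintegral_mono fun x => by
          simpa using enorm_sub_le_lintegral_gradient (hφ j) x h (t := 1) (δ := 1)
            ⟨one_pos, le_rfl⟩
      _ = ‖h‖ₑ * ∫⁻ s in Set.Ioc (0 : ℝ) 1, ∫⁻ x in Metric.ball p r,
            ‖gradient (φ j) (x + s • h)‖ₑ := by
          rw [lintegral_const_mul' _ _ (by simp), lintegral_lintegral_swap]
          exact ((hgm j).comp (by fun_prop : Measurable fun q : EuclideanSpace ℝ (Fin d) × ℝ =>
            q.1 + q.2 • h)).aemeasurable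
      _ ≤ ‖h‖ₑ * ∫⁻ s in Set.Ioc (0 : ℝ) 1, ∫⁻ y in Ω, ‖gradient (φ j) y‖ₑ := by
          gcongr ‖h‖ₑ * ?_
          refine setLIntegral_mono' measurableSet_Ioc fun s hs => ?_
          refine setLIntegral_ball_translate_le hΩ hball ?_ fun y => ‖gradient (φ j) y‖ₑ
          rw [norm_smul, Real.norm_of_nonneg hs.1.le]
          exact (mul_le_of_le_one_left (norm_nonneg _) hs.2).trans hh
      _ = _ := by simp
  have hle : ∀ j, ∫⁻ x in Metric.ball p r, ‖ψ (x + h) - ψ x‖ₑ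
      ≤ (∫⁻ y in Ω, ‖φ j y - ψ y‖ₑ) + (‖h‖ₑ * ∫⁻ y in Ω, ‖gradient (φ j) y‖ₑ)
        + ∫⁻ y in Ω, ‖φ j y - ψ y‖ₑ := by
    intro j
    have hsub : Metric.ball p r ⊆ Ω := (Metric.ball_subset_ball (by linarith)).trans hball
    calc ∫⁻ x in Metric.ball p r, ‖ψ (x + h) - ψ x‖ₑ
        ≤ ∫⁻ x in Metric.ball p r, ((‖φ j (x + h) - ψ (x + h)‖ₑ + ‖φ j (x + h) - φ j x‖ₑ)
            + ‖φ j x - ψ x‖ₑ) := lintegral_mono fun x => by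
          have : ψ (x + h) - ψ x = -(φ j (x + h) - ψ (x + h)) + (φ j (x + h) - φ j x)
            + (φ j x - ψ x) := by ring
          rw [this]
          refine (enorm_add_le _ _).trans ?_
          gcongr
          refine (enorm_add_le _ _).trans ?_
          rw [enorm_neg]
      _ = (∫⁻ x in Metric.ball p r, ‖φ j (x + h) - ψ (x + h)‖ₑ)
          + (∫⁻ x in Metric.ball p r, ‖φ j (x + h) - φ j x‖ₑ)
          + ∫⁻ x in Metric.ball p r, ‖φ j x - ψ x‖ₑ := by
          have hm1 : Measurable fun x => ‖φ j (x + h) - ψ (x + h)‖ₑ :=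
            (hdm j).comp (measurable_add_const h)
          rw [lintegral_add_right _ (hdm j), lintegral_add_left hm1]
      _ ≤ _ := by
          exact add_le_add_three
            (setLIntegral_ball_translate_le hΩ hball hh fun y => ‖φ j y - ψ y‖ₑ) (hgrad j)
            (lintegral_mono_set hsub)
  have hlim : Tendsto (fun j => (∫⁻ y in Ω, ‖φ j y - ψ y‖ₑ)
      + (‖h‖ₑ * ∫⁻ y in Ω, ‖gradient (φ j) y‖ₑ) + ∫⁻ y in Ω, ‖φ j y - ψ y‖ₑ) atTop (𝓝 0) := by
    simpa using (h1.add (ENNReal.Tendsto.const_mul h2 (Or.inr (by simp)))).add h1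
  have h0 : ∫⁻ x in Metric.ball p r, ‖ψ (x + h) - ψ x‖ₑ = 0 :=
    le_antisymm (ge_of_tendsto' hlim hle) zero_le
  have hm2 : Measurable fun x => ‖ψ (x + h) - ψ x‖ₑ :=
    ((hψ.comp (measurable_add_const h)).sub hψ).enorm
  rw [lintegral_eq_zero_iff hm2] at h0
  filter_upwards [(ae_restrict_iff' measurableSet_ball).1 h0] with x hx hxb
  simpa [sub_eq_zero] using hx hxb

lemma exists_ae_eq_const_ball (hΩ : IsOpen Ω) {ψ : EuclideanSpace ℝ (Fin d) → ℝ}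
    (hψ : Measurable ψ) {φ : ℕ → EuclideanSpace ℝ (Fin d) → ℝ} (hφ : ∀ j, ContDiff ℝ ∞ (φ j))
    (h1 : Tendsto (fun j => ∫⁻ y in Ω, ‖φ j y - ψ y‖ₑ) atTop (𝓝 0))
    (h2 : Tendsto (fun j => ∫⁻ y in Ω, ‖gradient (φ j) y‖ₑ) atTop (𝓝 0))
    {p : EuclideanSpace ℝ (Fin d)} (hp : p ∈ Ω) :
    ∃ c r : ℝ, 0 < r ∧ ∀ᵐ y, y ∈ Metric.ball p r → ψ y = c := by
  obtain ⟨R, hR, hball⟩ := Metric.isOpen_iff.1 hΩ p hp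
  set r := R / 2 with hr
  have hr0 : 0 < r := by positivity
  have hball' : Metric.ball p (2 * r) ⊆ Ω := by rwa [hr, mul_div_cancel₀ _ two_ne_zero]
  have h3 : ∀ᵐ h : EuclideanSpace ℝ (Fin d), ∀ᵐ x : EuclideanSpace ℝ (Fin d),
      (‖h‖ ≤ r ∧ x ∈ Metric.ball p r) → ψ (x + h) = ψ x := Eventually.of_forall fun h => by
    by_cases hh : ‖h‖ ≤ r
    · filter_upwards [ae_translate_eq hΩ hψ hφ h1 h2 hball' hh] with x hx hhx
      exact hx hhx.2
    · exact Eventually.of_forall fun x hx => absurd hx.1 hh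
  have hmeas : MeasurableSet {q : EuclideanSpace ℝ (Fin d) × EuclideanSpace ℝ (Fin d) |
      (‖q.1‖ ≤ r ∧ q.2 ∈ Metric.ball p r) → ψ (q.2 + q.1) = ψ q.2} := by
    have m1 : MeasurableSet {q : EuclideanSpace ℝ (Fin d) × EuclideanSpace ℝ (Fin d) |
        ‖q.1‖ ≤ r ∧ q.2 ∈ Metric.ball p r} :=
      (measurableSet_le measurable_fst.norm measurable_const).inter
        (measurable_snd measurableSet_ball)
    have m2 : MeasurableSet {q : EuclideanSpace ℝ (Fin d) × EuclideanSpace ℝ (Fin d) |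
        ψ (q.2 + q.1) = ψ q.2} :=
      measurableSet_eq_fun (hψ.comp (measurable_snd.add measurable_fst)) (hψ.comp measurable_snd)
    have : {q : EuclideanSpace ℝ (Fin d) × EuclideanSpace ℝ (Fin d) |
        (‖q.1‖ ≤ r ∧ q.2 ∈ Metric.ball p r) → ψ (q.2 + q.1) = ψ q.2}
        = {q | ‖q.1‖ ≤ r ∧ q.2 ∈ Metric.ball p r}ᶜ ∪ {q | ψ (q.2 + q.1) = ψ q.2} := by
      ext q; simp only [Set.mem_ofPred_eq, Set.mem_union, Set.mem_compl_iff]; tauto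
    rw [this]
    exact m1.compl.union m2
  -- Fubini exchanges "for every shift, almost every point" for "for almost every point, almost
  -- every shift"; one good point x near p then gives the constant ψ x.
  rw [Measure.ae_ae_comm hmeas] at h3
  have hpos : (volume : Measure (EuclideanSpace ℝ (Fin d))) (Metric.ball p (r / 2)) ≠ 0 :=
    (Metric.measure_ball_pos _ _ (by positivity)).ne'
  obtain ⟨x, hx, hxp⟩ : ∃ x, (∀ᵐ h, (‖h‖ ≤ r ∧ x ∈ Metric.ball p r) → ψ (x + h) = ψ x) ∧
      x ∈ Metric.ball p (r / 2) := by
    by_contra! hcon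
    exact hpos (measure_eq_zero_iff_ae_notMem.2 (h3.mono hcon))
  refine ⟨ψ x, r / 2, by positivity, ?_⟩
  have hq := (measurePreserving_add_right volume (-x)).quasiMeasurePreserving.ae hx
  filter_upwards [hq] with y hy hyb
  have e : x + (y + -x) = y := by abel
  rw [e] at hy
  refine hy ⟨?_, Metric.ball_subset_ball (by linarith) hxp⟩
  rw [← sub_eq_add_neg, ← dist_eq_norm]
  rw [Metric.mem_ball] at hyb hxp
  linarith [dist_triangle_right y x p]

/-- The local constants are unique because balls have positive measure, and they do not change near
a given point; connectedness makes them equal throughout Ω. -/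
lemma exists_ae_eq_const (hΩ : IsOpen Ω) (hconn : IsConnected Ω)
    {ψ : EuclideanSpace ℝ (Fin d) → ℝ}
    (hψ : Measurable ψ) {φ : ℕ → EuclideanSpace ℝ (Fin d) → ℝ} (hφ : ∀ j, ContDiff ℝ ∞ (φ j))
    (h1 : Tendsto (fun j => ∫⁻ y in Ω, ‖φ j y - ψ y‖ₑ) atTop (𝓝 0))
    (h2 : Tendsto (fun j => ∫⁻ y in Ω, ‖gradient (φ j) y‖ₑ) atTop (𝓝 0)) :
    ∃ c : ℝ, ∀ᵐ y ∂(volume.restrict Ω), ψ y = c := by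
  set P : EuclideanSpace ℝ (Fin d) → ℝ → Prop := fun p c =>
    ∃ r : ℝ, 0 < r ∧ ∀ᵐ y, y ∈ Metric.ball p r → ψ y = c with hP
  have hex : ∀ p ∈ Ω, ∃ c, P p c := fun p hp => exists_ae_eq_const_ball hΩ hψ hφ h1 h2 hp
  have hev : ∀ p c, P p c → ∀ᶠ q in 𝓝 p, P q c := by
    rintro p c ⟨r, hr, h⟩
    filter_upwards [Metric.ball_mem_nhds p hr] with q hq
    refine ⟨r - dist q p, sub_pos.2 hq, ?_⟩
    filter_upwards [h] with y hy hyb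
    refine hy ?_
    rw [Metric.mem_ball] at hyb ⊢
    linarith [dist_triangle y q p]
  have huniq : ∀ p c c', P p c → P p c' → c = c' := by
    rintro p c c' ⟨r, hr, h⟩ ⟨r', hr', h'⟩
    by_contra hne
    have hpos : (volume : Measure (EuclideanSpace ℝ (Fin d))) (Metric.ball p (min r r')) ≠ 0 :=
      (Metric.measure_ball_pos _ _ (by positivity)).ne'
    refine hpos (measure_eq_zero_iff_ae_notMem.2 ?_)
    filter_upwards [h, h'] with y h h' hy
    exact hne ((h (Metric.ball_subset_ball (min_le_left _ _) hy)).symm.trans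
      (h' (Metric.ball_subset_ball (min_le_right _ _) hy)))
  obtain ⟨p₀, hp₀⟩ := hconn.nonempty
  obtain ⟨c, hc⟩ := hex p₀ hp₀
  have hall : ∀ p ∈ Ω, P p c := by
    intro p hp
    refine (hconn.isPreconnected.induction₂ (fun x y => ∀ c, P x c ↔ P y c)
      (fun x hx => ?_) (fun x y z _ _ _ hxy hyz c => (hxy c).trans (hyz c))
      (fun x y _ _ hxy c => (hxy c).symm) hp₀ hp c).1 hc
    · obtain ⟨cx, hcx⟩ := hex x hx
      filter_upwards [nhdsWithin_le_nhds (hev x cx hcx)] with y hy c'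
      constructor
      · intro h; rwa [huniq x c' cx h hcx]
      · intro h; rwa [huniq y c' cx h hy]
  refine ⟨c, (ae_restrict_iff' hΩ.measurableSet).2 ?_⟩
  have : (volume : Measure (EuclideanSpace ℝ (Fin d))) {y | y ∈ Ω ∧ ψ y ≠ c} = 0 := by
    refine measure_null_of_locally_null _ fun x hx => ?_
    obtain ⟨r, hr, h⟩ := hall x hx.1
    refine ⟨Metric.ball x r ∩ {y | y ∈ Ω ∧ ψ y ≠ c}, inter_mem
      (nhdsWithin_le_nhds (Metric.ball_mem_nhds x hr)) self_mem_nhdsWithin, ?_⟩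
    refine measure_eq_zero_iff_ae_notMem.2 ?_
    filter_upwards [h] with y hy hy'
    exact hy'.2.2 (hy hy'.1)
  filter_upwards [measure_eq_zero_iff_ae_notMem.1 this] with y hy hyΩ
  by_contra hne
  exact hy ⟨hyΩ, hne⟩

/-- A trace inequality: near a boundary point the surface integral of the averages over short
vertical segments is controlled by a volume integral. -/
lemma exists_trace_bound (hΩ : IsOpen Ω) {p e : EuclideanSpace ℝ (Fin d)}
    {K : NNReal} {γ : EuclideanSpace ℝ (Fin d) → ℝ} {R : ℝ} (he : ‖e‖ = 1)
    (hγ : LipschitzWith K γ) (hR : 0 < R)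
    (hgraph : ∀ y ∈ Metric.ball p R, (y ∈ Ω ↔ inner ℝ e y < γ (y - inner ℝ e y • e))) :
    ∃ C : ENNReal, C ≠ ⊤ ∧ ∀ F : EuclideanSpace ℝ (Fin d) → ENNReal, Measurable F →
      ∫⁻ y in frontier Ω ∩ Metric.ball p (R / 2),
        (∫⁻ t in Set.Ioc (0 : ℝ) (R / 2), F (y + t • (-e))) ∂(Measure.hausdorffMeasure ((d : ℝ) - 1))
      ≤ C * ∫⁻ y in Ω, F y := by
  have hee : inner ℝ e e = 1 := by rw [real_inner_self_eq_norm_sq, he, one_pow]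
  -- Coordinates (x, s) ∈ e^⊥ × ℝ, in which the boundary is the graph s = γ(x) and Ω lies below it.
  set W : Submodule ℝ (EuclideanSpace ℝ (Fin d)) := (Submodule.span ℝ {e})ᗮ with hW
  have hWe : ∀ x : W, inner ℝ e (x : EuclideanSpace ℝ (Fin d)) = 0 := fun x =>
    Submodule.mem_orthogonal_singleton_iff_inner_right.1 x.2
  have hproj : ∀ y : EuclideanSpace ℝ (Fin d), y - inner ℝ e y • e ∈ W := fun y => by
    rw [hW, Submodule.mem_orthogonal_singleton_iff_inner_right, inner_sub_right,
      real_inner_smul_right, hee, mul_one, sub_self]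
  let T₀ : (W × ℝ) ≃ₗ[ℝ] EuclideanSpace ℝ (Fin d) :=
    { toFun := fun q => (q.1 : EuclideanSpace ℝ (Fin d)) + q.2 • e
      map_add' := fun q q' => by
        simp only [Prod.fst_add, Prod.snd_add, Submodule.coe_add, add_smul]; abel
      map_smul' := fun c q => by
        simp only [Prod.smul_fst, Prod.smul_snd, Submodule.coe_smul, smul_add, smul_smul,
          smul_eq_mul, RingHom.id_apply]
      invFun := fun y => (⟨y - inner ℝ e y • e, hproj y⟩, inner ℝ e y)
      left_inv := fun q => by
        have h1 : inner ℝ e ((q.1 : EuclideanSpace ℝ (Fin d)) + q.2 • e) = q.2 := by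
          rw [inner_add_right, hWe, real_inner_smul_right, hee, mul_one, zero_add]
        ext1
        · apply Subtype.ext
          simp only [h1, add_sub_cancel_right]
        · exact h1
      right_inv := fun y => by simp }
  let T : (W × ℝ) ≃L[ℝ] EuclideanSpace ℝ (Fin d) := T₀.toContinuousLinearEquiv
  have hT : ∀ x s, T (x, s) = (x : EuclideanSpace ℝ (Fin d)) + s • e := fun _ _ => rfl
  let π : EuclideanSpace ℝ (Fin d) → W := fun y => (T.symm y).1
  have hπ : ∀ y, (π y : EuclideanSpace ℝ (Fin d)) = y - inner ℝ e y • e := fun _ => rfl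
  have hπm : Measurable π := (continuous_fst.comp T.symm.continuous).measurable
  have hfin : Module.finrank ℝ W + 1 = d := by
    have := T.toLinearEquiv.finrank_eq
    simpa using this
  have hdW : (d : ℝ) - 1 = (Module.finrank ℝ W : ℝ) := by
    have h1 : ((Module.finrank ℝ W + 1 : ℕ) : ℝ) = d := by exact_mod_cast hfin
    push_cast at h1
    linarith
  let g : W → EuclideanSpace ℝ (Fin d) := fun x => (x : EuclideanSpace ℝ (Fin d)) + γ x • e
  have hg : LipschitzWith (1 + K) g := by
    refine LipschitzWith.add W.subtypeₗᵢ.lipschitz ?_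
    refine LipschitzWith.of_dist_le_mul fun x y => ?_
    rw [dist_eq_norm, ← sub_smul, norm_smul, he, mul_one, ← dist_eq_norm]
    exact hγ.dist_le_mul x y
  have hm : Continuous fun y : EuclideanSpace ℝ (Fin d) => γ (y - inner ℝ e y • e) :=
    hγ.continuous.comp (by fun_prop)
  set Γ₀ := frontier Ω ∩ Metric.ball p (R / 2) with hΓ₀
  have hΓ₀m : MeasurableSet Γ₀ := isClosed_frontier.measurableSet.inter measurableSet_ball
  have hsub : Metric.ball p (R / 2) ⊆ Metric.ball p R := Metric.ball_subset_ball (by linarith)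
  -- Above the graph there is a neighbourhood without points of Ω; a point below it belongs to the
  -- open set Ω. Boundary points can be neither.
  have hbd : ∀ y ∈ Γ₀, inner ℝ e y = γ (y - inner ℝ e y • e) := by
    rintro y ⟨hy, hyb⟩
    refine le_antisymm ?_ ?_
    · by_contra! hlt
      have hopen : IsOpen ({z | γ (z - inner ℝ e z • e) < inner ℝ e z} ∩ Metric.ball p R) :=
        (isOpen_lt hm (by fun_prop)).inter Metric.isOpen_ball
      obtain ⟨z, hz, hzΩ⟩ := mem_closure_iff.1 hy.1 _ hopen ⟨hlt, hsub hyb⟩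
      exact lt_asymm hz.1 ((hgraph z hz.2).1 hzΩ)
    · by_contra! hlt
      have := (hgraph y (hsub hyb)).2 hlt
      rw [hΩ.frontier_eq] at hy
      exact hy.2 this
  have hyg : ∀ y ∈ Γ₀, g (π y) = y := fun y hy => by
    simp only [g, hπ, ← hbd y hy, sub_add_cancel]
  have hin : ∀ y ∈ Γ₀, ∀ t ∈ Set.Ioc (0 : ℝ) (R / 2), y + t • (-e) ∈ Ω := by
    intro y hy t ht
    have h1 : inner ℝ e (y + t • (-e)) = inner ℝ e y - t := by
      rw [inner_add_right, real_inner_smul_right, inner_neg_right, hee]; ring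
    have h2 : y + t • (-e) - inner ℝ e (y + t • (-e)) • e = y - inner ℝ e y • e := by
      rw [h1, sub_smul, smul_neg]; abel
    refine (hgraph _ ?_).2 ?_
    · have := hy.2
      rw [Metric.mem_ball, dist_eq_norm] at this ⊢
      calc ‖y + t • (-e) - p‖ = ‖(y - p) + t • (-e)‖ := by congr 1; abel
        _ ≤ ‖y - p‖ + ‖t • (-e)‖ := norm_add_le _ _
        _ = ‖y - p‖ + t := by rw [norm_smul, norm_neg, he, mul_one, Real.norm_of_nonneg ht.1.le]
        _ < R := by linarith [ht.2]
    · rw [h2, h1, ← hbd y hy]; linarith [ht.1]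
  set μW : Measure W := Measure.hausdorffMeasure (Module.finrank ℝ W : ℝ) with hμW
  set c₁ : ENNReal := ((1 + K : NNReal) : ENNReal) ^ (Module.finrank ℝ W : ℝ) with hc₁
  -- The graph map is Lipschitz, so surface measure projected to e^⊥ is at most a constant times the
  -- (d-1)-dimensional Hausdorff measure there.
  have hν : ((Measure.hausdorffMeasure ((d : ℝ) - 1)).restrict Γ₀).map π ≤ c₁ • μW := by
    refine Measure.le_iff.2 fun s hs => ?_
    rw [Measure.map_apply hπm hs, Measure.restrict_apply (hπm hs), hdW]
    calc Measure.hausdorffMeasure (Module.finrank ℝ W : ℝ) (π ⁻¹' s ∩ Γ₀)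
        ≤ Measure.hausdorffMeasure (Module.finrank ℝ W : ℝ) (g '' s) :=
          measure_mono fun y hy => ⟨π y, hy.1, hyg y hy.2⟩
      _ ≤ _ := hg.hausdorffMeasure_image_le (by positivity) s
  -- Uniqueness of Haar measure replaces the computation of the constant between the product measure
  -- and Lebesgue measure.
  let κ : NNReal := Measure.addHaarScalarFactor ((μW.prod (volume : Measure ℝ)).map T) volume
  have hκ : (μW.prod (volume : Measure ℝ)).map T = κ • volume :=
    Measure.isAddLeftInvariant_eq_smul _ _
  refine ⟨c₁ * κ, ENNReal.mul_ne_top (ENNReal.rpow_ne_top_of_nonneg (by positivity) (by simp))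
    (by simp), fun F hF => ?_⟩
  set F' := Ω.indicator F with hF'
  have hF'm : Measurable F' := hF.indicator hΩ.measurableSet
  let Φ : W → ENNReal := fun x => ∫⁻ t in Set.Ioc (0 : ℝ) (R / 2), F' (g x + t • (-e))
  have hΦ : Measurable Φ := by
    have h1 : Measurable fun q : W × ℝ => F' (g q.1 + q.2 • (-e)) :=
      hF'm.comp (((hg.continuous.comp continuous_fst).add
        (continuous_snd.smul continuous_const)).measurable)
    exact h1.lintegral_prod_right'
  have hΦle : ∀ x, Φ x ≤ ∫⁻ s : ℝ, F' (T (x, s)) := by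
    intro x
    calc Φ x ≤ ∫⁻ t : ℝ, F' (g x + t • (-e)) := setLIntegral_le_lintegral _ _
      _ = ∫⁻ t : ℝ, F' (T (x, γ x - t)) := by
          refine lintegral_congr fun t => ?_
          rw [hT]
          congr 1
          simp only [g, sub_smul, smul_neg]; abel
      _ = _ := lintegral_sub_left_eq_self (fun s => F' (T (x, s))) (γ x)
  calc _ = ∫⁻ y in Γ₀, Φ (π y) ∂(Measure.hausdorffMeasure ((d : ℝ) - 1)) := by
        refine setLIntegral_congr_fun hΓ₀m fun y hy => ?_
        refine setLIntegral_congr_fun measurableSet_Ioc fun t ht => ?_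
        rw [hyg y hy, hF', Set.indicator_of_mem (hin y hy t ht)]
    _ = ∫⁻ x, Φ x ∂(((Measure.hausdorffMeasure ((d : ℝ) - 1)).restrict Γ₀).map π) :=
        (lintegral_map hΦ hπm).symm
    _ ≤ ∫⁻ x, Φ x ∂(c₁ • μW) := lintegral_mono' hν le_rfl
    _ = c₁ * ∫⁻ x, Φ x ∂μW := lintegral_smul_measure _ _
    _ ≤ c₁ * ∫⁻ x, (∫⁻ s : ℝ, F' (T (x, s))) ∂μW := by
        gcongr with x
        exact hΦle x
    _ = c₁ * ∫⁻ q, F' (T q) ∂(μW.prod (volume : Measure ℝ)) := by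
        rw [lintegral_prod]
        exact (hF'm.comp T.continuous.measurable).aemeasurable
    _ = c₁ * ∫⁻ y, F' y ∂(κ • (volume : Measure (EuclideanSpace ℝ (Fin d)))) := by
        rw [← hκ, lintegral_map hF'm T.continuous.measurable]
    _ = c₁ * κ * ∫⁻ y in Ω, F y := by
        rw [hF', ← lintegral_indicator hΩ.measurableSet, mul_assoc]
        congr 1
        exact lintegral_smul_measure _ _

lemma tendsto_lintegral_enorm_of_tendsto_eLpNorm_two {α F : Type*} [MeasurableSpace α]
    [NormedAddCommGroup F] {μ : Measure α} [IsFiniteMeasure μ] {f : ℕ → α → F}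
    (hf : ∀ j, AEStronglyMeasurable (f j) μ)
    (h : Tendsto (fun j => eLpNorm (f j) 2 μ) atTop (𝓝 0)) :
    Tendsto (fun j => ∫⁻ y, ‖f j y‖ₑ ∂μ) atTop (𝓝 0) := by
  have hle : ∀ j, ∫⁻ y, ‖f j y‖ₑ ∂μ ≤ eLpNorm (f j) 2 μ
      * μ Set.univ ^ (1 / (1 : ENNReal).toReal - 1 / (2 : ENNReal).toReal) := fun j => by
    rw [← eLpNorm_one_eq_lintegral_enorm]
    exact eLpNorm_le_eLpNorm_mul_rpow_measure_univ (by norm_num) (hf j)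
  refine tendsto_of_tendsto_of_tendsto_of_le_of_le tendsto_const_nhds ?_ (fun _ => zero_le) hle
  have := ENNReal.Tendsto.mul_const (b := μ Set.univ ^ (1 / (1 : ENNReal).toReal
    - 1 / (2 : ENNReal).toReal)) h (Or.inr
      (ENNReal.rpow_ne_top_of_nonneg (by norm_num) (measure_ne_top μ _)))
  simpa using this

/-- A function of vanishing gradient whose trace vanishes on a part of the boundary of positive
surface measure is zero. -/
lemma MemH1D.ae_eq_zero (hΩ : IsOpen Ω) (hconn : IsConnected Ω)
    (hbdd : Bornology.IsBounded Ω) (hlip : HasLipschitzBoundary Ω) (hΓ : Γ ⊆ frontier Ω)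
    (hpos : 0 < Measure.hausdorffMeasure ((d : ℝ) - 1) Γ) {u : EuclideanSpace ℝ (Fin d) → ℝ}
    (hu : MemH1D Ω Γ u) (h0 : weakGrad Ω u =ᵐ[volume.restrict Ω] 0) :
    u =ᵐ[volume.restrict Ω] 0 := by
  obtain ⟨huH, φ, hφ, h1, h2, h3⟩ := hu
  have : IsFiniteMeasure (volume.restrict Ω) := ⟨by simpa using hbdd.measure_lt_top⟩
  set ψ := huH.1.1.mk u with hψ
  have hψm : Measurable ψ := huH.1.1.stronglyMeasurable_mk.measurable
  have hψu : u =ᵐ[volume.restrict Ω] ψ := huH.1.1.ae_eq_mk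
  have h1' : Tendsto (fun j => ∫⁻ y in Ω, ‖φ j y - u y‖ₑ) atTop (𝓝 0) :=
    tendsto_lintegral_enorm_of_tendsto_eLpNorm_two
      (fun j => (hφ j).continuous.aestronglyMeasurable.sub huH.1.1) h1
  have h2' : Tendsto (fun j => ∫⁻ y in Ω, ‖gradient (φ j) y‖ₑ) atTop (𝓝 0) := by
    refine tendsto_lintegral_enorm_of_tendsto_eLpNorm_two
      (fun j => (continuous_gradient (hφ j)).aestronglyMeasurable) (h2.congr fun j => ?_)
    refine eLpNorm_congr_ae ?_
    filter_upwards [h0] with y hy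
    rw [hy, Pi.zero_apply, sub_zero]
  obtain ⟨c, hc⟩ := exists_ae_eq_const hΩ hconn hψm hφ (h1'.congr fun j => by
    refine lintegral_congr_ae ?_
    filter_upwards [hψu] with y hy
    rw [hy]) h2'
  have huc : ∀ᵐ y ∂(volume.restrict Ω), u y = c := by
    filter_upwards [hψu, hc] with y hy hy'
    rw [hy, hy']
  suffices c = 0 by
    filter_upwards [huc] with y hy
    rw [hy, this, Pi.zero_apply]
  have h1c : Tendsto (fun j => ∫⁻ y in Ω, ‖φ j y - c‖ₑ) atTop (𝓝 0) := h1'.congr fun j => by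
    refine lintegral_congr_ae ?_
    filter_upwards [huc] with y hy
    rw [hy]
  -- A point of Γ each of whose neighbourhoods meets Γ in positive surface measure, so that one
  -- boundary chart suffices.
  obtain ⟨p, hpΓ, hp⟩ := exists_mem_forall_mem_nhdsWithin_pos_measure hpos.ne'
  obtain ⟨e, K, γ, R, he, hγ, hR, hgraph⟩ := hlip p (hΓ hpΓ)
  obtain ⟨C, hC, hbound⟩ := exists_trace_bound hΩ he hγ hR hgraph
  set H : Measure (EuclideanSpace ℝ (Fin d)) := Measure.hausdorffMeasure ((d : ℝ) - 1) with hH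
  set σ := H.restrict (Metric.ball p (R / 2) ∩ Γ) with hσ
  set δ := R / 2 with hδ
  have hδ0 : 0 < δ := by positivity
  have hσ0 : σ ≠ 0 := by
    rw [hσ, Ne, Measure.restrict_eq_zero]
    exact (hp _ (inter_mem (nhdsWithin_le_nhds (Metric.ball_mem_nhds p hδ0))
      self_mem_nhdsWithin)).ne'
  have hσle : σ ≤ H.restrict (frontier Ω ∩ Metric.ball p (R / 2)) :=
    Measure.restrict_mono (fun y (hy : y ∈ Metric.ball p (R / 2) ∩ Γ) =>
      (⟨hΓ hy.2, hy.1⟩ : y ∈ frontier Ω ∩ Metric.ball p (R / 2))) le_rfl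
  have hσle' : σ ≤ H.restrict Γ := Measure.restrict_mono Set.inter_subset_right le_rfl
  -- φ j(y) is compared with φ j(y - te), and the estimate is integrated over t ∈ (0, δ].
  have hpt : ∀ j y, ENNReal.ofReal δ * ‖φ j y - c‖ₑ
      ≤ (∫⁻ t in Set.Ioc (0 : ℝ) δ, ‖φ j (y + t • (-e)) - c‖ₑ)
        + ENNReal.ofReal δ * ∫⁻ t in Set.Ioc (0 : ℝ) δ, ‖gradient (φ j) (y + t • (-e))‖ₑ := by
    intro j y
    have hne : ‖(-e)‖ₑ = 1 := by rw [enorm_neg, ← ofReal_norm, he, ENNReal.ofReal_one]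
    calc ENNReal.ofReal δ * ‖φ j y - c‖ₑ = ∫⁻ _t in Set.Ioc (0 : ℝ) δ, ‖φ j y - c‖ₑ := by
          rw [setLIntegral_const, Real.volume_Ioc, sub_zero, mul_comm]
      _ ≤ ∫⁻ t in Set.Ioc (0 : ℝ) δ, (‖φ j (y + t • (-e)) - c‖ₑ
            + ∫⁻ s in Set.Ioc (0 : ℝ) δ, ‖gradient (φ j) (y + s • (-e))‖ₑ) := by
          refine setLIntegral_mono' measurableSet_Ioc fun t ht => ?_
          have h4 := enorm_sub_le_lintegral_gradient (hφ j) y (-e) ht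
          rw [hne, one_mul] at h4
          have h5 : φ j y - c = (φ j (y + t • (-e)) - c) + -(φ j (y + t • (-e)) - φ j y) := by ring
          rw [h5]
          refine (enorm_add_le _ _).trans ?_
          rw [enorm_neg]
          gcongr
      _ = _ := by
          rw [lintegral_add_right _ measurable_const, setLIntegral_const, Real.volume_Ioc, sub_zero,
            mul_comm (ENNReal.ofReal δ)]
  have hint : ∀ j, ENNReal.ofReal δ * ∫⁻ y, ‖φ j y - c‖ₑ ∂σ
      ≤ C * (∫⁻ y in Ω, ‖φ j y - c‖ₑ)
        + ENNReal.ofReal δ * (C * ∫⁻ y in Ω, ‖gradient (φ j) y‖ₑ) := by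
    intro j
    have hm1 : Measurable fun y => ‖φ j y - c‖ₑ :=
      ((hφ j).continuous.sub continuous_const).enorm.measurable
    have hm2 : Measurable fun y => ‖gradient (φ j) y‖ₑ :=
      (continuous_gradient (hφ j)).enorm.measurable
    have hline : Measurable fun q : EuclideanSpace ℝ (Fin d) × ℝ => q.1 + q.2 • (-e) := by fun_prop
    have hm3 : Measurable fun y => ∫⁻ t in Set.Ioc (0 : ℝ) δ, ‖φ j (y + t • (-e)) - c‖ₑ :=
      (hm1.comp hline).lintegral_prod_right'
    calc ENNReal.ofReal δ * ∫⁻ y, ‖φ j y - c‖ₑ ∂σ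
        = ∫⁻ y, ENNReal.ofReal δ * ‖φ j y - c‖ₑ ∂σ := (lintegral_const_mul _ hm1).symm
      _ ≤ ∫⁻ y, ((∫⁻ t in Set.Ioc (0 : ℝ) δ, ‖φ j (y + t • (-e)) - c‖ₑ)
          + ENNReal.ofReal δ * ∫⁻ t in Set.Ioc (0 : ℝ) δ, ‖gradient (φ j) (y + t • (-e))‖ₑ)
          ∂(H.restrict (frontier Ω ∩ Metric.ball p (R / 2))) :=
        lintegral_mono' hσle fun y => hpt j y
      _ ≤ _ := by
        rw [lintegral_add_left hm3, lintegral_const_mul' _ _ (by simp)]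
        gcongr
        · exact hbound _ hm1
        · exact hbound _ hm2
  have hlim : Tendsto (fun j => ∫⁻ y, ‖φ j y - c‖ₑ ∂σ) atTop (𝓝 0) := by
    have h4 : Tendsto (fun j => C * (∫⁻ y in Ω, ‖φ j y - c‖ₑ)
        + ENNReal.ofReal δ * (C * ∫⁻ y in Ω, ‖gradient (φ j) y‖ₑ)) atTop (𝓝 0) := by
      simpa using (ENNReal.Tendsto.const_mul h1c (Or.inr hC)).add (ENNReal.Tendsto.const_mul
        (ENNReal.Tendsto.const_mul h2' (Or.inr hC)) (Or.inr ENNReal.ofReal_ne_top))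
    have h5 := tendsto_of_tendsto_of_tendsto_of_le_of_le tendsto_const_nhds h4
      (fun _ => zero_le) hint
    have hδ1 : ENNReal.ofReal δ ≠ 0 := by simpa using hδ0
    have h6 := ENNReal.Tendsto.const_mul (a := (ENNReal.ofReal δ)⁻¹) h5
      (Or.inr (by simpa using hδ0))
    simp only [mul_zero] at h6
    refine h6.congr fun j => ?_
    rw [← mul_assoc, ENNReal.inv_mul_cancel hδ1 ENNReal.ofReal_ne_top, one_mul]
  have hm : ∀ j, AEStronglyMeasurable (φ j) σ := fun j => (hφ j).continuous.aestronglyMeasurable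
  -- On a boundary piece of positive measure the same sequence converges to c, by the trace
  -- inequality, and to 0, by vanishing of the trace.
  have hT1 : TendstoInMeasure σ φ atTop fun _ => c := by
    refine tendstoInMeasure_of_tendsto_eLpNorm one_ne_zero hm aestronglyMeasurable_const ?_
    simpa only [eLpNorm_one_eq_lintegral_enorm, Pi.sub_apply] using hlim
  have hT2 : TendstoInMeasure σ φ atTop fun _ => 0 := by
    refine tendstoInMeasure_of_tendsto_eLpNorm two_ne_zero hm aestronglyMeasurable_const ?_
    refine tendsto_of_tendsto_of_tendsto_of_le_of_le tendsto_const_nhds h3 (fun _ => zero_le)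
      fun j => ?_
    have : φ j - (fun _ => (0 : ℝ)) = φ j := by ext; simp
    simp only [this]
    exact eLpNorm_mono_measure _ hσle'
  have hae := tendstoInMeasure_ae_unique hT1 hT2
  have : (ae σ).NeBot := ae_neBot.2 hσ0
  obtain ⟨y, hy⟩ := hae.exists
  exact hy

/-! ### The Galerkin ansatz in coordinates. -/

namespace Problem

variable {d m N : ℕ}

/-- The standing assumptions on the problem. -/
structure Standing (S : Problem d m N) : Prop where
  one_le_m : 1 ≤ m
  lam_pos : 0 < S.lam
  τ_pos : 0 < S.τ
  ε_pos : 0 < S.ε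
  adm : S.toMixture.Admissible
  domain : S.DomainAssumption
  data : S.DataAssumption
  diff : S.toMixture.DiffusionAssumption
  prod : S.toMixture.ProductionAssumption
  gal : S.GalerkinAssumption

/-- Coefficients of pairs of functions in the Galerkin spaces. -/
abbrev Coeff (N : ℕ) := EuclideanSpace ℝ (Fin N ⊕ Fin N)

variable (S : Problem d m N)

/-- The measure of the domain. -/
abbrev vol : Measure (EuclideanSpace ℝ (Fin d)) := volume.restrict S.Ω

/-- The element of `V_N` with given coefficients. -/
def vComb (x : Coeff N) (y : EuclideanSpace ℝ (Fin d)) (i : Fin m) : ℝ :=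
  ∑ j, x (Sum.inl j) * S.v j y i

/-- The element of `P_N` with given coefficients. -/
def θComb (x : Coeff N) (y : EuclideanSpace ℝ (Fin d)) : ℝ :=
  ∑ j, x (Sum.inr j) * S.θ j y

/-- A fixed representative of the gradient that is linear in the coefficients at every point,
whereas `weakGrad` of a linear combination is known only almost everywhere. The same purpose is
served by `θGrad`, `wGrad` and `ΦGrad`. -/
def vGrad (x : Coeff N) (i : Fin m) (y : EuclideanSpace ℝ (Fin d)) : EuclideanSpace ℝ (Fin d) :=
  ∑ j, x (Sum.inl j) • weakGrad S.Ω (fun y => S.v j y i) y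

def θGrad (x : Coeff N) (y : EuclideanSpace ℝ (Fin d)) : EuclideanSpace ℝ (Fin d) :=
  ∑ j, x (Sum.inr j) • weakGrad S.Ω (S.θ j) y

def wField (x : Coeff N) : EuclideanSpace ℝ (Fin d) → Fin m → ℝ :=
  fun y i => S.vComb x y i + S.wD y i

def ΦField (x : Coeff N) : EuclideanSpace ℝ (Fin d) → ℝ := fun y => S.θComb x y + S.ΦD y

def wGrad (x : Coeff N) (i : Fin m) (y : EuclideanSpace ℝ (Fin d)) : EuclideanSpace ℝ (Fin d) :=
  S.vGrad x i y + S.relCharge i • weakGrad S.Ω S.ΦD y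

def ΦGrad (x : Coeff N) (y : EuclideanSpace ℝ (Fin d)) : EuclideanSpace ℝ (Fin d) :=
  S.θGrad x y + weakGrad S.Ω S.ΦD y

/-- The densities of the ansatz with coefficients `x`. -/
def rhoField (x : Coeff N) : EuclideanSpace ℝ (Fin d) → Fin (m + 1) → ℝ :=
  S.rho (S.wField x) (S.ΦField x)

/-- A square integrable function that dominates all data of the scheme. -/
def envelope (y : EuclideanSpace ℝ (Fin d)) : ℝ :=
  1 + |S.f y| + ‖weakGrad S.Ω S.ΦD y‖ + ∑ j, (|S.θ j y| + ‖weakGrad S.Ω (S.θ j) y‖)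
    + ∑ j, ∑ i, (|S.v j y i| + ‖weakGrad S.Ω (fun y => S.v j y i) y‖)

variable {S}

lemma Standing.isOpen (h : S.Standing) : IsOpen S.Ω := h.domain.isOpen

lemma Standing.isFiniteMeasure (h : S.Standing) : IsFiniteMeasure S.vol :=
  ⟨by simpa using h.domain.bounded.measure_lt_top⟩

lemma isH1Pair_vComb (h : S.Standing) (x : Coeff N) (i : Fin m) :
    IsH1Pair S.Ω (fun y => S.vComb x y i) (S.vGrad x i) :=
  IsH1Pair.sum Finset.univ (fun j => (h.gal.v_H1 j i).isH1Pair) fun j => x (Sum.inl j)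

lemma isH1Pair_θComb (h : S.Standing) (x : Coeff N) :
    IsH1Pair S.Ω (S.θComb x) (S.θGrad x) :=
  IsH1Pair.sum Finset.univ (fun j => (h.gal.θ_H1D j).1.isH1Pair) fun j => x (Sum.inr j)

lemma memH1D_θComb (h : S.Standing) (x : Coeff N) : MemH1D S.Ω S.ΓD (S.θComb x) :=
  MemH1D.sum h.isOpen Finset.univ h.gal.θ_H1D fun j => x (Sum.inr j)

lemma isH1Pair_wField (h : S.Standing) (x : Coeff N) (i : Fin m) :
    IsH1Pair S.Ω (fun y => S.wField x y i) (S.wGrad x i) :=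
  (isH1Pair_vComb h x i).add (h.data.ΦD_H1.isH1Pair.const_mul _)

lemma isH1Pair_ΦField (h : S.Standing) (x : Coeff N) :
    IsH1Pair S.Ω (S.ΦField x) (S.ΦGrad x) :=
  (isH1Pair_θComb h x).add h.data.ΦD_H1.isH1Pair

lemma vComb_mem_V (x : Coeff N) : S.vComb x ∈ S.V := by
  refine (Submodule.mem_span_range_iff_exists_fun ℝ).2 ⟨fun j => x (Sum.inl j), ?_⟩
  ext y i
  simp [vComb, Finset.sum_apply]

lemma exists_vComb_eq {φ : EuclideanSpace ℝ (Fin d) → Fin m → ℝ} (hφ : φ ∈ S.V) :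
    ∃ x : Coeff N, φ = S.vComb x ∧ ∀ j, x (Sum.inr j) = 0 := by
  obtain ⟨c, rfl⟩ := (Submodule.mem_span_range_iff_exists_fun ℝ).1 hφ
  refine ⟨WithLp.toLp 2 (Sum.elim c 0), ?_, fun j => by simp⟩
  ext y i
  simp [vComb, Finset.sum_apply]

lemma θComb_mem_P (x : Coeff N) : S.θComb x ∈ S.P := by
  refine (Submodule.mem_span_range_iff_exists_fun ℝ).2 ⟨fun j => x (Sum.inr j), ?_⟩
  ext y
  simp [θComb, Finset.sum_apply]

lemma exists_θComb_eq {θ : EuclideanSpace ℝ (Fin d) → ℝ} (hθ : θ ∈ S.P) :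
    ∃ x : Coeff N, θ = S.θComb x ∧ ∀ j, x (Sum.inl j) = 0 := by
  obtain ⟨c, rfl⟩ := (Submodule.mem_span_range_iff_exists_fun ℝ).1 hθ
  refine ⟨WithLp.toLp 2 (Sum.elim 0 c), ?_, fun j => by simp⟩
  ext y
  simp [θComb, Finset.sum_apply]

/-! ### The envelope -/

lemma memLp_envelope (h : S.Standing) : MemLp S.envelope 2 S.vol := by
  have := h.isFiniteMeasure
  have hf : MemLp (fun y => |S.f y|) 2 S.vol := (h.data.f_bdd.mono_exponent le_top).norm
  have hΦ : MemLp (fun y => ‖weakGrad S.Ω S.ΦD y‖) 2 S.vol := h.data.ΦD_H1.isH1Pair.2.norm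
  have hθ : ∀ j, MemLp (fun y => |S.θ j y| + ‖weakGrad S.Ω (S.θ j) y‖) 2 S.vol := fun j =>
    (h.gal.θ_H1D j).1.1.norm.add (h.gal.θ_H1D j).1.isH1Pair.2.norm
  have hv : ∀ j i, MemLp (fun y => |S.v j y i| + ‖weakGrad S.Ω (fun y => S.v j y i) y‖) 2 S.vol :=
    fun j i => (h.gal.v_H1 j i).1.norm.add (h.gal.v_H1 j i).isH1Pair.2.norm
  exact ((((memLp_const (1 : ℝ)).add hf).add hΦ).add (memLp_finsetSum _ fun j _ => hθ j)).add
    (memLp_finsetSum _ fun j _ => memLp_finsetSum _ fun i _ => hv j i)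

lemma integrable_envelope_sq (h : S.Standing) : Integrable (fun y => S.envelope y ^ 2) S.vol :=
  (memLp_envelope h).integrable_sq

lemma sum_θ_nonneg (y : EuclideanSpace ℝ (Fin d)) :
    0 ≤ ∑ j, (|S.θ j y| + ‖weakGrad S.Ω (S.θ j) y‖) :=
  Finset.sum_nonneg fun _ _ => by positivity

lemma sum_v_nonneg (y : EuclideanSpace ℝ (Fin d)) :
    0 ≤ ∑ j, ∑ i, (|S.v j y i| + ‖weakGrad S.Ω (fun y => S.v j y i) y‖) :=
  Finset.sum_nonneg fun _ _ => Finset.sum_nonneg fun _ _ => by positivity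

lemma one_le_envelope (y : EuclideanSpace ℝ (Fin d)) : 1 ≤ S.envelope y := by
  have := S.sum_θ_nonneg y
  have := S.sum_v_nonneg y
  have := abs_nonneg (S.f y)
  have := norm_nonneg (weakGrad S.Ω S.ΦD y)
  unfold envelope; linarith

lemma abs_f_le_envelope (y : EuclideanSpace ℝ (Fin d)) : |S.f y| ≤ S.envelope y := by
  have := S.sum_θ_nonneg y
  have := S.sum_v_nonneg y
  have := norm_nonneg (weakGrad S.Ω S.ΦD y)
  unfold envelope; linarith

lemma norm_grad_ΦD_le_envelope (y : EuclideanSpace ℝ (Fin d)) :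
    ‖weakGrad S.Ω S.ΦD y‖ ≤ S.envelope y := by
  have := S.sum_θ_nonneg y
  have := S.sum_v_nonneg y
  have := abs_nonneg (S.f y)
  unfold envelope; linarith

lemma norm_sum_smul_le {ι F : Type*} [Fintype ι] [NormedAddCommGroup F] [NormedSpace ℝ F]
    {c : ι → ℝ} {R : ℝ} (hc : ∀ j, |c j| ≤ R) (g : ι → F) : ‖∑ j, c j • g j‖ ≤ R * ∑ j, ‖g j‖ := by
  rw [Finset.mul_sum]
  refine (norm_sum_le _ _).trans (Finset.sum_le_sum fun j _ => ?_)
  rw [norm_smul]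
  exact mul_le_mul_of_nonneg_right (hc j) (norm_nonneg _)

lemma abs_coeff_le (x : Coeff N) (k : Fin N ⊕ Fin N) : |x k| ≤ ‖x‖ := PiLp.norm_apply_le x k

lemma abs_vComb_le (x : Coeff N) (y : EuclideanSpace ℝ (Fin d)) (i : Fin m) :
    |S.vComb x y i| ≤ ‖x‖ * S.envelope y := by
  refine (norm_sum_smul_le (fun j => abs_coeff_le x (Sum.inl j)) fun j => S.v j y i).trans ?_
  gcongr
  have h1 : ∑ j, ‖S.v j y i‖ ≤ ∑ j, ∑ i, (|S.v j y i| + ‖weakGrad S.Ω (fun y => S.v j y i) y‖) :=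
    Finset.sum_le_sum fun j _ => (le_add_of_nonneg_right (norm_nonneg _)).trans
      (Finset.single_le_sum (f := fun i => |S.v j y i| + ‖weakGrad S.Ω (fun y => S.v j y i) y‖)
        (fun _ _ => by positivity) (Finset.mem_univ i))
  have := S.sum_θ_nonneg y
  have := abs_nonneg (S.f y)
  have := norm_nonneg (weakGrad S.Ω S.ΦD y)
  unfold envelope; linarith

lemma norm_vGrad_le (x : Coeff N) (y : EuclideanSpace ℝ (Fin d)) (i : Fin m) :
    ‖S.vGrad x i y‖ ≤ ‖x‖ * S.envelope y := by
  refine (norm_sum_smul_le (fun j => abs_coeff_le x (Sum.inl j)) _).trans ?_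
  gcongr
  have h1 : ∑ j, ‖weakGrad S.Ω (fun y => S.v j y i) y‖
      ≤ ∑ j, ∑ i, (|S.v j y i| + ‖weakGrad S.Ω (fun y => S.v j y i) y‖) :=
    Finset.sum_le_sum fun j _ => (le_add_of_nonneg_left (abs_nonneg _)).trans
      (Finset.single_le_sum (f := fun i => |S.v j y i| + ‖weakGrad S.Ω (fun y => S.v j y i) y‖)
        (fun _ _ => by positivity) (Finset.mem_univ i))
  have := S.sum_θ_nonneg y
  have := abs_nonneg (S.f y)
  have := norm_nonneg (weakGrad S.Ω S.ΦD y)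
  unfold envelope; linarith

lemma abs_θComb_le (x : Coeff N) (y : EuclideanSpace ℝ (Fin d)) :
    |S.θComb x y| ≤ ‖x‖ * S.envelope y := by
  refine (norm_sum_smul_le (fun j => abs_coeff_le x (Sum.inr j)) fun j => S.θ j y).trans ?_
  gcongr
  have h1 : ∑ j, ‖S.θ j y‖ ≤ ∑ j, (|S.θ j y| + ‖weakGrad S.Ω (S.θ j) y‖) :=
    Finset.sum_le_sum fun j _ => le_add_of_nonneg_right (norm_nonneg _)
  have := S.sum_v_nonneg y
  have := abs_nonneg (S.f y)
  have := norm_nonneg (weakGrad S.Ω S.ΦD y)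
  unfold envelope; linarith

lemma norm_θGrad_le (x : Coeff N) (y : EuclideanSpace ℝ (Fin d)) :
    ‖S.θGrad x y‖ ≤ ‖x‖ * S.envelope y := by
  refine (norm_sum_smul_le (fun j => abs_coeff_le x (Sum.inr j)) _).trans ?_
  gcongr
  have h1 : ∑ j, ‖weakGrad S.Ω (S.θ j) y‖ ≤ ∑ j, (|S.θ j y| + ‖weakGrad S.Ω (S.θ j) y‖) :=
    Finset.sum_le_sum fun j _ => le_add_of_nonneg_left (abs_nonneg _)
  have := S.sum_v_nonneg y
  have := abs_nonneg (S.f y)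
  have := norm_nonneg (weakGrad S.Ω S.ΦD y)
  unfold envelope; linarith

/-! ### Dominated families of functions -/

/-- Families of functions, continuous in the coefficients, of at most linear growth. -/
structure LinGrowth {F : Type*} [NormedAddCommGroup F] (S : Problem d m N)
    (A : Coeff N → EuclideanSpace ℝ (Fin d) → F) : Prop where
  meas : ∀ x, AEStronglyMeasurable (A x) S.vol
  cont : ∀ y, Continuous fun x => A x y
  bound : ∃ K : ℝ, 0 ≤ K ∧ ∀ x, ∀ᵐ y ∂S.vol, ‖A x y‖ ≤ K * (1 + ‖x‖) * S.envelope y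

/-- Dominated convergence: for ‖x - x₀‖ < 1 the integrands are bounded by a fixed multiple of the
square of the envelope, which is integrable. -/
lemma continuous_integral_of_growth (h : S.Standing)
    {A : Coeff N → EuclideanSpace ℝ (Fin d) → ℝ} (hm : ∀ x, AEStronglyMeasurable (A x) S.vol)
    (hc : ∀ y, Continuous fun x => A x y) {K : ℝ}
    (hb : ∀ x, ∀ᵐ y ∂S.vol, |A x y| ≤ K * (1 + ‖x‖) ^ 2 * S.envelope y ^ 2) :
    Continuous fun x => ∫ y, A x y ∂S.vol := by
  refine continuous_iff_continuousAt.2 fun x₀ => ?_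
  refine continuousAt_of_dominated (bound := fun y => |K| * (2 + ‖x₀‖) ^ 2 * S.envelope y ^ 2)
    (Eventually.of_forall hm) ?_ ((integrable_envelope_sq h).const_mul _)
    (Eventually.of_forall fun y => (hc y).continuousAt)
  filter_upwards [Metric.ball_mem_nhds x₀ one_pos] with x hx
  filter_upwards [hb x] with y hy
  have h1 : ‖x‖ ≤ ‖x₀‖ + 1 := by
    rw [Metric.mem_ball, dist_eq_norm] at hx
    linarith [norm_le_norm_add_norm_sub' x x₀]
  refine hy.trans ?_
  have h2 : 1 + ‖x‖ ≤ 2 + ‖x₀‖ := by linarith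
  gcongr
  exact le_abs_self K

variable {F : Type*} [NormedAddCommGroup F] [InnerProductSpace ℝ F]
  {A A' : Coeff N → EuclideanSpace ℝ (Fin d) → F}

lemma LinGrowth.abs_inner_le (hA : S.LinGrowth A) (hA' : S.LinGrowth A') : ∃ K : ℝ, 0 ≤ K ∧
    ∀ x ξ, ∀ᵐ y ∂S.vol, |inner ℝ (A x y) (A' ξ y)|
      ≤ K * (1 + ‖x‖) * (1 + ‖ξ‖) * S.envelope y ^ 2 := by
  obtain ⟨K, hK, hb⟩ := hA.bound
  obtain ⟨K', hK', hb'⟩ := hA'.bound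
  refine ⟨K * K', by positivity, fun x ξ => ?_⟩
  filter_upwards [hb x, hb' ξ] with y hy hy'
  calc |inner ℝ (A x y) (A' ξ y)| ≤ ‖A x y‖ * ‖A' ξ y‖ := abs_real_inner_le_norm _ _
    _ ≤ (K * (1 + ‖x‖) * S.envelope y) * (K' * (1 + ‖ξ‖) * S.envelope y) :=
      mul_le_mul hy hy' (norm_nonneg _) ((norm_nonneg _).trans hy)
    _ = _ := by ring

lemma LinGrowth.integrable_inner (h : S.Standing) (hA : S.LinGrowth A) (hA' : S.LinGrowth A')
    (x ξ : Coeff N) : Integrable (fun y => inner ℝ (A x y) (A' ξ y)) S.vol := by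
  obtain ⟨K, -, hb⟩ := hA.abs_inner_le hA'
  exact ((integrable_envelope_sq h).const_mul _).mono' ((hA.meas x).inner (hA'.meas ξ)) (hb x ξ)

lemma LinGrowth.continuous_integral_inner (h : S.Standing) (hA : S.LinGrowth A)
    (hA' : S.LinGrowth A') (ξ : Coeff N) :
    Continuous fun x => ∫ y, inner ℝ (A x y) (A' ξ y) ∂S.vol := by
  obtain ⟨K, hK, hb⟩ := hA.abs_inner_le hA'
  refine continuous_integral_of_growth h (K := K * (1 + ‖ξ‖))
    (fun x => (hA.meas x).inner (hA'.meas ξ)) (fun y => (hA.cont y).inner continuous_const)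
    fun x => ?_
  filter_upwards [hb x ξ] with y hy
  refine hy.trans ?_
  have h1 : 1 + ‖x‖ ≤ (1 + ‖x‖) ^ 2 := by nlinarith [norm_nonneg x]
  calc _ = K * (1 + ‖ξ‖) * (1 + ‖x‖) * S.envelope y ^ 2 := by ring
    _ ≤ _ := by gcongr

lemma LinGrowth.continuous_integral_inner_self (h : S.Standing) (hA : S.LinGrowth A) :
    Continuous fun x => ∫ y, inner ℝ (A x y) (A x y) ∂S.vol := by
  obtain ⟨K, hK, hb⟩ := hA.abs_inner_le hA
  refine continuous_integral_of_growth h (K := K)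
    (fun x => (hA.meas x).inner (hA.meas x)) (fun y => (hA.cont y).inner (hA.cont y))
    fun x => ?_
  filter_upwards [hb x x] with y hy
  exact hy.trans (le_of_eq (by ring))

lemma LinGrowth.of_bounded {A : Coeff N → EuclideanSpace ℝ (Fin d) → ℝ}
    (hm : ∀ x, AEStronglyMeasurable (A x) S.vol) (hc : ∀ y, Continuous fun x => A x y)
    {K : ℝ} (hb : ∀ x, ∀ᵐ y ∂S.vol, |A x y| ≤ K) : S.LinGrowth A := by
  refine ⟨hm, hc, |K|, abs_nonneg K, fun x => ?_⟩
  filter_upwards [hb x] with y hy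
  calc ‖A x y‖ ≤ K := hy
    _ ≤ |K| := le_abs_self K
    _ = |K| * 1 * 1 := by ring
    _ ≤ |K| * (1 + ‖x‖) * S.envelope y := by
      have := S.one_le_envelope y
      gcongr
      linarith [norm_nonneg x]

lemma linGrowth_of_le {E' : Type*} [NormedAddCommGroup E']
    {A : Coeff N → EuclideanSpace ℝ (Fin d) → E'}
    (hm : ∀ x, AEStronglyMeasurable (A x) S.vol) (hc : ∀ y, Continuous fun x => A x y)
    (hb : ∀ x y, ‖A x y‖ ≤ ‖x‖ * S.envelope y) : S.LinGrowth A := by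
  refine ⟨hm, hc, 1, zero_le_one, fun x => Eventually.of_forall fun y => (hb x y).trans ?_⟩
  have := S.one_le_envelope y
  gcongr
  linarith

lemma continuous_coeff (k : Fin N ⊕ Fin N) : Continuous fun x : Coeff N => x k := by fun_prop

lemma linGrowth_vComb (h : S.Standing) (i : Fin m) : S.LinGrowth fun x y => S.vComb x y i :=
  linGrowth_of_le (fun x => (isH1Pair_vComb h x i).1.1)
    (fun _ => continuous_finsetSum _ fun _ _ => (continuous_coeff _).mul continuous_const)
    fun x y => abs_vComb_le x y i

lemma linGrowth_θComb (h : S.Standing) : S.LinGrowth S.θComb :=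
  linGrowth_of_le (fun x => (isH1Pair_θComb h x).1.1)
    (fun _ => continuous_finsetSum _ fun _ _ => (continuous_coeff _).mul continuous_const)
    fun x y => abs_θComb_le x y

lemma linGrowth_vGrad (h : S.Standing) (i : Fin m) : S.LinGrowth fun x y => S.vGrad x i y :=
  linGrowth_of_le (fun x => (isH1Pair_vComb h x i).2.1)
    (fun _ => continuous_finsetSum _ fun _ _ => (continuous_coeff _).smul continuous_const)
    fun x y => norm_vGrad_le x y i

lemma linGrowth_θGrad (h : S.Standing) : S.LinGrowth S.θGrad :=
  linGrowth_of_le (fun x => (isH1Pair_θComb h x).2.1)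
    (fun _ => continuous_finsetSum _ fun _ _ => (continuous_coeff _).smul continuous_const)
    fun x y => norm_θGrad_le x y

lemma LinGrowth.add_const {E' : Type*} [NormedAddCommGroup E']
    {A : Coeff N → EuclideanSpace ℝ (Fin d) → E'}
    (hA : S.LinGrowth A) {g : EuclideanSpace ℝ (Fin d) → E'} (hg : AEStronglyMeasurable g S.vol)
    {c : ℝ} (hb : ∀ y, ‖g y‖ ≤ c * S.envelope y) : S.LinGrowth fun x y => A x y + g y := by
  obtain ⟨K, hK, hbA⟩ := hA.bound
  refine ⟨fun x => (hA.meas x).add hg, fun y => (hA.cont y).add continuous_const, K + |c|,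
    by positivity, fun x => ?_⟩
  filter_upwards [hbA x] with y hy
  have h1 : c * S.envelope y ≤ |c| * (1 + ‖x‖) * S.envelope y := by
    have := S.one_le_envelope y
    have h2 : c ≤ |c| * (1 + ‖x‖) := (le_abs_self c).trans
      (le_mul_of_one_le_right (abs_nonneg c) (by linarith [norm_nonneg x]))
    gcongr
  calc ‖A x y + g y‖ ≤ ‖A x y‖ + ‖g y‖ := norm_add_le _ _
    _ ≤ K * (1 + ‖x‖) * S.envelope y + |c| * (1 + ‖x‖) * S.envelope y :=
      add_le_add hy ((hb y).trans h1)
    _ = _ := by ring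

lemma linGrowth_wGrad (h : S.Standing) (i : Fin m) : S.LinGrowth fun x y => S.wGrad x i y :=
  (linGrowth_vGrad h i).add_const (h.data.ΦD_H1.isH1Pair.const_mul _).2.1
    (c := |S.relCharge i|) fun y => by
      rw [norm_smul]
      exact mul_le_mul_of_nonneg_left (norm_grad_ΦD_le_envelope y) (norm_nonneg _)

lemma linGrowth_ΦGrad (h : S.Standing) : S.LinGrowth S.ΦGrad :=
  (linGrowth_θGrad h).add_const h.data.ΦD_H1.isH1Pair.2.1
    (c := 1) fun y => by rw [one_mul]; exact norm_grad_ΦD_le_envelope y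

lemma LinGrowth.bounded_smul {b : Coeff N → EuclideanSpace ℝ (Fin d) → ℝ}
    (hbm : ∀ x, AEStronglyMeasurable (b x) S.vol) (hbc : ∀ y, Continuous fun x => b x y)
    {c : ℝ} (hb : ∀ x y, |b x y| ≤ c) (hA : S.LinGrowth A) :
    S.LinGrowth fun x y => b x y • A x y := by
  obtain ⟨K, hK, hbA⟩ := hA.bound
  refine ⟨fun x => (hbm x).smul (hA.meas x), fun y => (hbc y).smul (hA.cont y), |c| * K,
    by positivity, fun x => ?_⟩
  filter_upwards [hbA x] with y hy
  rw [norm_smul]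
  calc ‖b x y‖ * ‖A x y‖ ≤ |c| * (K * (1 + ‖x‖) * S.envelope y) :=
        mul_le_mul ((hb x y).trans (le_abs_self c)) hy (norm_nonneg _) (abs_nonneg c)
    _ = _ := by ring

/-! ### Fields of densities -/

lemma aestronglyMeasurable_comp_fields {E' : Type*} [TopologicalSpace E'] (h : S.Standing)
    (x : Coeff N) {g : (Fin m → ℝ) × ℝ → E'} (hg : Continuous g) :
    AEStronglyMeasurable (fun y => g (S.wField x y, S.ΦField x y)) S.vol := by
  have h1 : AEMeasurable (fun y => S.wField x y) S.vol :=
    aemeasurable_pi_lambda _ fun i => (isH1Pair_wField h x i).1.1.aemeasurable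
  exact hg.comp_aestronglyMeasurable
    (h1.aestronglyMeasurable.prodMk (isH1Pair_ΦField h x).1.1)

lemma continuous_comp_fields {E' : Type*} [TopologicalSpace E'] (y : EuclideanSpace ℝ (Fin d))
    {g : (Fin m → ℝ) × ℝ → E'} (hg : Continuous g) :
    Continuous fun x : Coeff N => g (S.wField x y, S.ΦField x y) := by
  refine hg.comp (Continuous.prodMk (continuous_pi fun i => ?_) ?_)
  · simp only [wField, vComb]; fun_prop
  · simp only [ΦField, θComb]; fun_prop

lemma isDensity_rhoField (h : S.Standing) (x : Coeff N) (y : EuclideanSpace ℝ (Fin d)) :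
    S.IsDensity (S.wField x y) (S.ΦField x y) (S.rhoField x y) :=
  Mixture.isDensity_density h.one_le_m h.adm _ _

end Problem

/-! ### Production rates and semidefinite forms of gradients. -/

namespace Mixture

variable {m : ℕ} {S : Mixture m}

lemma measurable_mixEntropy : Measurable S.mixEntropy := by
  have h1 : Measurable S.ctot := by unfold ctot; fun_prop
  have h2 : ∀ i, Measurable fun ρ => S.molarFrac ρ i := fun i => by
    unfold molarFrac; fun_prop
  exact h1.mul (Finset.measurable_sum _ fun i _ => (h2 i).mul (h2 i).log)

lemma fracs_mem_Icc (hS : S.Admissible) (w : Fin m → ℝ) (φ : ℝ) :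
    S.fracs w φ ∈ Set.Icc (0 : Fin (m + 1) → ℝ) 1 :=
  ⟨fun i => (S.fracs_pos w φ i).le, fun i => by
    rw [Pi.one_apply, ← sum_fracs hS w φ]
    exact Finset.single_le_sum (fun j _ => (S.fracs_pos w φ j).le) (Finset.mem_univ i)⟩

lemma continuous_r_density (hm : 1 ≤ m) (hS : S.Admissible) (hprod : S.ProductionAssumption)
    (i : Fin (m + 1)) :
    Continuous fun p : (Fin m → ℝ) × ℝ => S.r i (S.molarFrac (S.density p.1 p.2)) := by
  simp only [molarFrac_density hm hS]
  exact (hprod.cont i).comp_continuous (continuous_pi fun j => continuous_fracs hS j)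
    fun p => fracs_mem_Icc hS p.1 p.2

lemma exists_r_bound (hm : 1 ≤ m) (hS : S.Admissible) (hprod : S.ProductionAssumption) :
    ∃ R : ℝ, ∀ i w φ, |S.r i (S.molarFrac (S.density w φ))| ≤ R := by
  have h1 : ∀ i, ∃ R, ∀ x ∈ Set.Icc (0 : Fin (m + 1) → ℝ) 1, ‖S.r i x‖ ≤ R := fun i =>
    isCompact_Icc.exists_bound_of_continuousOn (hprod.cont i)
  choose R hR using h1
  obtain ⟨i₀, hi₀⟩ := Finite.exists_max R
  refine ⟨R i₀, fun i w φ => ?_⟩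
  rw [molarFrac_density hm hS]
  exact (hR i _ (fracs_mem_Icc hS w φ)).trans (hi₀ i)

/-- The rates add up to zero, so `sum_mul_entropyVar` applies to them; its logarithmic part is
nonpositive by dissipativity, and the electric part is left. -/
lemma sum_r_mul_entropyVar_le (hm : 1 ≤ m) (hS : S.Admissible) (hprod : S.ProductionAssumption)
    (w : Fin m → ℝ) (φ φ₀ : ℝ) :
    ∑ i : Fin m, S.r i.castSucc (S.molarFrac (S.density w φ)) * (w i - S.relCharge i * φ₀)
      ≤ ∑ i, S.z i / S.M i * S.r i (S.molarFrac (S.density w φ)) * (φ - φ₀) := by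
  have hmem := fracs_mem_Icc hS w φ
  rw [sum_mul_entropyVar (isDensity_density hm hS w φ)
    (q := fun i => S.r i (S.molarFrac (S.density w φ))) (by
      rw [molarFrac_density hm hS]; exact hprod.sum_zero _ hmem), ← Finset.sum_mul,
    molarFrac_density hm hS]
  have := hprod.dissipative (S.fracs w φ) fun i => ⟨S.fracs_pos w φ i, hmem.2 i⟩
  simp only [mul_div_assoc] at this
  linarith

/-- Positive semidefinite matrices, acting on vector-valued functions. -/
lemma sum_sum_mul_inner_nonneg {d : ℕ} {B : Fin m → Fin m → ℝ}
    (hB : ∀ p : Fin m → ℝ, 0 ≤ ∑ i, ∑ j, B i j * (p i * p j))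
    (p : Fin m → EuclideanSpace ℝ (Fin d)) : 0 ≤ ∑ i, ∑ j, B i j * inner ℝ (p i) (p j) := by
  have : ∑ i, ∑ j, B i j * inner ℝ (p i) (p j) = ∑ c, ∑ i, ∑ j, B i j * (p i c * p j c) := by
    simp only [PiLp.inner_apply, RCLike.inner_apply, conj_trivial, Finset.mul_sum]
    conv_rhs => rw [Finset.sum_comm]
    refine Finset.sum_congr rfl fun i _ => ?_
    conv_rhs => rw [Finset.sum_comm]
    exact Finset.sum_congr rfl fun j _ => Finset.sum_congr rfl fun c _ => by ring
  rw [this]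
  exact Finset.sum_nonneg fun c _ => hB fun i => p i c

lemma neg_le_sum_sum_mul_inner {d : ℕ} {B : Fin m → Fin m → ℝ}
    (hB : ∀ p : Fin m → ℝ, 0 ≤ ∑ i, ∑ j, B i j * (p i * p j)) (hsymm : ∀ i j, B i j = B j i)
    (p q : Fin m → EuclideanSpace ℝ (Fin d)) :
    -(1 / 4) * ∑ i, ∑ j, B i j * inner ℝ (q i) (q j)
      ≤ ∑ i, ∑ j, B i j * inner ℝ (p i) (p j + q j) := by
  -- Completing the square: p·B(p + q) = (p + q/2)·B(p + q/2) - ¼ q·Bq for symmetric B.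
  have h1 := sum_sum_mul_inner_nonneg hB fun i => p i + (1 / 2 : ℝ) • q i
  have h2 : ∑ i, ∑ j, B i j * inner ℝ (q i) (p j) = ∑ i, ∑ j, B i j * inner ℝ (p i) (q j) := by
    rw [Finset.sum_comm]
    refine Finset.sum_congr rfl fun i _ => Finset.sum_congr rfl fun j _ => ?_
    rw [hsymm, real_inner_comm]
  have h3 : ∑ i, ∑ j, B i j * inner ℝ (p i + (1 / 2 : ℝ) • q i) (p j + (1 / 2 : ℝ) • q j)
      = ∑ i, ∑ j, B i j * inner ℝ (p i) (p j)
        + (1 / 2) * ∑ i, ∑ j, B i j * inner ℝ (p i) (q j)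
        + (1 / 2) * ∑ i, ∑ j, B i j * inner ℝ (q i) (p j)
        + (1 / 4) * ∑ i, ∑ j, B i j * inner ℝ (q i) (q j) := by
    simp only [Finset.mul_sum, ← Finset.sum_add_distrib]
    refine Finset.sum_congr rfl fun i _ => Finset.sum_congr rfl fun j _ => ?_
    simp only [inner_add_left, inner_add_right, real_inner_smul_left, real_inner_smul_right]
    ring
  have h4 : ∑ i, ∑ j, B i j * inner ℝ (p i) (p j + q j)
      = ∑ i, ∑ j, B i j * inner ℝ (p i) (p j) + ∑ i, ∑ j, B i j * inner ℝ (p i) (q j) := by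
    simp only [inner_add_right, mul_add, Finset.sum_add_distrib]
  rw [h3, h2] at h1
  rw [h4]
  linarith

end Mixture

/-! ### Fluxes, rates and charges as dominated families. -/

namespace Problem

variable {d m N : ℕ} {S : Problem d m N}

lemma LinGrowth.add {E' : Type*} [NormedAddCommGroup E']
    {A A' : Coeff N → EuclideanSpace ℝ (Fin d) → E'} (hA : S.LinGrowth A) (hA' : S.LinGrowth A') :
    S.LinGrowth fun x y => A x y + A' x y := by
  obtain ⟨K, hK, hb⟩ := hA.bound
  obtain ⟨K', hK', hb'⟩ := hA'.bound
  refine ⟨fun x => (hA.meas x).add (hA'.meas x), fun y => (hA.cont y).add (hA'.cont y), K + K',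
    by positivity, fun x => ?_⟩
  filter_upwards [hb x, hb' x] with y hy hy'
  refine (norm_add_le _ _).trans ((add_le_add hy hy').trans (le_of_eq ?_))
  ring

lemma linGrowth_zero {E' : Type*} [NormedAddCommGroup E'] :
    S.LinGrowth fun _ _ => (0 : E') :=
  ⟨fun _ => aestronglyMeasurable_const, fun _ => continuous_const, 0, le_rfl,
    fun _ => Eventually.of_forall fun _ => by simp⟩

lemma LinGrowth.sum {ι E' : Type*} [NormedAddCommGroup E'] (s : Finset ι)
    {A : ι → Coeff N → EuclideanSpace ℝ (Fin d) → E'} (hA : ∀ i, S.LinGrowth (A i)) :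
    S.LinGrowth fun x y => ∑ i ∈ s, A i x y := by
  classical
  induction s using Finset.induction_on with
  | empty => simpa using linGrowth_zero
  | insert j s hj ih => simpa only [Finset.sum_insert hj] using (hA j).add ih

variable (S) in
/-- The flux `∑_j B_ij ∇w_j`. -/
def flux (i : Fin m) (x : Coeff N) (y : EuclideanSpace ℝ (Fin d)) : EuclideanSpace ℝ (Fin d) :=
  ∑ j, S.B (S.rhoField x y) i j • S.wGrad x j y

variable (S) in
/-- The production rates of the ansatz. -/
def rate (i : Fin (m + 1)) (x : Coeff N) (y : EuclideanSpace ℝ (Fin d)) : ℝ :=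
  S.r i (S.molarFrac (S.rhoField x y))

variable (S) in
/-- The right-hand side of the Poisson equation. -/
def charge (x : Coeff N) (y : EuclideanSpace ℝ (Fin d)) : ℝ :=
  ∑ i, S.z i * (S.rhoField x y i / S.M i) + S.f y

lemma linGrowth_flux (h : S.Standing) (i : Fin m) : S.LinGrowth (S.flux i) := by
  obtain ⟨b, -, hb⟩ := Mixture.exists_B_bound h.adm h.diff
  refine LinGrowth.sum Finset.univ fun j => LinGrowth.bounded_smul
    (fun x => ?_) (fun y => ?_) (c := b) (fun x y => ?_) (linGrowth_wGrad h j)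
  · exact aestronglyMeasurable_comp_fields h x
      (Mixture.continuous_B_density h.one_le_m h.adm h.diff i j)
  · exact continuous_comp_fields y (Mixture.continuous_B_density h.one_le_m h.adm h.diff i j)
  · have hd := isDensity_rhoField h x y
    exact (hb _ hd.1 hd.2.1).2 i j

lemma linGrowth_rate (h : S.Standing) (i : Fin (m + 1)) : S.LinGrowth (S.rate i) := by
  obtain ⟨R, hR⟩ := Mixture.exists_r_bound h.one_le_m h.adm h.prod
  have hc := Mixture.continuous_r_density h.one_le_m h.adm h.prod i
  exact LinGrowth.of_bounded (fun x => aestronglyMeasurable_comp_fields h x hc)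
    (fun y => continuous_comp_fields y hc) (K := R)
    fun x => Eventually.of_forall fun y => hR i _ _

lemma linGrowth_rhoField (h : S.Standing) (i : Fin (m + 1)) :
    S.LinGrowth fun x y => S.rhoField x y i := by
  have hc := Mixture.continuous_density h.one_le_m h.adm i
  refine LinGrowth.of_bounded (fun x => aestronglyMeasurable_comp_fields h x hc)
    (fun y => continuous_comp_fields y hc) (K := 1) fun x => Eventually.of_forall fun y => ?_
  have := (isDensity_rhoField h x y).1 i
  rw [abs_of_pos this.1]
  exact this.2.le

lemma LinGrowth.const_mul {A : Coeff N → EuclideanSpace ℝ (Fin d) → ℝ} (hA : S.LinGrowth A)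
    (c : ℝ) : S.LinGrowth fun x y => c * A x y :=
  hA.bounded_smul (b := fun _ _ => c) (fun _ => aestronglyMeasurable_const)
    (fun _ => continuous_const) (c := |c|) fun _ _ => le_rfl

lemma linGrowth_charge (h : S.Standing) : S.LinGrowth S.charge := by
  have hA := (LinGrowth.sum Finset.univ fun i => (linGrowth_rhoField h i).const_mul
    (S.z i / S.M i)).add_const h.data.f_bdd.1 (c := 1)
      fun y => by rw [one_mul]; exact abs_f_le_envelope y
  have : S.charge = fun x y => ∑ i, S.z i / S.M i * S.rhoField x y i + S.f y := by
    ext x y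
    simp only [charge]
    congr 1
    exact Finset.sum_congr rfl fun i _ => by ring
  rw [this]; exact hA

/-! ### The previous time step -/

/-- What is used of the densities and the potential of the previous time step. -/
structure IsPrev (S : Problem d m N) (ρ : EuclideanSpace ℝ (Fin d) → Fin (m + 1) → ℝ)
    (Φ : EuclideanSpace ℝ (Fin d) → ℝ) : Prop where
  meas : ∀ i, AEMeasurable (fun y => ρ y i) S.vol
  nonneg : ∀ᵐ y ∂S.vol, ∀ i, 0 ≤ ρ y i
  sum : ∀ᵐ y ∂S.vol, ∑ i, ρ y i = 1
  memH1 : MemH1 S.Ω Φ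
  poisson : ∀ x : Coeff N, S.lam * ∫ y, inner ℝ (weakGrad S.Ω Φ y) (S.θGrad x y) ∂S.vol
    = ∫ y, (∑ i, S.z i * (ρ y i / S.M i) + S.f y) * S.θComb x y ∂S.vol

lemma weakGrad_θComb (h : S.Standing) (x : Coeff N) :
    weakGrad S.Ω (S.θComb x) =ᵐ[S.vol] S.θGrad x := (isH1Pair_θComb h x).weakGrad_ae_eq h.isOpen

/-- Only the last step matters, so no induction is needed. Initially the Poisson equation holds for
all of H¹_D, which contains P_N; later it is part of the scheme. -/
lemma IsIterate.isPrev (h : S.Standing) (hinit : S.IsInitialPotential) {k : ℕ}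
    {ρ : EuclideanSpace ℝ (Fin d) → Fin (m + 1) → ℝ} {Φ : EuclideanSpace ℝ (Fin d) → ℝ}
    (hk : S.IsIterate k ρ Φ) : S.IsPrev ρ Φ := by
  have key : ∀ (Φ : EuclideanSpace ℝ (Fin d) → ℝ) (x : Coeff N),
      ∫ y, inner ℝ (weakGrad S.Ω Φ y) (S.θGrad x y) ∂S.vol
        = ∫ y, inner ℝ (weakGrad S.Ω Φ y) (weakGrad S.Ω (S.θComb x) y) ∂S.vol := fun Φ x =>
    integral_congr_ae (by filter_upwards [weakGrad_θComb h x] with y hy; rw [hy])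
  cases hk with
  | zero =>
    exact ⟨h.data.ρ0_meas, h.data.ρ0_nonneg, h.data.ρ0_sum, hinit.mem, fun x => by
      rw [key]; exact hinit.weak _ (memH1D_θComb h x)⟩
  | @succ k ρ' Φ' w _ _ hstep =>
    obtain ⟨x, hx, -⟩ := exists_vComb_eq hstep.mem_V
    obtain ⟨x', hx', -⟩ := exists_θComb_eq hstep.mem_P
    have hw : w = S.wField x := by
      rw [sub_eq_iff_eq_add] at hx; rw [hx]; rfl
    have hΦ : Φ = S.ΦField x' := by
      rw [sub_eq_iff_eq_add] at hx'; rw [hx']; rfl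
    have hd : ∀ y, S.IsDensity (w y) (Φ y) (S.rho w Φ y) := fun y =>
      Mixture.isDensity_density h.one_le_m h.adm _ _
    have hwm : AEMeasurable (fun y => w y) S.vol := by
      rw [hw]
      exact aemeasurable_pi_lambda _ fun i => (isH1Pair_wField h x i).1.1.aemeasurable
    have hΦH : MemH1 S.Ω Φ := by rw [hΦ]; exact (isH1Pair_ΦField h x').memH1
    refine ⟨fun i => ?_, Eventually.of_forall fun y i => ((hd y).1 i).1.le,
      Eventually.of_forall fun y => (hd y).2.1, hΦH, fun x => by
        rw [key]; exact hstep.poisson _ (θComb_mem_P x)⟩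
    exact (Mixture.continuous_density h.one_le_m h.adm i).measurable.comp_aemeasurable
      (hwm.prodMk hΦH.1.1.aemeasurable)

/-! ### The residual of the scheme -/

variable (S) in
/-- Increments of the densities. -/
def incr (ρp : EuclideanSpace ℝ (Fin d) → Fin (m + 1) → ℝ) (i : Fin (m + 1)) (x : Coeff N)
    (y : EuclideanSpace ℝ (Fin d)) : ℝ := S.rhoField x y i - ρp y i

variable {ρp : EuclideanSpace ℝ (Fin d) → Fin (m + 1) → ℝ} {Φp : EuclideanSpace ℝ (Fin d) → ℝ}

lemma IsPrev.le_one (hp : S.IsPrev ρp Φp) : ∀ᵐ y ∂S.vol, ∀ i, ρp y i ≤ 1 := by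
  filter_upwards [hp.nonneg, hp.sum] with y hy hy' i
  rw [← hy']
  exact Finset.single_le_sum (fun j _ => hy j) (Finset.mem_univ i)

lemma linGrowth_incr (h : S.Standing) (hp : S.IsPrev ρp Φp) (i : Fin (m + 1)) :
    S.LinGrowth (S.incr ρp i) := by
  refine LinGrowth.of_bounded
    (fun x => ((linGrowth_rhoField h i).meas x).sub (hp.meas i).aestronglyMeasurable)
    (fun y => ((linGrowth_rhoField h i).cont y).sub continuous_const) (K := 1) fun x => ?_
  filter_upwards [hp.nonneg, hp.le_one] with y hy hy'
  have := (isDensity_rhoField h x y).1 i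
  rw [incr, abs_le]
  constructor <;> linarith [hy i, hy' i]

variable (S) in
/-- The pairing of two families of functions. -/
def pair {F : Type*} [NormedAddCommGroup F] [InnerProductSpace ℝ F]
    (A L : Coeff N → EuclideanSpace ℝ (Fin d) → F) (x ξ : Coeff N) : ℝ :=
  ∫ y, inner ℝ (A x y) (L ξ y) ∂S.vol

variable (S) in
/-- The residual of one time step, tested with the pair of functions with coefficients `ξ`. -/
def residual (ρp : EuclideanSpace ℝ (Fin d) → Fin (m + 1) → ℝ) (x ξ : Coeff N) : ℝ :=
  ∑ i : Fin m, S.pair (S.incr ρp i.castSucc) (fun x y => S.vComb x y i) x ξ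
    + S.τ * S.ε * ∑ i, S.pair (fun x y => S.vComb x y i) (fun x y => S.vComb x y i) x ξ
    + S.τ * ∑ i, S.pair (S.flux i) (fun x y => S.vGrad x i y) x ξ
    - S.τ * ∑ i : Fin m, S.pair (S.rate i.castSucc) (fun x y => S.vComb x y i) x ξ
    + S.lam * S.pair S.ΦGrad S.θGrad x ξ
    - S.pair S.charge S.θComb x ξ

/-- Linearity in the test coefficients, needed to represent the residual as the inner product of a
vector with ξ. -/
lemma pair_eq_sum (h : S.Standing) {F : Type*} [NormedAddCommGroup F] [InnerProductSpace ℝ F]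
    {A L : Coeff N → EuclideanSpace ℝ (Fin d) → F} (hA : S.LinGrowth A) (hL : S.LinGrowth L)
    (hlin : ∀ ξ y, L ξ y = ∑ k, ξ k • L (EuclideanSpace.single k 1) y) (x ξ : Coeff N) :
    S.pair A L x ξ = ∑ k, ξ k * S.pair A L x (EuclideanSpace.single k 1) := by
  simp only [pair]
  rw [integral_congr_ae (Eventually.of_forall fun y => by rw [hlin ξ y])]
  simp only [inner_sum, real_inner_smul_right]
  rw [integral_finsetSum _ fun k _ => (hA.integrable_inner h hL x _).const_mul _]
  simp only [integral_const_mul]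

lemma vComb_eq_sum (ξ : Coeff N) (y : EuclideanSpace ℝ (Fin d)) (i : Fin m) :
    S.vComb ξ y i = ∑ k, ξ k • S.vComb (EuclideanSpace.single k 1) y i := by
  simp [vComb, Fintype.sum_sum_type]

lemma vGrad_eq_sum (ξ : Coeff N) (y : EuclideanSpace ℝ (Fin d)) (i : Fin m) :
    S.vGrad ξ i y = ∑ k, ξ k • S.vGrad (EuclideanSpace.single k 1) i y := by
  simp [vGrad, Fintype.sum_sum_type]

lemma θComb_eq_sum (ξ : Coeff N) (y : EuclideanSpace ℝ (Fin d)) :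
    S.θComb ξ y = ∑ k, ξ k • S.θComb (EuclideanSpace.single k 1) y := by
  simp [θComb, Fintype.sum_sum_type]

lemma θGrad_eq_sum (ξ : Coeff N) (y : EuclideanSpace ℝ (Fin d)) :
    S.θGrad ξ y = ∑ k, ξ k • S.θGrad (EuclideanSpace.single k 1) y := by
  simp [θGrad, Fintype.sum_sum_type]

lemma residual_eq_sum (h : S.Standing) (hp : S.IsPrev ρp Φp) (x ξ : Coeff N) :
    S.residual ρp x ξ = ∑ k, ξ k * S.residual ρp x (EuclideanSpace.single k 1) := by
  have e1 := fun i : Fin m => pair_eq_sum h (linGrowth_incr h hp i.castSucc) (linGrowth_vComb h i)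
    (fun ξ y => vComb_eq_sum ξ y i) x ξ
  have e2 := fun i : Fin m => pair_eq_sum h (linGrowth_vComb h i) (linGrowth_vComb h i)
    (fun ξ y => vComb_eq_sum ξ y i) x ξ
  have e3 := fun i : Fin m => pair_eq_sum h (linGrowth_flux h i) (linGrowth_vGrad h i)
    (fun ξ y => vGrad_eq_sum ξ y i) x ξ
  have e4 := fun i : Fin m => pair_eq_sum h (linGrowth_rate h i.castSucc) (linGrowth_vComb h i)
    (fun ξ y => vComb_eq_sum ξ y i) x ξ
  have e5 := pair_eq_sum h (linGrowth_ΦGrad h) (linGrowth_θGrad h) θGrad_eq_sum x ξ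
  have e6 := pair_eq_sum h (linGrowth_charge h) (linGrowth_θComb h) θComb_eq_sum x ξ
  unfold residual
  simp only [e1, e2, e3, e4, e5, e6]
  simp only [Finset.sum_comm (s := (Finset.univ : Finset (Fin m))), Finset.mul_sum,
    ← Finset.sum_add_distrib, ← Finset.sum_sub_distrib]
  refine Finset.sum_congr rfl fun k _ => ?_
  rw [mul_sub, mul_add, Finset.mul_sum]
  congr 2
  · exact Finset.sum_congr rfl fun i _ => by ring
  · ring

lemma continuous_residual (h : S.Standing) (hp : S.IsPrev ρp Φp) (ξ : Coeff N) :
    Continuous fun x => S.residual ρp x ξ := by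
  have e1 := fun i : Fin m => (linGrowth_incr h hp i.castSucc).continuous_integral_inner h
    (linGrowth_vComb h i) ξ
  have e2 := fun i : Fin m => (linGrowth_vComb h i).continuous_integral_inner h
    (linGrowth_vComb h i) ξ
  have e3 := fun i : Fin m => (linGrowth_flux h i).continuous_integral_inner h
    (linGrowth_vGrad h i) ξ
  have e4 := fun i : Fin m => (linGrowth_rate h i.castSucc).continuous_integral_inner h
    (linGrowth_vComb h i) ξ
  have e5 := (linGrowth_ΦGrad h).continuous_integral_inner h (linGrowth_θGrad h) ξ
  have e6 := (linGrowth_charge h).continuous_integral_inner h (linGrowth_θComb h) ξ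
  unfold residual pair
  exact ((((((continuous_finsetSum _ fun i _ => e1 i).add
    ((continuous_finsetSum _ fun i _ => e2 i).const_mul _)).add
    ((continuous_finsetSum _ fun i _ => e3 i).const_mul _)).sub
    ((continuous_finsetSum _ fun i _ => e4 i).const_mul _)).add (e5.const_mul _)).sub e6)

end Problem

namespace Problem

variable {d m N : ℕ} {S : Problem d m N}
  {ρp : EuclideanSpace ℝ (Fin d) → Fin (m + 1) → ℝ} {Φp : EuclideanSpace ℝ (Fin d) → ℝ}

/-! ### The entropy inequality for the residual -/

lemma integrable_mixEntropy_rhoField (h : S.Standing) (x : Coeff N) :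
    Integrable (fun y => S.mixEntropy (S.rhoField x y)) S.vol := by
  have := h.isFiniteMeasure
  obtain ⟨c, hc⟩ := Mixture.exists_mixEntropy_bound h.adm
  refine (integrable_const c).mono' ?_ (Eventually.of_forall fun y => ?_)
  · have h1 : AEMeasurable (fun y => S.rhoField x y) S.vol :=
      aemeasurable_pi_lambda _ fun i => ((linGrowth_rhoField h i).meas x).aemeasurable
    exact (Mixture.measurable_mixEntropy.comp_aemeasurable h1).aestronglyMeasurable
  · have hd := isDensity_rhoField h x y
    exact hc _ (fun i => (hd.1 i).1.le) hd.2.1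

lemma IsPrev.integrable_mixEntropy (h : S.Standing) (hp : S.IsPrev ρp Φp) :
    Integrable (fun y => S.mixEntropy (ρp y)) S.vol := by
  have := h.isFiniteMeasure
  obtain ⟨c, hc⟩ := Mixture.exists_mixEntropy_bound h.adm
  refine (integrable_const c).mono' ?_ ?_
  · exact (Mixture.measurable_mixEntropy.comp_aemeasurable
      (aemeasurable_pi_lambda _ hp.meas)).aestronglyMeasurable
  · filter_upwards [hp.nonneg, hp.sum] with y hy hy'
    exact hc _ hy hy'

lemma wField_sub (x : Coeff N) (y : EuclideanSpace ℝ (Fin d)) (i : Fin m) :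
    S.wField x y i - S.relCharge i * S.ΦD y = S.vComb x y i := by
  simp [wField, wD]

lemma ΦField_sub (x : Coeff N) (y : EuclideanSpace ℝ (Fin d)) :
    S.ΦField x y - S.ΦD y = S.θComb x y := by
  simp [ΦField]

variable (S) in
/-- Increments of the total charge. -/
def chargeIncr (ρp : EuclideanSpace ℝ (Fin d) → Fin (m + 1) → ℝ) (x : Coeff N)
    (y : EuclideanSpace ℝ (Fin d)) : ℝ := ∑ i, S.z i / S.M i * S.incr ρp i x y

lemma linGrowth_chargeIncr (h : S.Standing) (hp : S.IsPrev ρp Φp) :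
    S.LinGrowth (S.chargeIncr ρp) :=
  LinGrowth.sum Finset.univ fun i => (linGrowth_incr h hp i).const_mul _

lemma sum_pair_eq_integral (h : S.Standing) {F : Type*} [NormedAddCommGroup F]
    [InnerProductSpace ℝ F] {A L : Fin m → Coeff N → EuclideanSpace ℝ (Fin d) → F}
    (hA : ∀ i, S.LinGrowth (A i)) (hL : ∀ i, S.LinGrowth (L i)) (x ξ : Coeff N) :
    ∑ i, S.pair (A i) (L i) x ξ = ∫ y, ∑ i, inner ℝ (A i x y) (L i ξ y) ∂S.vol :=
  (integral_finsetSum _ fun i _ => (hA i).integrable_inner h (hL i) x ξ).symm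

lemma integrable_sum_inner (h : S.Standing) {F : Type*} [NormedAddCommGroup F]
    [InnerProductSpace ℝ F] {A L : Fin m → Coeff N → EuclideanSpace ℝ (Fin d) → F}
    (hA : ∀ i, S.LinGrowth (A i)) (hL : ∀ i, S.LinGrowth (L i)) (x ξ : Coeff N) :
    Integrable (fun y => ∑ i, inner ℝ (A i x y) (L i ξ y)) S.vol :=
  integrable_finsetSum _ fun i _ => (hA i).integrable_inner h (hL i) x ξ

/-- Pointwise Gibbs inequality. The density increments of all n species add up to zero, so u = w -
w_D may be replaced by the log x_i / M_i at the price of the term with Φ - Φ_D. -/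
lemma le_sum_pair_incr (h : S.Standing) (hp : S.IsPrev ρp Φp) (x : Coeff N) :
    ∫ y, S.mixEntropy (S.rhoField x y) ∂S.vol - ∫ y, S.mixEntropy (ρp y) ∂S.vol
        + S.pair (S.chargeIncr ρp) S.θComb x x
      ≤ ∑ i : Fin m, S.pair (S.incr ρp i.castSucc) (fun x y => S.vComb x y i) x x := by
  have hi := fun i : Fin m => linGrowth_incr h hp i.castSucc
  have hc := (linGrowth_chargeIncr h hp).integrable_inner h (linGrowth_θComb h) x x
  have h1 := integrable_mixEntropy_rhoField h x
  have h2 := hp.integrable_mixEntropy h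
  have h12 : Integrable (fun y => S.mixEntropy (S.rhoField x y) - S.mixEntropy (ρp y)) S.vol :=
    h1.sub h2
  rw [sum_pair_eq_integral h hi (linGrowth_vComb h), pair, ← integral_sub h1 h2,
    ← integral_add h12 hc]
  refine integral_mono_ae (h12.add hc)
    (integrable_sum_inner h hi (linGrowth_vComb h) x x) ?_
  filter_upwards [hp.nonneg, hp.sum] with y hy hy'
  have hd := isDensity_rhoField h x y
  have h3 := Mixture.mixEntropy_sub_le h.adm (fun i => (hd.1 i).1) hd.2.1 hy hy'
  have h4 := Mixture.sum_mul_entropyVar hd (q := fun i => S.incr ρp i x y) (by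
    simp only [incr]; rw [Finset.sum_sub_distrib, hd.2.1, hy', sub_self]) (S.ΦD y)
  simp only [wField_sub, ΦField_sub] at h4
  simp only [RCLike.inner_apply, conj_trivial, chargeIncr]
  simp only [mul_comm (S.vComb x y _), h4]
  simp only [incr] at h3 ⊢
  linarith

/-- The background charge f drops out of the increment, and the previous Poisson equation expresses
the old charge by the old potential. The increment term cancels with the one in `le_sum_pair_incr`.
-/
lemma pair_charge_eq (h : S.Standing) (hp : S.IsPrev ρp Φp) (x : Coeff N) :
    S.pair S.charge S.θComb x x = S.pair (S.chargeIncr ρp) S.θComb x x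
      + S.lam * ∫ y, inner ℝ (weakGrad S.Ω Φp y) (S.θGrad x y) ∂S.vol := by
  have h1 := (linGrowth_charge h).integrable_inner h (linGrowth_θComb h) x x
  have h2 := (linGrowth_chargeIncr h hp).integrable_inner h (linGrowth_θComb h) x x
  rw [hp.poisson, pair, pair, ← sub_eq_iff_eq_add', ← integral_sub h1 h2]
  refine integral_congr_ae (Eventually.of_forall fun y => ?_)
  simp only [RCLike.inner_apply, conj_trivial]
  rw [← mul_sub, mul_comm]
  congr 1
  simp only [charge, chargeIncr, incr, mul_sub, Finset.sum_sub_distrib]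
  simp only [div_mul_eq_mul_div, mul_div_assoc]
  ring

variable (S) in
/-- The squared norm of the gradient of the deviation from the boundary potential. -/
def prevEnergy (Φp : EuclideanSpace ℝ (Fin d) → ℝ) : ℝ :=
  ∫ y, ‖weakGrad S.Ω (fun y => Φp y - S.ΦD y) y‖ ^ 2 ∂S.vol

lemma integrable_prevEnergy (h : S.Standing) (hp : S.IsPrev ρp Φp) :
    Integrable (fun y => ‖weakGrad S.Ω (fun y => Φp y - S.ΦD y) y‖ ^ 2) S.vol :=
  ((hp.memH1.isH1Pair.sub h.data.ΦD_H1.isH1Pair).memH1.isH1Pair.2.integrable_norm_pow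
    two_ne_zero)

/-- This is a·(a - b) ≥ ½|a|² - ½|b|² with a and b the gradients of the new and old deviations from
Φ_D. -/
lemma le_pair_ΦGrad (h : S.Standing) (hp : S.IsPrev ρp Φp) (x : Coeff N) :
    1 / 2 * S.pair S.θGrad S.θGrad x x - 1 / 2 * S.prevEnergy Φp
      ≤ S.pair S.ΦGrad S.θGrad x x
        - ∫ y, inner ℝ (weakGrad S.Ω Φp y) (S.θGrad x y) ∂S.vol := by
  have hsub := hp.memH1.isH1Pair.sub h.data.ΦD_H1.isH1Pair
  have h1 := (linGrowth_θGrad h).integrable_inner h (linGrowth_θGrad h) x x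
  have h2 := (linGrowth_ΦGrad h).integrable_inner h (linGrowth_θGrad h) x x
  have h3 : Integrable (fun y => inner ℝ (weakGrad S.Ω Φp y) (S.θGrad x y)) S.vol :=
    (hp.memH1.isH1Pair.2.norm.integrable_mul (isH1Pair_θComb h x).2.norm).mono'
      (hp.memH1.isH1Pair.2.1.inner (isH1Pair_θComb h x).2.1)
      (Eventually.of_forall fun y => norm_inner_le_norm _ _)
  have h4 := integrable_prevEnergy h hp
  rw [pair, pair, prevEnergy, ← integral_sub h2 h3, ← integral_const_mul, ← integral_const_mul,
    ← integral_sub (h1.const_mul _) (h4.const_mul _)]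
  refine integral_mono_ae ((h1.const_mul _).sub (h4.const_mul _)) (h2.sub h3) ?_
  filter_upwards [hsub.weakGrad_ae_eq h.isOpen] with y hy
  have e1 : S.ΦGrad x y = S.θGrad x y + weakGrad S.Ω S.ΦD y := rfl
  simp only [hy, e1, real_inner_self_eq_norm_sq, ← inner_sub_left]
  have e2 : S.θGrad x y + weakGrad S.Ω S.ΦD y - weakGrad S.Ω Φp y
      = S.θGrad x y - (weakGrad S.Ω Φp y - weakGrad S.Ω S.ΦD y) := by abel
  rw [e2]
  set a := S.θGrad x y
  set b := weakGrad S.Ω Φp y - weakGrad S.Ω S.ΦD y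
  rw [inner_sub_left, real_inner_self_eq_norm_sq]
  have := norm_sub_sq_real b a
  nlinarith [sq_nonneg ‖b - a‖]

variable (S) in
/-- The diffusive dissipation. -/
def dissipation (x : Coeff N) : ℝ := ∑ i, S.pair (S.flux i) (fun x y => S.vGrad x i y) x x

variable (S) in
/-- The squared norm of `u = w - w_D`. -/
def sqNorm (x : Coeff N) : ℝ :=
  ∑ i : Fin m, S.pair (fun x y => S.vComb x y i) (fun x y => S.vComb x y i) x x

variable (S) in
/-- The power of the production terms. -/
def power (x : Coeff N) : ℝ :=
  ∑ i : Fin m, S.pair (S.rate i.castSucc) (fun x y => S.vComb x y i) x x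

/-- Discrete entropy inequality for an arbitrary ansatz, with the residual as defect. It serves
twice: as coercivity estimate before a solution is known, and as the final entropy inequality. -/
lemma le_residual_self (h : S.Standing) (hp : S.IsPrev ρp Φp) (x : Coeff N) :
    (∫ y, S.mixEntropy (S.rhoField x y) ∂S.vol + S.lam / 2 * S.pair S.θGrad S.θGrad x x)
        - (∫ y, S.mixEntropy (ρp y) ∂S.vol + S.lam / 2 * S.prevEnergy Φp)
        + S.τ * S.ε * S.sqNorm x + S.τ * S.dissipation x - S.τ * S.power x
      ≤ S.residual ρp x x := by
  have h1 := le_sum_pair_incr h hp x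
  have h2 := pair_charge_eq h hp x
  have h3 := mul_le_mul_of_nonneg_left (le_pair_ΦGrad h hp x) h.lam_pos.le
  unfold residual
  simp only [sqNorm, dissipation, power]
  rw [h2]
  linarith

/-! ### Coercivity -/

/-- The boundary part of ∇w spoils the sign; completing the square leaves -¼∇w_D : B∇w_D, which is
bounded independently of x as B is bounded. -/
lemma exists_le_dissipation (h : S.Standing) : ∃ C : ℝ, ∀ x, -C ≤ S.dissipation x := by
  obtain ⟨b, hb0, hb⟩ := Mixture.exists_B_bound h.adm h.diff
  set K : ℝ := 1 / 4 * ∑ i : Fin m, ∑ j : Fin m, b * (|S.relCharge i| * |S.relCharge j|) with hK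
  refine ⟨∫ y, K * S.envelope y ^ 2 ∂S.vol, fun x => ?_⟩
  rw [dissipation, sum_pair_eq_integral h (linGrowth_flux h) (linGrowth_vGrad h), ← integral_neg]
  refine integral_mono ((integrable_envelope_sq h).const_mul K).neg
    (integrable_sum_inner h (linGrowth_flux h) (linGrowth_vGrad h) x x) fun y => ?_
  have hd := isDensity_rhoField h x y
  have hB := hb _ hd.1 hd.2.1
  have h1 := Mixture.neg_le_sum_sum_mul_inner hB.1 (Mixture.B_symm h.adm hd.1 hd.2.1)
    (fun i => S.vGrad x i y) (fun i => S.relCharge i • weakGrad S.Ω S.ΦD y)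
  have h2 : ∑ i, inner ℝ (S.flux i x y) (S.vGrad x i y)
      = ∑ i, ∑ j, S.B (S.rhoField x y) i j * inner ℝ (S.vGrad x i y)
        (S.vGrad x j y + S.relCharge j • weakGrad S.Ω S.ΦD y) := by
    refine Finset.sum_congr rfl fun i _ => ?_
    simp only [flux, sum_inner, real_inner_smul_left]
    exact Finset.sum_congr rfl fun j _ => by rw [real_inner_comm, wGrad]
  simp only
  rw [h2]
  refine le_trans ?_ h1
  have h3 : ∑ i, ∑ j, S.B (S.rhoField x y) i j * inner ℝ (S.relCharge i • weakGrad S.Ω S.ΦD y)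
      (S.relCharge j • weakGrad S.Ω S.ΦD y)
      ≤ (∑ i : Fin m, ∑ j : Fin m, b * (|S.relCharge i| * |S.relCharge j|))
        * S.envelope y ^ 2 := by
    simp only [Finset.sum_mul]
    refine Finset.sum_le_sum fun i _ => Finset.sum_le_sum fun j _ => ?_
    rw [real_inner_smul_left, real_inner_smul_right, real_inner_self_eq_norm_sq]
    refine (le_abs_self _).trans ?_
    rw [abs_mul, abs_mul, abs_mul, abs_of_nonneg (sq_nonneg ‖weakGrad S.Ω S.ΦD y‖), mul_assoc b,
      mul_assoc |S.relCharge i|]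
    have := norm_grad_ΦD_le_envelope (S := S) y
    have := hB.2 i j
    gcongr
  rw [hK]
  linarith

/-- Young's inequality with bounded rates; half of the regularizing ε-term is spent on the
absorption. Dissipativity is not enough here, as its remainder grows with Φ. -/
lemma exists_power_le (h : S.Standing) : ∃ C : ℝ, ∀ x, S.power x ≤ S.ε / 2 * S.sqNorm x + C := by
  have := h.isFiniteMeasure
  have hε := h.ε_pos
  obtain ⟨R, hR⟩ := Mixture.exists_r_bound h.one_le_m h.adm h.prod
  set K : ℝ := ∑ _i : Fin m, R ^ 2 / (2 * S.ε) with hK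
  refine ⟨∫ _, K ∂S.vol, fun x => ?_⟩
  have hr := fun i : Fin m => linGrowth_rate h i.castSucc
  have h2 := integrable_sum_inner h (linGrowth_vComb h) (linGrowth_vComb h) x x
  rw [power, sqNorm, sum_pair_eq_integral h hr (linGrowth_vComb h),
    sum_pair_eq_integral h (linGrowth_vComb h) (linGrowth_vComb h), ← integral_const_mul,
    ← integral_add (h2.const_mul _) (integrable_const K)]
  refine integral_mono (integrable_sum_inner h hr (linGrowth_vComb h) x x)
    ((h2.const_mul _).add (integrable_const K)) fun y => ?_
  simp only [Finset.mul_sum, hK, ← Finset.sum_add_distrib]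
  refine Finset.sum_le_sum fun i _ => ?_
  simp only [RCLike.inner_apply, conj_trivial]
  have h3 : |S.rate i.castSucc x y| ≤ R := hR _ _ _
  have h4 : S.rate i.castSucc x y ^ 2 ≤ R ^ 2 := by
    rw [← sq_abs]; exact pow_le_pow_left₀ (abs_nonneg _) h3 2
  have h5 : S.vComb x y i * S.rate i.castSucc x y
      ≤ S.ε / 2 * (S.vComb x y i * S.vComb x y i) + S.rate i.castSucc x y ^ 2 / (2 * S.ε) := by
    have h6 : S.ε / 2 * (S.vComb x y i * S.vComb x y i) + S.rate i.castSucc x y ^ 2 / (2 * S.ε)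
        - S.vComb x y i * S.rate i.castSucc x y
        = (S.ε * S.vComb x y i - S.rate i.castSucc x y) ^ 2 / (2 * S.ε) := by
      field_simp; ring
    have : 0 ≤ (S.ε * S.vComb x y i - S.rate i.castSucc x y) ^ 2 / (2 * S.ε) := by positivity
    linarith
  refine h5.trans ?_
  gcongr

variable (S) in
/-- The quadratic form that controls the residual from below. -/
def coercForm (x : Coeff N) : ℝ :=
  S.τ * S.ε / 2 * S.sqNorm x + S.lam / 2 * S.pair S.θGrad S.θGrad x x

lemma exists_coercForm_sub_le (h : S.Standing) (hp : S.IsPrev ρp Φp) :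
    ∃ C : ℝ, ∀ x, S.coercForm x - C ≤ S.residual ρp x x := by
  have := h.isFiniteMeasure
  obtain ⟨C₁, h1⟩ := exists_le_dissipation h
  obtain ⟨C₂, h2⟩ := exists_power_le h
  obtain ⟨c, hc⟩ := Mixture.exists_mixEntropy_bound h.adm
  have h3 : ∀ x, ∫ _, -c ∂S.vol ≤ ∫ y, S.mixEntropy (S.rhoField x y) ∂S.vol := fun x =>
    integral_mono (integrable_const _) (integrable_mixEntropy_rhoField h x) fun y => by
      have hd := isDensity_rhoField h x y
      exact neg_le_of_abs_le (hc _ (fun i => (hd.1 i).1.le) hd.2.1)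
  refine ⟨(∫ y, S.mixEntropy (ρp y) ∂S.vol + S.lam / 2 * S.prevEnergy Φp) - ∫ _, -c ∂S.vol
    + S.τ * C₁ + S.τ * C₂, fun x => ?_⟩
  have h4 := le_residual_self h hp x
  have h5 := mul_le_mul_of_nonneg_left (h1 x) h.τ_pos.le
  have h6 := mul_le_mul_of_nonneg_left (h2 x) h.τ_pos.le
  have h7 := h3 x
  unfold coercForm
  linarith

lemma pair_self_nonneg {F : Type*} [NormedAddCommGroup F] [InnerProductSpace ℝ F]
    (A : Coeff N → EuclideanSpace ℝ (Fin d) → F) (x : Coeff N) : 0 ≤ S.pair A A x x :=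
  integral_nonneg fun _ => real_inner_self_nonneg

lemma sqNorm_nonneg (x : Coeff N) : 0 ≤ S.sqNorm x :=
  Finset.sum_nonneg fun i _ => pair_self_nonneg (fun x y => S.vComb x y i) x

lemma ae_eq_zero_of_pair_self {F : Type*} [NormedAddCommGroup F] [InnerProductSpace ℝ F]
    (h : S.Standing) {A : Coeff N → EuclideanSpace ℝ (Fin d) → F} (hA : S.LinGrowth A)
    {x : Coeff N} (h0 : S.pair A A x x = 0) : A x =ᵐ[S.vol] 0 := by
  have := (integral_eq_zero_iff_of_nonneg (fun _ => real_inner_self_nonneg)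
    (hA.integrable_inner h hA x x)).1 h0
  filter_upwards [this] with y hy
  exact inner_self_eq_zero.1 hy

lemma pair_eq_zero {F : Type*} [NormedAddCommGroup F] [InnerProductSpace ℝ F]
    (A : Coeff N → EuclideanSpace ℝ (Fin d) → F) {L : Coeff N → EuclideanSpace ℝ (Fin d) → F}
    (x : Coeff N) {ξ : Coeff N} (hL : L ξ =ᵐ[S.vol] 0) : S.pair A L x ξ = 0 := by
  refine integral_eq_zero_of_ae ?_
  filter_upwards [hL] with y hy
  rw [hy, Pi.zero_apply, Pi.zero_apply, inner_zero_right]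

/-- Both test functions vanish almost everywhere: u as its L² norm does, hence also its gradient,
and the potential part by vanishing gradient and trace. Dependent spanning functions do no harm for
this reason. -/
lemma residual_eq_zero_of_coercForm (h : S.Standing) {ξ : Coeff N} (h0 : S.coercForm ξ = 0)
    (x : Coeff N) : S.residual ρp x ξ = 0 := by
  have h1 := S.sqNorm_nonneg ξ
  have h2 := S.pair_self_nonneg S.θGrad ξ
  have h3 : 0 < S.τ * S.ε / 2 := by have := h.τ_pos; have := h.ε_pos; positivity
  have h4 : 0 < S.lam / 2 := half_pos h.lam_pos
  have h5 : S.sqNorm ξ = 0 := by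
    have := mul_nonneg h3.le h1
    have := mul_nonneg h4.le h2
    have h6 : S.τ * S.ε / 2 * S.sqNorm ξ = 0 := by unfold coercForm at h0; linarith
    exact (mul_eq_zero.1 h6).resolve_left h3.ne'
  have h6 : S.pair S.θGrad S.θGrad ξ ξ = 0 := by
    unfold coercForm at h0
    rw [h5, mul_zero, zero_add] at h0
    exact (mul_eq_zero.1 h0).resolve_left h4.ne'
  have hv : ∀ i, (fun y => S.vComb ξ y i) =ᵐ[S.vol] 0 := fun i =>
    ae_eq_zero_of_pair_self h (linGrowth_vComb h i) ((Finset.sum_eq_zero_iff_of_nonneg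
      fun i _ => pair_self_nonneg (fun x y => S.vComb x y i) ξ).1 h5 i (Finset.mem_univ i))
  have hvG : ∀ i, (fun y => S.vGrad ξ i y) =ᵐ[S.vol] 0 := fun i =>
    ((isH1Pair_vComb h ξ i).weakGrad_ae_eq h.isOpen).symm.trans
      (weakGrad_ae_eq_zero h.isOpen (hv i))
  have hθG : S.θGrad ξ =ᵐ[S.vol] 0 := ae_eq_zero_of_pair_self h (linGrowth_θGrad h) h6
  have hθ : S.θComb ξ =ᵐ[S.vol] 0 :=
    (memH1D_θComb h ξ).ae_eq_zero h.isOpen h.domain.connected h.domain.bounded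
      h.domain.lipschitz (h.domain.boundary ▸ Set.subset_union_left) h.domain.meas_pos
      ((weakGrad_θComb h ξ).trans hθG)
  unfold residual
  rw [Finset.sum_eq_zero fun i _ => pair_eq_zero _ x (hv i),
    Finset.sum_eq_zero fun i _ => pair_eq_zero _ x (hv i),
    Finset.sum_eq_zero fun i _ => pair_eq_zero _ x (hvG i),
    Finset.sum_eq_zero fun i _ => pair_eq_zero _ x (hv i),
    pair_eq_zero _ x hθG, pair_eq_zero _ x hθ]
  ring

lemma vComb_smul (t : ℝ) (x : Coeff N) (y : EuclideanSpace ℝ (Fin d)) (i : Fin m) :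
    S.vComb (t • x) y i = t * S.vComb x y i := by
  simp [vComb, Finset.mul_sum, mul_assoc]

lemma θGrad_smul (t : ℝ) (x : Coeff N) (y : EuclideanSpace ℝ (Fin d)) :
    S.θGrad (t • x) y = t • S.θGrad x y := by
  simp [θGrad, Finset.smul_sum, smul_smul]

lemma coercForm_smul (t : ℝ) (x : Coeff N) : S.coercForm (t • x) = t ^ 2 * S.coercForm x := by
  have h1 : S.sqNorm (t • x) = t ^ 2 * S.sqNorm x := by
    simp only [sqNorm, Finset.mul_sum, pair, ← integral_const_mul]
    refine Finset.sum_congr rfl fun i _ => integral_congr_ae (Eventually.of_forall fun y => ?_)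
    simp only [vComb_smul, RCLike.inner_apply, conj_trivial]
    ring
  have h2 : S.pair S.θGrad S.θGrad (t • x) (t • x) = t ^ 2 * S.pair S.θGrad S.θGrad x x := by
    simp only [pair, ← integral_const_mul]
    refine integral_congr_ae (Eventually.of_forall fun y => ?_)
    simp only [θGrad_smul, real_inner_smul_left, real_inner_smul_right]
    ring
  unfold coercForm
  rw [h1, h2]; ring

lemma continuous_coercForm (h : S.Standing) : Continuous S.coercForm :=
  ((continuous_finsetSum _ fun i _ =>
    (linGrowth_vComb h i).continuous_integral_inner_self h).const_mul _).add
    (((linGrowth_θGrad h).continuous_integral_inner_self h).const_mul _)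

/-- Solvability of one time step. -/
lemma exists_residual_eq_zero (h : S.Standing) (hp : S.IsPrev ρp Φp) :
    ∃ x : Coeff N, ∀ ξ, S.residual ρp x ξ = 0 := by
  obtain ⟨C, hC⟩ := exists_coercForm_sub_le h hp
  -- The Riesz representative of ξ ↦ `residual ρp x ξ`.
  set F : Coeff N → Coeff N := fun x =>
    WithLp.toLp 2 fun k => S.residual ρp x (EuclideanSpace.single k 1) with hF
  have hinner : ∀ x ξ, inner ℝ (F x) ξ = S.residual ρp x ξ := fun x ξ => by
    rw [residual_eq_sum h hp x ξ, PiLp.inner_apply]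
    exact Finset.sum_congr rfl fun k _ => by simp [hF]
  obtain ⟨x, hx⟩ := exists_zero_of_coercive (F := F) (Q := S.coercForm) (C := C)
    ((PiLp.continuous_toLp 2 _).comp (continuous_pi fun k => continuous_residual h hp _))
    (continuous_coercForm h)
    (fun x => add_nonneg
      (mul_nonneg (by have := h.τ_pos; have := h.ε_pos; positivity) (sqNorm_nonneg x))
      (mul_nonneg (half_pos h.lam_pos).le (pair_self_nonneg _ x)))
    coercForm_smul (fun ξ h0 x => by rw [hinner]; exact residual_eq_zero_of_coercForm h h0 x)
    (fun x => by rw [hinner]; exact hC x)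
  exact ⟨x, fun ξ => by rw [← hinner, hx, inner_zero_left]⟩

end Problem

namespace Problem

variable {d m N : ℕ} {S : Problem d m N}
  {ρp : EuclideanSpace ℝ (Fin d) → Fin (m + 1) → ℝ} {Φp : EuclideanSpace ℝ (Fin d) → ℝ}

/-! ### From the residual to the scheme -/

lemma diffusion_ae_eq (h : S.Standing) (x ξ : Coeff N) :
    S.diffusion (S.rhoField x) (S.vComb ξ) (S.wField x)
      =ᵐ[S.vol] fun y => ∑ i, inner ℝ (S.flux i x y) (S.vGrad ξ i y) := by
  have h1 := ae_all_iff.2 fun i => (isH1Pair_vComb h ξ i).weakGrad_ae_eq h.isOpen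
  have h2 := ae_all_iff.2 fun i => (isH1Pair_wField h x i).weakGrad_ae_eq h.isOpen
  filter_upwards [h1, h2] with y hy hy'
  simp only [diffusion, hy, hy', flux, sum_inner, real_inner_smul_left]
  exact Finset.sum_congr rfl fun i _ => Finset.sum_congr rfl fun j _ => by rw [real_inner_comm]

lemma integrable_diffusion (h : S.Standing) (x ξ : Coeff N) :
    Integrable (S.diffusion (S.rhoField x) (S.vComb ξ) (S.wField x)) S.vol :=
  (integrable_sum_inner h (linGrowth_flux h) (linGrowth_vGrad h) x ξ).congr
    (diffusion_ae_eq h x ξ).symm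

lemma integral_diffusion (h : S.Standing) (x ξ : Coeff N) :
    ∫ y, S.diffusion (S.rhoField x) (S.vComb ξ) (S.wField x) y ∂S.vol
      = ∑ i, S.pair (S.flux i) (fun x y => S.vGrad x i y) x ξ := by
  rw [sum_pair_eq_integral h (linGrowth_flux h) (linGrowth_vGrad h)]
  exact integral_congr_ae (diffusion_ae_eq h x ξ)

lemma sum_pair_eq_integral_mul (h : S.Standing) {A L : Fin m → Coeff N →
    EuclideanSpace ℝ (Fin d) → ℝ} (hA : ∀ i, S.LinGrowth (A i)) (hL : ∀ i, S.LinGrowth (L i))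
    (x ξ : Coeff N) : ∑ i, S.pair (A i) (L i) x ξ = ∫ y, ∑ i, A i x y * L i ξ y ∂S.vol := by
  rw [sum_pair_eq_integral h hA hL]
  simp only [RCLike.inner_apply, conj_trivial, mul_comm]

lemma wField_sub_wD (x : Coeff N) : S.wField x - S.wD = S.vComb x := by
  ext y i; simp [wField]

lemma ΦField_sub_ΦD (x : Coeff N) : S.ΦField x - S.ΦD = S.θComb x := by
  ext y; simp [ΦField]

/-- Test coefficients without potential part remove the Poisson residual; division by τ restores the
scaling of the scheme. `poisson_of_residual` uses the complementary block. -/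
lemma mass_of_residual (h : S.Standing) (hp : S.IsPrev ρp Φp) {x ξ : Coeff N}
    (hx : S.residual ρp x ξ = 0) (hξ : ∀ j, ξ (Sum.inr j) = 0) :
    1 / S.τ * (∫ y, ∑ i : Fin m,
        (S.rhoField x y i.castSucc - ρp y i.castSucc) * S.vComb ξ y i ∂S.vol)
      + S.ε * (∫ y, ∑ i : Fin m, (S.wField x y i - S.wD y i) * S.vComb ξ y i ∂S.vol)
      + ∫ y, S.diffusion (S.rhoField x) (S.vComb ξ) (S.wField x) y ∂S.vol
    = ∫ y, ∑ i : Fin m, S.r i.castSucc (S.molarFrac (S.rhoField x y)) * S.vComb ξ y i ∂S.vol := by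
  have e1 := sum_pair_eq_integral_mul h (fun i : Fin m => linGrowth_incr h hp i.castSucc)
    (linGrowth_vComb h) x ξ
  have e2 := sum_pair_eq_integral_mul h (linGrowth_vComb h) (linGrowth_vComb h) x ξ
  have e3 := integral_diffusion h x ξ
  have e4 := sum_pair_eq_integral_mul h (fun i : Fin m => linGrowth_rate h i.castSucc)
    (linGrowth_vComb h) x ξ
  have e5 : S.pair S.ΦGrad S.θGrad x ξ = 0 :=
    pair_eq_zero _ x (Eventually.of_forall fun y => by simp [θGrad, hξ])
  have e6 : S.pair S.charge S.θComb x ξ = 0 :=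
    pair_eq_zero _ x (Eventually.of_forall fun y => by simp [θComb, hξ])
  have hw : ∀ y i, S.wField x y i - S.wD y i = S.vComb x y i := fun y i => wField_sub x y i
  simp only [hw]
  simp only [incr] at e1
  simp only [rate] at e4
  rw [← e1, ← e2, e3, ← e4]
  have hτ := h.τ_pos.ne'
  unfold residual at hx
  rw [e5, e6] at hx
  field_simp
  linear_combination hx

lemma poisson_of_residual (h : S.Standing) {x ξ : Coeff N}
    (hx : S.residual ρp x ξ = 0) (hξ : ∀ j, ξ (Sum.inl j) = 0) :
    S.lam * (∫ y, inner ℝ (weakGrad S.Ω (S.ΦField x) y) (weakGrad S.Ω (S.θComb ξ) y) ∂S.vol)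
      = ∫ y, (∑ i, S.z i * (S.rhoField x y i / S.M i) + S.f y) * S.θComb ξ y ∂S.vol := by
  have hv : ∀ i, (fun y => S.vComb ξ y i) =ᵐ[S.vol] 0 := fun i =>
    Eventually.of_forall fun y => by simp [vComb, hξ]
  have hvG : ∀ i, (fun y => S.vGrad ξ i y) =ᵐ[S.vol] 0 := fun i =>
    Eventually.of_forall fun y => by simp [vGrad, hξ]
  have e1 : S.pair S.ΦGrad S.θGrad x ξ
      = ∫ y, inner ℝ (weakGrad S.Ω (S.ΦField x) y) (weakGrad S.Ω (S.θComb ξ) y) ∂S.vol := by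
    refine integral_congr_ae ?_
    filter_upwards [(isH1Pair_ΦField h x).weakGrad_ae_eq h.isOpen, weakGrad_θComb h ξ]
      with y hy hy'
    rw [hy, hy']
  have e2 : S.pair S.charge S.θComb x ξ
      = ∫ y, (∑ i, S.z i * (S.rhoField x y i / S.M i) + S.f y) * S.θComb ξ y ∂S.vol := by
    simp only [pair, RCLike.inner_apply, conj_trivial, charge, mul_comm]
  rw [← e1, ← e2]
  unfold residual at hx
  rw [Finset.sum_eq_zero fun i _ => pair_eq_zero _ x (hv i),
    Finset.sum_eq_zero fun i _ => pair_eq_zero _ x (hv i),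
    Finset.sum_eq_zero fun i _ => pair_eq_zero _ x (hvG i),
    Finset.sum_eq_zero fun i _ => pair_eq_zero _ x (hv i)] at hx
  linarith

lemma isStep_of_residual (h : S.Standing) (hp : S.IsPrev ρp Φp) {x : Coeff N}
    (hx : ∀ ξ, S.residual ρp x ξ = 0) : S.IsStep ρp (S.wField x) (S.ΦField x) where
  mem_V := by rw [wField_sub_wD]; exact vComb_mem_V x
  mem_P := by rw [ΦField_sub_ΦD]; exact θComb_mem_P x
  integrable φ hφ := by
    obtain ⟨ξ, rfl, -⟩ := exists_vComb_eq hφ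
    exact integrable_diffusion h x ξ
  mass φ hφ := by
    obtain ⟨ξ, rfl, hξ⟩ := exists_vComb_eq hφ
    exact mass_of_residual h hp (hx ξ) hξ
  poisson θ hθ := by
    obtain ⟨ξ, rfl, hξ⟩ := exists_θComb_eq hθ
    exact poisson_of_residual h (hx ξ) hξ

lemma IsPrev.integrable_entropyDensity (h : S.Standing) (hp : S.IsPrev ρp Φp) :
    Integrable (S.entropyDensity ρp Φp) S.vol :=
  (hp.integrable_mixEntropy h).add ((integrable_prevEnergy h hp).const_mul _)

lemma IsPrev.entropy_eq (h : S.Standing) (hp : S.IsPrev ρp Φp) :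
    S.entropy ρp Φp = ∫ y, S.mixEntropy (ρp y) ∂S.vol + S.lam / 2 * S.prevEnergy Φp := by
  rw [prevEnergy, ← integral_const_mul,
    ← integral_add (hp.integrable_mixEntropy h) ((integrable_prevEnergy h hp).const_mul _)]
  rfl

lemma entropyDensity_ae_eq (h : S.Standing) (x : Coeff N) :
    S.entropyDensity (S.rhoField x) (S.ΦField x) =ᵐ[S.vol] fun y =>
      S.mixEntropy (S.rhoField x y) + S.lam / 2 * inner ℝ (S.θGrad x y) (S.θGrad x y) := by
  have h1 : (fun y => S.ΦField x y - S.ΦD y) = S.θComb x := ΦField_sub_ΦD x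
  filter_upwards [weakGrad_θComb h x] with y hy
  simp only [entropyDensity, h1, hy, real_inner_self_eq_norm_sq]
  rfl

lemma integrable_entropyDensity (h : S.Standing) (x : Coeff N) :
    Integrable (S.entropyDensity (S.rhoField x) (S.ΦField x)) S.vol :=
  ((integrable_mixEntropy_rhoField h x).add (((linGrowth_θGrad h).integrable_inner h
    (linGrowth_θGrad h) x x).const_mul _)).congr (entropyDensity_ae_eq h x).symm

lemma entropy_eq (h : S.Standing) (x : Coeff N) :
    S.entropy (S.rhoField x) (S.ΦField x)
      = ∫ y, S.mixEntropy (S.rhoField x y) ∂S.vol + S.lam / 2 * S.pair S.θGrad S.θGrad x x := by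
  rw [pair, ← integral_const_mul, ← integral_add (integrable_mixEntropy_rhoField h x)
    (((linGrowth_θGrad h).integrable_inner h (linGrowth_θGrad h) x x).const_mul _)]
  exact integral_congr_ae (entropyDensity_ae_eq h x)

/-- Unlike `exists_power_le`, this uses dissipativity and keeps the full ε-term for the final
inequality. -/
lemma power_le (h : S.Standing) (x : Coeff N) :
    S.power x ≤ ∫ y, ∑ i, S.z i / S.M i * S.r i (S.molarFrac (S.rhoField x y))
      * (S.ΦField x y - S.ΦD y) ∂S.vol := by
  have hr := fun i : Fin m => linGrowth_rate h i.castSucc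
  have h1 := integrable_sum_inner h hr (linGrowth_vComb h) x x
  rw [power, sum_pair_eq_integral h hr (linGrowth_vComb h)]
  refine integral_mono h1 (integrable_finsetSum _ fun i _ => ?_) fun y => ?_
  · refine (((linGrowth_rate h i).integrable_inner h (linGrowth_θComb h) x x).const_mul
      (S.z i / S.M i)).congr (Eventually.of_forall fun y => ?_)
    simp only [ΦField_sub, RCLike.inner_apply, conj_trivial, rate]
    ring
  · have h2 := Mixture.sum_r_mul_entropyVar_le h.one_le_m h.adm h.prod (S.wField x y)
      (S.ΦField x y) (S.ΦD y)
    simp only [wField_sub] at h2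
    simp only [RCLike.inner_apply, conj_trivial, mul_comm (S.vComb x y _)]
    exact h2

/-- The solution's own coefficients are admissible test coefficients, since u and Φ - Φ_D lie in the
Galerkin spaces. -/
lemma entropy_inequality (h : S.Standing) (hp : S.IsPrev ρp Φp) {x : Coeff N}
    (hx : S.residual ρp x x = 0) :
    S.entropy (S.rhoField x) (S.ΦField x)
        + S.τ * (∫ y, S.diffusion (S.rhoField x) (S.wField x - S.wD) (S.wField x) y ∂S.vol)
        + S.ε * S.τ * (∫ y, ∑ i, (S.wField x y i - S.wD y i) ^ 2 ∂S.vol)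
      ≤ S.τ * (∫ y, ∑ i, S.z i / S.M i * S.r i (S.molarFrac (S.rhoField x y))
            * (S.ΦField x y - S.ΦD y) ∂S.vol)
        + S.entropy ρp Φp := by
  have h1 := le_residual_self h hp x
  have h2 := mul_le_mul_of_nonneg_left (power_le h x) h.τ_pos.le
  have h3 : ∫ y, ∑ i, (S.wField x y i - S.wD y i) ^ 2 ∂S.vol = S.sqNorm x := by
    rw [sqNorm, sum_pair_eq_integral_mul h (linGrowth_vComb h) (linGrowth_vComb h)]
    simp only [wField, add_sub_cancel_right, sq]
  rw [wField_sub_wD, integral_diffusion h, h3, entropy_eq h, hp.entropy_eq h]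
  rw [hx] at h1
  unfold dissipation at h1
  linarith

end Problem

end PMS

end

theorem theorem1p1 {d m N : ℕ} (hd : 1 ≤ d) (hm : 1 ≤ m) (S : PMS.Problem d m N)
    (hlam : 0 < S.lam) (hτ : 0 < S.τ) (hε : 0 < S.ε)
    (hS : S.toMixture.Admissible)
    (hdomain : S.DomainAssumption)
    (hdata : S.DataAssumption)
    (hdiff : S.toMixture.DiffusionAssumption)
    (hprod : S.toMixture.ProductionAssumption)
    (hgal : S.GalerkinAssumption)
    (hinit : S.IsInitialPotential)
    (k : ℕ) (hk : 1 ≤ k)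
    (ρprev : EuclideanSpace ℝ (Fin d) → Fin (m + 1) → ℝ)
    (Φprev : EuclideanSpace ℝ (Fin d) → ℝ)
    (hprev : S.IsIterate (k - 1) ρprev Φprev) :
    ∃ (w : EuclideanSpace ℝ (Fin d) → Fin m → ℝ) (Φ : EuclideanSpace ℝ (Fin d) → ℝ),
      S.IsStep ρprev w Φ ∧
      (∀ y ∈ S.Ω, ∀ i, 0 < S.rho w Φ y i ∧ S.rho w Φ y i < 1) ∧
      (∀ y ∈ S.Ω, ∑ i, S.rho w Φ y i = 1) ∧
      MeasureTheory.IntegrableOn (S.entropyDensity ρprev Φprev) S.Ω ∧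
      MeasureTheory.IntegrableOn (S.entropyDensity (S.rho w Φ) Φ) S.Ω ∧
      S.entropy (S.rho w Φ) Φ
          + S.τ * (∫ y in S.Ω, S.diffusion (S.rho w Φ) (w - S.wD) w y)
          + S.ε * S.τ * (∫ y in S.Ω, ∑ i, (w y i - S.wD y i) ^ 2)
        ≤ S.τ * (∫ y in S.Ω, ∑ i, S.z i / S.M i
              * S.r i (S.molarFrac (S.rho w Φ y)) * (Φ y - S.ΦD y))
          + S.entropy ρprev Φprev := by
  have h : S.Standing := ⟨hm, hlam, hτ, hε, hS, hdomain, hdata, hdiff, hprod, hgal⟩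
  have hp := hprev.isPrev h hinit
  obtain ⟨x, hx⟩ := PMS.Problem.exists_residual_eq_zero h hp
  exact ⟨S.wField x, S.ΦField x, PMS.Problem.isStep_of_residual h hp hx,
    fun y _ => (PMS.Problem.isDensity_rhoField h x y).1,
    fun y _ => (PMS.Problem.isDensity_rhoField h x y).2.1,
    hp.integrable_entropyDensity h, PMS.Problem.integrable_entropyDensity h x,
    PMS.Problem.entropy_inequality h hp (hx x)⟩
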